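/- Let $M,N,n\ge 1$ be integers, $\Gamma=\mathbb Z/M\mathbb Z\times\mathbb Z/N\mathbb Z$, and let $\tau$ be a point of the upper half-plane. Let $\mathfrak t=\mathfrak t_{1,n}^\Gamma$ be the complex Lie algebra with generators $x_i,y_i$ ($1\le i\le n$) and $t_{ij}^\alpha$ ($\alpha\in\Gamma$, $i\ne j$) and relations, for pairwise distinct $i,j,k,l$ and $\alpha,\beta\in\Gamma$: $t_{ij}^\alpha=t_{ji}^{-\alpha}$; $[x_i,y_j]=[x_j,y_i]=\sum_{\alpha}t_{ij}^\alpha$; $[x_i,x_j]=[y_i,y_j]=0$; $[x_i,y_i]=-\sum_{j\neq i}\sum_\alpha t_{ij}^\alpha$; $[t_{ij}^\alpha,t_{kl}^\beta]=0$; $[x_i,t_{jk}^\alpha]=[y_i,t_{jk}^\alpha]=0$; $[t_{ij}^\alpha,t_{ik}^{\alpha+\beta}+t_{jk}^\beta]=0$; $[x_i+x_j,t_{ij}^\alpha]=[y_i+y_j,t_{ij}^\alpha]=0$. It is graded with $x_i,y_i$ in degree $1$ and $t_{ij}^\alpha$ in degree $2$. Let $\bar{\mathfrak t}$ be the quotient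 of $\mathfrak t$ by $\sum_ix_i$ and $\sum_iy_i$, let $\hat{\mathfrak t}$ and $\hat{\bar{\mathfrak t}}$ be the degree completions, and $\exp(\hat{\mathfrak t})$, $\exp(\hat{\bar{\mathfrak t}})$ the corresponding pro-unipotent groups. Let $Y=\{\mathbf z\in\mathbb C^n : z_i-z_j\notin\frac1M\mathbb Z+\frac\tau N\mathbb Z \text{ for all } i\ne j\}$ and $\Lambda=\mathbb Z+\tau\mathbb Z$. Let $\mathcal P$ be the principal $\exp(\hat{\mathfrak t})$-bundle $\Lambda^n\backslash\big(Y\times\exp(\hat{\mathfrak t})\big)$ over the twisted configuration space $\Lambda^n\backslash Y$, where $(a_i+b_i\tau)_i$ acts by $(\mathbf z,g)\mapsto\big((z_i+a_i+b_i\tau)_i,\;e^{-2\pi\mathrm i\sum_i b_ix_i}g\big)$. Let $\bar Y$ be the image of $Y$ in $\mathbb C^n/\mathbb C(1,\dots,1)$, and let $\bar{\mathcal P}=\Lambda^n\backslash\big(\bar Y\times\exp(\hat{\bar{\mathfrak t}})\big)$ be the principal $\exp(\hat{\bar{\mathfrak t}})$-bundle over $\Lambda^n\backslash\bar Y$ obtained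 in the same way from the images of the $x_i$ in $\bar{\mathfrak t}$. Let $\theta$ be the unique entire function with zero set $\Lambda$ such that $\theta(z+1)=-\theta(z)=\theta(-z)$, $\theta(z+\tau)=-e^{-\pi\mathrm i\tau}e^{-2\pi\mathrm iz}\theta(z)$ and $\theta'(0)=1$. For $\alpha\in\Gamma$ choose a lift $\tilde\alpha=a_0+a\tau\in\frac1M\mathbb Z+\frac\tau N\mathbb Z$ (with $a_0=u/M$ and $a=v/N$ if $\alpha=(\bar u,\bar v)$) and put $$k_\alpha(x,z)=e^{-2\pi\mathrm iax}\frac{\theta(z-\tilde\alpha+x)}{\theta(z-\tilde\alpha)\theta(x)}-\frac1x,$$ which is independent of the lift and is expanded as a power series in $x$ at $x=0$. Put $$K_{ij}(z)=\sum_{\alpha\in\Gamma}k_\alpha(\operatorname{ad}x_i,z)(t_{ij}^\alpha),\qquad K_i(\mathbf z)=-y_i+\sum_{j\ne i}K_{ij}(z_i-z_j)\in\hat{\mathfrak t}.$$ **Theorem.** The $K_i$ are meromorphic on $\mathbb C^n$, with poles only on the complement of $Y$, and $\nabla=d-\sum_{i=1}^nK_i(\mathbf z)\,dz_i$ on $Y\times\exp(\hat{\mathfrak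 t})$ descends to a flat holomorphic connection on $\mathcal P$. Moreover its image under $\hat{\mathfrak t}\to\hat{\bar{\mathfrak t}}$ is the pull-back of a flat holomorphic connection $\bar\nabla$ on $\bar{\mathcal P}$. -/

import Mathlib

open scoped Topology UpperHalfPlane

noncomputable section

namespace EllKZB

/-! ### Lie algebras with weighted generators, degree completion, exponential group -/

/-- A generating family of a complex Lie algebra, with a positive weight for each generator. -/
structure WeightedGens (L : Type) [LieRing L] [LieAlgebra ℂ L] where
  Idx : Type
  gen : Idx → L
  wt : Idx → ℕ
  wt_pos : ∀ i, 0 < wt i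
  lieSpan_gen : LieSubalgebra.lieSpan ℂ L (Set.range gen) = ⊤

namespace WeightedGens

variable {L : Type} [LieRing L] [LieAlgebra ℂ L] (W : WeightedGens L)

/-- `W.Mono e u`: `u` is an iterated bracket of generators of total weight `e`. -/
inductive Mono : ℕ → L → Prop
  | gen (i : W.Idx) : Mono (W.wt i) (W.gen i)
  | lie {p q : ℕ} {a b : L} : Mono p a → Mono q b → Mono (p + q) ⁅a, b⁆

/-- The linear span of all iterated brackets of generators of total weight at least `d`. -/
def monoSpan (d : ℕ) : Submodule ℂ L :=
  Submodule.span ℂ {u | ∃ e, d ≤ e ∧ W.Mono e u}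

theorem Mono.pos {e : ℕ} {u : L} (h : W.Mono e u) : 0 < e := by
  induction h with
  | gen i => exact W.wt_pos i
  | lie _ _ h1 h2 => omega

theorem monoSpan_anti {d e : ℕ} (h : d ≤ e) : W.monoSpan e ≤ W.monoSpan d :=
  Submodule.span_mono fun _ ⟨k, hk, hu⟩ => ⟨k, h.trans hk, hu⟩

theorem lie_mem_monoSpan {p q : ℕ} {a b : L} (ha : a ∈ W.monoSpan p) (hb : b ∈ W.monoSpan q) :
    ⁅a, b⁆ ∈ W.monoSpan (p + q) := by
  unfold monoSpan at ha
  induction ha using Submodule.span_induction with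
  | zero => simp
  | add x y _ _ hx hy => rw [add_lie]; exact add_mem hx hy
  | smul c x _ hx => rw [smul_lie]; exact Submodule.smul_mem _ _ hx
  | mem x hx =>
    obtain ⟨e, he, hxe⟩ := hx
    unfold monoSpan at hb
    induction hb using Submodule.span_induction with
    | zero => simp
    | add x y _ _ hx hy => rw [lie_add]; exact add_mem hx hy
    | smul c x _ hx => rw [lie_smul]; exact Submodule.smul_mem _ _ hx
    | mem y hy =>
      obtain ⟨f, hf, hyf⟩ := hy
      exact Submodule.subset_span ⟨e + f, by omega, Mono.lie hxe hyf⟩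

theorem monoSpan_one : W.monoSpan 1 = ⊤ := by
  let S : LieSubalgebra ℂ L :=
    { W.monoSpan 1 with
      lie_mem' := fun {_ _} ha hb => W.monoSpan_anti (by omega) (W.lie_mem_monoSpan ha hb) }
  have h : LieSubalgebra.lieSpan ℂ L (Set.range W.gen) ≤ S := by
    rw [LieSubalgebra.lieSpan_le]
    rintro _ ⟨i, rfl⟩
    exact Submodule.subset_span ⟨W.wt i, W.wt_pos i, Mono.gen i⟩
  rw [W.lieSpan_gen] at h
  exact eq_top_iff.2 fun u _ => h (LieSubalgebra.mem_top u)

/-- The ideal of elements of degree at least `d`. -/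
def fil (d : ℕ) : LieIdeal ℂ L :=
  { W.monoSpan d with
    lie_mem := fun {x _} hm => by
      have hx : x ∈ W.monoSpan 1 := by rw [W.monoSpan_one]; trivial
      exact W.monoSpan_anti (by omega) (W.lie_mem_monoSpan hx hm) }

theorem mem_fil {d : ℕ} {u : L} : u ∈ W.fil d ↔ u ∈ W.monoSpan d := Iff.rfl

/-- The truncation `L / (degree ≥ d)`. -/
abbrev Trunc (d : ℕ) : Type := L ⧸ W.fil d

/-- The class of `u` in the truncation `L / (degree ≥ d)`. -/
def proj (d : ℕ) (u : L) : W.Trunc d := LieSubmodule.Quotient.mk u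

theorem proj_surj (d : ℕ) (a : W.Trunc d) : ∃ u, W.proj d u = a :=
  LieSubmodule.Quotient.surjective_mk' (W.fil d) a

theorem proj_eq_zero {d : ℕ} {u : L} : W.proj d u = 0 ↔ u ∈ W.monoSpan d :=
  LieSubmodule.Quotient.mk_eq_zero'

theorem proj_add (d : ℕ) (u v : L) : W.proj d (u + v) = W.proj d u + W.proj d v := rfl
theorem proj_smul (d : ℕ) (c : ℂ) (u : L) : W.proj d (c • u) = c • W.proj d u := rfl
theorem proj_lie (d : ℕ) (u v : L) : W.proj d ⁅u, v⁆ = ⁅W.proj d u, W.proj d v⁆ := rfl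

/-- The degree completion of `L`, the inverse limit of the truncations `L / (degree ≥ d)`: families
whose components of index `d + 1` and `d` have a common representative in `L`. -/
def hatSubmodule : Submodule ℂ (∀ d, W.Trunc d) where
  carrier := {f | ∀ d, ∃ r : L, f (d + 1) = W.proj (d + 1) r ∧ f d = W.proj d r}
  zero_mem' := fun _ => ⟨0, rfl, rfl⟩
  add_mem' := fun {f g} hf hg d => by
    obtain ⟨r, h1, h2⟩ := hf d
    obtain ⟨s, h3, h4⟩ := hg d
    exact ⟨r + s, by simp [h1, h3, proj_add], by simp [h2, h4, proj_add]⟩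
  smul_mem' := fun c f hf d => by
    obtain ⟨r, h1, h2⟩ := hf d
    exact ⟨c • r, by simp [h1, proj_smul], by simp [h2, proj_smul]⟩

/-- The degree completion of `L`. -/
abbrev Hat : Type := ↥W.hatSubmodule

instance : LieRing W.Hat where
  bracket a b := ⟨fun d => ⁅a.1 d, b.1 d⁆, fun d => by
    obtain ⟨r, h1, h2⟩ := a.2 d
    obtain ⟨s, h3, h4⟩ := b.2 d
    exact ⟨⁅r, s⁆, by simp only [h1, h3, proj_lie], by simp only [h2, h4, proj_lie]⟩⟩
  add_lie a b c := Subtype.ext (funext fun d => add_lie (a.1 d) (b.1 d) (c.1 d))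
  lie_add a b c := Subtype.ext (funext fun d => lie_add (a.1 d) (b.1 d) (c.1 d))
  lie_self a := Subtype.ext (funext fun d => lie_self (a.1 d))
  leibniz_lie a b c := Subtype.ext (funext fun d => leibniz_lie (a.1 d) (b.1 d) (c.1 d))

instance : LieAlgebra ℂ W.Hat where
  lie_smul c a b := Subtype.ext (funext fun d => lie_smul c (a.1 d) (b.1 d))

theorem hat_lie_apply (a b : W.Hat) (d : ℕ) : ⁅a, b⁆.1 d = ⁅a.1 d, b.1 d⁆ := rfl

/-- The canonical map from `L` to its completion. -/
def toHat : L →ₗ[ℂ] W.Hat where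
  toFun u := ⟨fun d => W.proj d u, fun _ => ⟨u, rfl, rfl⟩⟩
  map_add' _ _ := rfl
  map_smul' _ _ := rfl

theorem proj_ad_pow (d m : ℕ) (a u : L) :
    W.proj d (((LieAlgebra.ad ℂ L a) ^ m) u) =
      ((LieAlgebra.ad ℂ (W.Trunc d) (W.proj d a)) ^ m) (W.proj d u) := by
  induction m with
  | zero => simp
  | succ m ih => simp only [pow_succ', Module.End.mul_apply, LieAlgebra.ad_apply, proj_lie, ih]

theorem ad_pow_mem (m : ℕ) (a u : L) : ((LieAlgebra.ad ℂ L a) ^ m) u ∈ W.monoSpan m := by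
  induction m with
  | zero => exact W.monoSpan_anti (Nat.zero_le 1) (by rw [W.monoSpan_one]; trivial)
  | succ m ih =>
    rw [pow_succ', Module.End.mul_apply, LieAlgebra.ad_apply, add_comm]
    exact W.lie_mem_monoSpan (by rw [W.monoSpan_one]; trivial) ih

theorem ad_pow_eq_zero (d : ℕ) (a : W.Trunc d) : (LieAlgebra.ad ℂ (W.Trunc d) a) ^ d = 0 := by
  ext u
  obtain ⟨a, rfl⟩ := W.proj_surj d a
  obtain ⟨u, rfl⟩ := W.proj_surj d u
  rw [← proj_ad_pow]
  exact W.proj_eq_zero.2 (W.ad_pow_mem d a u)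

theorem adSeries_mem (c : ℕ → ℂ) (a u : W.Hat) :
    (fun d => ∑ m ∈ Finset.range d, c m • ((LieAlgebra.ad ℂ (W.Trunc d) (a.1 d)) ^ m) (u.1 d))
      ∈ W.hatSubmodule := by
  intro d
  obtain ⟨r, h1, h2⟩ := a.2 d
  obtain ⟨s, h3, h4⟩ := u.2 d
  have key : ∀ e, W.proj e (∑ m ∈ Finset.range (d + 1), c m • ((LieAlgebra.ad ℂ L r) ^ m) s) =
      ∑ m ∈ Finset.range (d + 1),
        c m • ((LieAlgebra.ad ℂ (W.Trunc e) (W.proj e r)) ^ m) (W.proj e s) := by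
    intro e
    have hs : ∀ v, W.proj e v = (LieSubmodule.Quotient.mk' (W.fil e)) v := fun _ => rfl
    rw [hs, map_sum]
    refine Finset.sum_congr rfl fun m _ => ?_
    rw [map_smul, ← hs, proj_ad_pow]
  refine ⟨∑ m ∈ Finset.range (d + 1), c m • ((LieAlgebra.ad ℂ L r) ^ m) s, ?_, ?_⟩
  · rw [key]; simp only [h1, h3]
  · rw [key, Finset.sum_range_succ, ad_pow_eq_zero]; simp only [h2, h4]; simp

/-- For `a`, `u` in the completion and a formal power series `f = ∑ c m X ^ m`, the element
`f (ad a) u = ∑ m, c m • (ad a) ^ m u` of the completion.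
(In `L / (degree ≥ d)` one has `(ad a) ^ d = 0`, so the sum is finite there.) -/
def adSeries (c : ℕ → ℂ) (a u : W.Hat) : W.Hat :=
  ⟨fun d => ∑ m ∈ Finset.range d, c m • ((LieAlgebra.ad ℂ (W.Trunc d) (a.1 d)) ^ m) (u.1 d),
    W.adSeries_mem c a u⟩

/-! #### The exponential group -/

attribute [local instance] LieRing.ofAssociativeRing

/-- The relations that kill, in the enveloping algebra, the words in the generators of total weight
at least `d`. -/
inductive WordRel (d : ℕ) : UniversalEnvelopingAlgebra ℂ (W.Trunc d) →
    UniversalEnvelopingAlgebra ℂ (W.Trunc d) → Prop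
  | mk (l : List W.Idx) (h : d ≤ (l.map W.wt).sum) :
      WordRel d ((l.map fun i => UniversalEnvelopingAlgebra.ι ℂ (W.proj d (W.gen i))).prod) 0

/-- The enveloping algebra of `L` truncated in degrees `≥ d`. -/
abbrev UTrunc (d : ℕ) : Type := RingQuot (W.WordRel d)

/-- The canonical map from the truncated Lie algebra to the truncated enveloping algebra. -/
def toUTrunc (d : ℕ) : W.Trunc d →ₗ[ℂ] W.UTrunc d :=
  (RingQuot.mkAlgHom ℂ (W.WordRel d)).toLinearMap ∘ₗ
    (UniversalEnvelopingAlgebra.ι ℂ : W.Trunc d →ₗ⁅ℂ⁆ _).toLinearMap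

/-- The algebra in which the exponentials of elements of `L / (degree ≥ d)` are formed: the
truncated enveloping algebra, together with the endomorphisms of `L / (degree ≥ d)`. -/
abbrev RepAlg (d : ℕ) : Type := W.UTrunc d × Module.End ℂ (W.Trunc d)

/-- The representation `u ↦ (u, ad u)`. Its first component is already faithful
(Poincaré–Birkhoff–Witt); the second one records the adjoint action. -/
def rep (d : ℕ) : W.Trunc d →ₗ[ℂ] W.RepAlg d :=
  (W.toUTrunc d).prod (LieAlgebra.ad ℂ (W.Trunc d)).toLinearMap

/-- The span of the words of weight at least `e` in the truncated enveloping algebra. -/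
def wordSpan (d e : ℕ) : Submodule ℂ (W.UTrunc d) :=
  Submodule.span ℂ {w | ∃ l : List W.Idx, e ≤ (l.map W.wt).sum ∧
    w = (l.map fun i => W.toUTrunc d (W.proj d (W.gen i))).prod}

theorem wordSpan_mul {d p q : ℕ} {a b : W.UTrunc d} (ha : a ∈ W.wordSpan d p)
    (hb : b ∈ W.wordSpan d q) : a * b ∈ W.wordSpan d (p + q) := by
  unfold wordSpan at ha
  induction ha using Submodule.span_induction with
  | zero => simp
  | add x y _ _ hx hy => rw [add_mul]; exact add_mem hx hy
  | smul c x _ hx => rw [smul_mul_assoc]; exact Submodule.smul_mem _ _ hx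
  | mem x hx =>
    obtain ⟨l, hl, rfl⟩ := hx
    unfold wordSpan at hb
    induction hb using Submodule.span_induction with
    | zero => simp
    | add x y _ _ hx hy => rw [mul_add]; exact add_mem hx hy
    | smul c x _ hx => rw [mul_smul_comm]; exact Submodule.smul_mem _ _ hx
    | mem y hy =>
      obtain ⟨k, hk, rfl⟩ := hy
      exact Submodule.subset_span ⟨l ++ k, by simp; omega, by simp⟩

theorem wordSpan_self (d : ℕ) {a : W.UTrunc d} (ha : a ∈ W.wordSpan d d) : a = 0 := by
  unfold wordSpan at ha
  induction ha using Submodule.span_induction with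
  | zero => rfl
  | add x y _ _ hx hy => rw [hx, hy, add_zero]
  | smul c x _ hx => rw [hx, smul_zero]
  | mem x hx =>
    obtain ⟨l, hl, rfl⟩ := hx
    have h := RingQuot.mkAlgHom_rel ℂ (WordRel.mk (W := W) (d := d) l hl)
    rw [map_zero, map_list_prod, List.map_map] at h
    exact h

theorem toUTrunc_lie (d : ℕ) (a b : W.Trunc d) :
    W.toUTrunc d ⁅a, b⁆ = W.toUTrunc d a * W.toUTrunc d b - W.toUTrunc d b * W.toUTrunc d a := by
  simp [toUTrunc, LieRing.of_associative_ring_bracket]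

theorem toUTrunc_mem (d : ℕ) (a : W.Trunc d) : W.toUTrunc d a ∈ W.wordSpan d 1 := by
  obtain ⟨a, rfl⟩ := W.proj_surj d a
  have ha : a ∈ W.monoSpan 1 := by rw [W.monoSpan_one]; trivial
  unfold monoSpan at ha
  induction ha using Submodule.span_induction with
  | zero => rw [show W.proj d 0 = 0 from rfl, map_zero]; exact zero_mem _
  | add x y _ _ hx hy => rw [proj_add, map_add]; exact add_mem hx hy
  | smul c x _ hx => rw [proj_smul, map_smul]; exact Submodule.smul_mem _ _ hx
  | mem x hx =>
    obtain ⟨e, -, hx⟩ := hx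
    have anti : ∀ {k : ℕ}, W.wordSpan d (1 + k) ≤ W.wordSpan d 1 := fun {k} =>
      Submodule.span_mono fun _ ⟨l, hl, hw⟩ => ⟨l, by omega, hw⟩
    induction hx with
    | gen i => exact Submodule.subset_span ⟨[i], by simpa using Nat.succ_le_of_lt (W.wt_pos i), by simp⟩
    | lie _ _ h1 h2 =>
      rw [proj_lie, toUTrunc_lie]
      exact sub_mem (anti (W.wordSpan_mul h1 h2)) (anti (W.wordSpan_mul h2 h1))

theorem rep_pow_eq_zero (d : ℕ) (a : W.Trunc d) : (W.rep d a) ^ d = 0 := by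
  have h : ∀ m, (W.toUTrunc d a) ^ m ∈ W.wordSpan d m := by
    intro m
    induction m with
    | zero => exact Submodule.subset_span ⟨[], by simp, by simp⟩
    | succ m ih => rw [pow_succ]; exact W.wordSpan_mul ih (W.toUTrunc_mem d a)
  exact Prod.ext (W.wordSpan_self d (h d)) (W.ad_pow_eq_zero d a)

/-- The exponential series in the truncation of index `d`. -/
def expTrunc (d : ℕ) (a : W.Trunc d) : W.RepAlg d :=
  ∑ k ∈ Finset.range d, (k.factorial : ℂ)⁻¹ • (W.rep d a) ^ k

theorem expTrunc_mul_neg (d : ℕ) (a : W.Trunc d) : W.expTrunc d a * W.expTrunc d (-a) = 1 := by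
  let _ : Module ℚ (W.RepAlg d) := Module.compHom _ (algebraMap ℚ ℂ)
  have h : ∀ b : W.Trunc d, W.expTrunc d b = IsNilpotent.exp (W.rep d b) := by
    intro b
    rw [IsNilpotent.exp_eq_sum (W.rep_pow_eq_zero d b)]
    refine Finset.sum_congr rfl fun k _ => ?_
    change _ = (algebraMap ℚ ℂ ((k.factorial : ℚ)⁻¹)) • (W.rep d b) ^ k
    simp
  rw [h, h, map_neg]
  exact IsNilpotent.exp_mul_exp_neg_self ⟨d, W.rep_pow_eq_zero d a⟩

/-- The exponential of an element of the completion. -/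
def expUnit (u : W.Hat) : ∀ d, (W.RepAlg d)ˣ := fun d =>
  ⟨W.expTrunc d (u.1 d), W.expTrunc d (-u.1 d), W.expTrunc_mul_neg d _, by
    simpa using W.expTrunc_mul_neg d (-u.1 d)⟩

/-- The exponential group of the completion, as the group generated by all exponentials. (By the
Baker–Campbell–Hausdorff formula the exponentials already form a group.) -/
def ExpGroup : Subgroup (∀ d, (W.RepAlg d)ˣ) := Subgroup.closure (Set.range W.expUnit)

/-- The exponential map. -/
def exp (u : W.Hat) : W.ExpGroup := ⟨W.expUnit u, Subgroup.subset_closure ⟨u, rfl⟩⟩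

theorem expUnit_snd (u w : W.Hat) (d : ℕ) :
    ((W.expUnit u d : W.RepAlg d)).2 (w.1 d) =
      (W.adSeries (fun k => (k.factorial : ℂ)⁻¹) u w).1 d := by
  have h : ∀ k, ((W.rep d (u.1 d)) ^ k).2 = (LieAlgebra.ad ℂ (W.Trunc d) (u.1 d)) ^ k := by
    intro k; rw [Prod.pow_snd]; rfl
  change (W.expTrunc d (u.1 d)).2 (w.1 d) = ∑ m ∈ Finset.range d, _
  simp [expTrunc, Prod.snd_sum, h, LinearMap.sum_apply]

theorem expUnit_inv (u : W.Hat) : (W.expUnit u)⁻¹ = W.expUnit (-u) := by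
  funext d
  apply Units.ext
  rfl

theorem Ad_mem (g : W.ExpGroup) (w : W.Hat) :
    (fun d => ((g.1 d : W.RepAlg d)).2 (w.1 d)) ∈ W.hatSubmodule := by
  obtain ⟨g, hg⟩ := g
  have hg' : g ∈ Submonoid.closure (Set.range W.expUnit ∪ (Set.range W.expUnit)⁻¹) := by
    rw [← Subgroup.closure_toSubmonoid]; exact hg
  change (fun d => ((g d : W.RepAlg d)).2 (w.1 d)) ∈ W.hatSubmodule
  clear hg
  have key : ∀ u w : W.Hat, (fun d => ((W.expUnit u d : W.RepAlg d)).2 (w.1 d)) ∈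
      W.hatSubmodule := by
    intro u w
    simp only [expUnit_snd]
    exact (W.adSeries _ u w).2
  induction hg' using Submonoid.closure_induction generalizing w with
  | one => exact w.2
  | mul x y _ _ hx hy => exact hx ⟨_, hy w⟩
  | mem x hx =>
    rcases hx with ⟨u, rfl⟩ | ⟨u, hu⟩
    · exact key u w
    · have : x = W.expUnit (-u) := by rw [← expUnit_inv, hu, inv_inv]
      rw [this]
      exact key (-u) w

/-- The adjoint action of the exponential group on the completion. -/
def Ad (g : W.ExpGroup) : W.Hat →ₗ[ℂ] W.Hat where
  toFun w := ⟨fun d => ((g.1 d : W.RepAlg d)).2 (w.1 d), W.Ad_mem g w⟩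
  map_add' a b := Subtype.ext (funext fun d => map_add ((g.1 d : W.RepAlg d)).2 (a.1 d) (b.1 d))
  map_smul' c a := Subtype.ext (funext fun d => map_smul ((g.1 d : W.RepAlg d)).2 c (a.1 d))

/-! #### Images under surjective morphisms -/

variable {L' : Type} [LieRing L'] [LieAlgebra ℂ L']

/-- The images of the generators under a surjective morphism, with the same weights. -/
def push (f : L →ₗ⁅ℂ⁆ L') (hf : Function.Surjective f) : WeightedGens L' where
  Idx := W.Idx
  gen i := f (W.gen i)
  wt := W.wt
  wt_pos := W.wt_pos
  lieSpan_gen := by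
    refine eq_top_iff.2 fun v _ => ?_
    obtain ⟨u, rfl⟩ := hf v
    have hu : u ∈ LieSubalgebra.lieSpan ℂ L (Set.range W.gen) := by
      rw [W.lieSpan_gen]; exact LieSubalgebra.mem_top u
    have h : LieSubalgebra.lieSpan ℂ L (Set.range W.gen) ≤
        (LieSubalgebra.lieSpan ℂ L' (Set.range fun i => f (W.gen i))).comap f := by
      rw [LieSubalgebra.lieSpan_le]
      rintro _ ⟨i, rfl⟩
      exact LieSubalgebra.subset_lieSpan ⟨i, rfl⟩
    exact h hu

theorem push_mono (f : L →ₗ⁅ℂ⁆ L') (hf : Function.Surjective f) {e : ℕ} {u : L}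
    (h : W.Mono e u) : (W.push f hf).Mono e (f u) := by
  induction h with
  | gen i => exact Mono.gen (W := W.push f hf) i
  | lie _ _ h1 h2 => rw [LieHom.map_lie]; exact Mono.lie h1 h2

theorem push_monoSpan (f : L →ₗ⁅ℂ⁆ L') (hf : Function.Surjective f) (d : ℕ) :
    W.monoSpan d ≤ ((W.push f hf).monoSpan d).comap (f : L →ₗ[ℂ] L') := by
  refine Submodule.span_le.2 ?_
  rintro u ⟨e, he, hu⟩
  exact Submodule.subset_span ⟨e, he, W.push_mono f hf hu⟩

/-- The map induced on truncations. -/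
def pushTrunc (f : L →ₗ⁅ℂ⁆ L') (hf : Function.Surjective f) (d : ℕ) :
    W.Trunc d →ₗ[ℂ] (W.push f hf).Trunc d :=
  Submodule.mapQ (W.fil d).toSubmodule ((W.push f hf).fil d).toSubmodule (f : L →ₗ[ℂ] L')
    (W.push_monoSpan f hf d)

/-- The map induced on completions. -/
def pushHat (f : L →ₗ⁅ℂ⁆ L') (hf : Function.Surjective f) :
    W.Hat →ₗ[ℂ] (W.push f hf).Hat where
  toFun w := ⟨fun d => W.pushTrunc f hf d (w.1 d), fun d => by
    obtain ⟨r, h1, h2⟩ := w.2 d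
    exact ⟨f r, by simp only [h1]; rfl, by simp only [h2]; rfl⟩⟩
  map_add' a b := Subtype.ext (funext fun d => map_add (W.pushTrunc f hf d) (a.1 d) (b.1 d))
  map_smul' c a := Subtype.ext (funext fun d => map_smul (W.pushTrunc f hf d) c (a.1 d))

end WeightedGens

/-! ### Principal bundles given by constant cocycles, and connections on them -/

section Bundles

variable {L : Type} [LieRing L] [LieAlgebra ℂ L] {W : WeightedGens L}
variable {V : Type} [AddCommGroup V] [Module ℂ V] [TopologicalSpace V]

/-- The data from which a principal bundle over the quotient of `Y ⊆ V` by the translations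
`z ↦ z + trans h` is built: `h` acts on `Y × exp` by
`h • (z, g) = (z + trans h, exp (coc h) * g)`. -/
structure CocycleData (W : WeightedGens L) (V : Type) where
  Y : Set V
  H : Type
  trans : H → V
  coc : H → W.Hat

/-- Two points of the trivial bundle `Y × exp` are related if some `h` maps the first one to the
second one. -/
def CocycleData.Rel (B : CocycleData W V) (p q : B.Y × W.ExpGroup) : Prop :=
  ∃ h : B.H, (q.1 : V) = (p.1 : V) + B.trans h ∧ q.2 = W.exp (B.coc h) * p.2

/-- The total space of the principal bundle, the quotient of `Y × exp` by the action. -/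
def CocycleData.Total (B : CocycleData W V) : Type := Quot B.Rel

/-- The class of `(z, g)`. -/
def CocycleData.pt (B : CocycleData W V) (z : B.Y) (g : W.ExpGroup) : B.Total :=
  Quot.mk _ (z, g)

/-- The right action of the structure group on the total space. -/
def CocycleData.act (B : CocycleData W V) (p : B.Total) (g : W.ExpGroup) : B.Total :=
  Quot.map (fun a : B.Y × W.ExpGroup => (a.1, a.2 * g))
    (fun _ _ ⟨h, h1, h2⟩ => ⟨h, h1, by simp only [h2, mul_assoc]⟩) p

open scoped Classical in
/-- The pull-back of a form on the total space along the section `z ↦ [z, 1]` over the cover `Y`,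
at the point `z` and the tangent vector `v` (extended by zero outside of `Y`). -/
def CocycleData.pullForm (B : CocycleData W V) (form : B.Total → (V × W.Hat →ₗ[ℂ] W.Hat))
    (z v : V) : W.Hat :=
  if h : z ∈ B.Y then form (B.pt ⟨z, h⟩ 1) (v, 0) else 0

/-- A holomorphic connection on the principal bundle, given by its connection form.

The tangent space of `Y × exp` at `(z, g)` is `V × Hat`, where `(v, u)` stands for the velocity
`v` of `z` and the velocity `g * u` of `g`. This identification is invariant under the action of
the translations (their cocycle is constant in `z` and multiplies `g` from the left), so `V × Hat`
is also the tangent space of the quotient at each point. The fundamental vector fields are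
`(0, u)`, and the right action of `g` has differential `(v, u) ↦ (v, Ad g⁻¹ u)`. -/
structure Connection (B : CocycleData W V) where
  form : B.Total → (V × W.Hat →ₗ[ℂ] W.Hat)
  vertical : ∀ p u, form p (0, u) = u
  equivariant : ∀ p g v u, form (B.act p g) (v, W.Ad g⁻¹ u) = W.Ad g⁻¹ (form p (v, u))
  holomorphic : ∀ (v : V) (d : ℕ) (φ : W.Trunc d →ₗ[ℂ] ℂ),
    DifferentiableOn ℂ (fun z => φ ((B.pullForm form z v).1 d)) B.Y

/-- The local form of a connection over the cover `Y`. For the connection `d - ω` it is `-ω`. -/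
def Connection.localForm {B : CocycleData W V} (A : Connection B) (z v : V) : W.Hat :=
  B.pullForm A.form z v

/-- The curvature `da + [a ∧ a] / 2` of the local form `a` vanishes on `Y`. Derivatives of
functions with values in the completion are taken componentwise in the truncations. -/
def Connection.IsFlat {B : CocycleData W V} (A : Connection B) : Prop :=
  ∀ z ∈ B.Y, ∀ (v w : V) (d : ℕ) (φ : W.Trunc d →ₗ[ℂ] ℂ),
    lineDeriv ℂ (fun y => φ ((A.localForm y w).1 d)) z v
      - lineDeriv ℂ (fun y => φ ((A.localForm y v).1 d)) z w
      + φ (⁅A.localForm z v, A.localForm z w⁆.1 d) = 0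

end Bundles

/-! ### The Lie algebra of infinitesimal ellipsitomic braids -/

/-- The generators `x i`, `y i` and `t α i j` (`i ≠ j`). -/
inductive Gen (M N n : ℕ) : Type
  | x (i : Fin n) : Gen M N n
  | y (i : Fin n) : Gen M N n
  | t (α : ZMod M × ZMod N) (i j : Fin n) (h : i ≠ j) : Gen M N n

section LieAlg

variable (M N n : ℕ)

abbrev Free : Type := FreeLieAlgebra ℂ (Gen M N n)

variable {M N n}

def fx (i : Fin n) : Free M N n := FreeLieAlgebra.of ℂ (Gen.x i)
def fy (i : Fin n) : Free M N n := FreeLieAlgebra.of ℂ (Gen.y i)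
/-- The generator `t α i j` for `i ≠ j` (zero for `i = j`). -/
def ft (α : ZMod M × ZMod N) (i j : Fin n) : Free M N n :=
  if h : i ≠ j then FreeLieAlgebra.of ℂ (Gen.t α i j h) else 0

variable [NeZero M] [NeZero N]

variable (M N n) in
/-- The elements of the free Lie algebra that the defining relations set to zero. -/
inductive Relator : Free M N n → Prop
  | tS1 (α : ZMod M × ZMod N) (i j : Fin n) : i ≠ j → Relator (ft α i j - ft (-α) j i)
  | tS2 (i j : Fin n) : i ≠ j → Relator (⁅(fx i : Free M N n), fy j⁆ - ∑ α, ft α i j)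
  | tS2' (i j : Fin n) : i ≠ j → Relator (⁅(fx j : Free M N n), fy i⁆ - ∑ α, ft α i j)
  | tNx (i j : Fin n) : i ≠ j → Relator ⁅(fx i : Free M N n), fx j⁆
  | tNy (i j : Fin n) : i ≠ j → Relator ⁅(fy i : Free M N n), fy j⁆
  | tT (i : Fin n) : Relator (⁅(fx i : Free M N n), fy i⁆
      + ∑ j ∈ Finset.univ.erase i, ∑ α, ft α i j)
  | tL1 (α β : ZMod M × ZMod N) (i j k l : Fin n) : i ≠ j → i ≠ k → i ≠ l →
      j ≠ k → j ≠ l → k ≠ l → Relator ⁅ft α i j, ft β k l⁆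
  | tL2x (α : ZMod M × ZMod N) (i j k : Fin n) : i ≠ j → i ≠ k → j ≠ k →
      Relator ⁅(fx i : Free M N n), ft α j k⁆
  | tL2y (α : ZMod M × ZMod N) (i j k : Fin n) : i ≠ j → i ≠ k → j ≠ k →
      Relator ⁅(fy i : Free M N n), ft α j k⁆
  | t4T1 (α β : ZMod M × ZMod N) (i j k : Fin n) : i ≠ j → i ≠ k → j ≠ k →
      Relator ⁅ft α i j, ft (α + β) i k + ft β j k⁆
  | t4T2x (α : ZMod M × ZMod N) (i j : Fin n) : i ≠ j →
      Relator ⁅(fx i : Free M N n) + fx j, ft α i j⁆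
  | t4T2y (α : ZMod M × ZMod N) (i j : Fin n) : i ≠ j →
      Relator ⁅(fy i : Free M N n) + fy j, ft α i j⁆

variable (M N n)

/-- The ideal generated by the defining relations. -/
def relIdeal : LieIdeal ℂ (Free M N n) :=
  LieSubmodule.lieSpan ℂ (Free M N n) {u | Relator M N n u}

/-- The Lie algebra `𝔱_{1,n}^Γ` for `Γ = ℤ/M × ℤ/N`. -/
abbrev T1 : Type := Free M N n ⧸ relIdeal M N n

end LieAlg

/-- The quotient morphism of a Lie algebra by an ideal. -/
def quotHom {L : Type} [LieRing L] [LieAlgebra ℂ L] (I : LieIdeal ℂ L) : L →ₗ⁅ℂ⁆ L ⧸ I :=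
  { (LieSubmodule.Quotient.mk' I : L →ₗ[ℂ] L ⧸ I) with map_lie' := fun {_ _} => rfl }

theorem quotHom_surjective {L : Type} [LieRing L] [LieAlgebra ℂ L] (I : LieIdeal ℂ L) :
    Function.Surjective (quotHom I) := LieSubmodule.Quotient.surjective_mk' I

/-- The free generators; `x` and `y` have degree `1`, and `t` has degree `2` (the total degree of
the bidegrees `(1,0)`, `(0,1)`, `(1,1)`). -/
def freeGens (M N n : ℕ) : WeightedGens (Free M N n) where
  Idx := Gen M N n
  gen := FreeLieAlgebra.of ℂ
  wt g := match g with
    | .x _ => 1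
    | .y _ => 1
    | .t _ _ _ _ => 2
  wt_pos g := by cases g <;> simp
  lieSpan_gen := by
    set S := LieSubalgebra.lieSpan ℂ (Free M N n) (Set.range (FreeLieAlgebra.of ℂ))
    let f : Free M N n →ₗ⁅ℂ⁆ S := FreeLieAlgebra.lift ℂ fun g =>
      ⟨FreeLieAlgebra.of ℂ g, LieSubalgebra.subset_lieSpan ⟨g, rfl⟩⟩
    have h : S.incl.comp f = LieHom.id := by
      apply FreeLieAlgebra.hom_ext
      intro g
      simp [f]
    refine eq_top_iff.2 fun u _ => ?_
    have hu : ((f u : S) : Free M N n) = u := congrArg (fun k => k u) h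
    rw [← hu]
    exact (f u).2

section Connections

variable (M N n : ℕ) [NeZero M] [NeZero N]

/-- The generators of `𝔱_{1,n}^Γ`; `(tGens M N n).Hat` is the completion of `𝔱_{1,n}^Γ`. -/
def tGens : WeightedGens (T1 M N n) :=
  (freeGens M N n).push (quotHom (relIdeal M N n)) (quotHom_surjective _)

variable {M N n} in
def tx (i : Fin n) : T1 M N n := quotHom _ (fx i)
variable {M N n} in
def ty (i : Fin n) : T1 M N n := quotHom _ (fy i)
variable {M N n} in
def tt (α : ZMod M × ZMod N) (i j : Fin n) : T1 M N n := quotHom _ (ft α i j)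

/-- The ideal generated by `∑ x i` and `∑ y i`. -/
def centerIdeal : LieIdeal ℂ (T1 M N n) :=
  LieSubmodule.lieSpan ℂ (T1 M N n) {∑ i, tx i, ∑ i, ty i}

/-- The reduced Lie algebra, the quotient of `𝔱_{1,n}^Γ` by `∑ x i` and `∑ y i`. -/
abbrev T1bar : Type := T1 M N n ⧸ centerIdeal M N n

/-- The generators of the reduced Lie algebra. -/
def tbarGens : WeightedGens (T1bar M N n) :=
  (tGens M N n).push (quotHom (centerIdeal M N n)) (quotHom_surjective _)

/-- The morphism from the completion of `𝔱_{1,n}^Γ` to that of its reduced version. -/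
def reduce : (tGens M N n).Hat →ₗ[ℂ] (tbarGens M N n).Hat :=
  (tGens M N n).pushHat (quotHom (centerIdeal M N n)) (quotHom_surjective _)

variable {M N n}

def hx (i : Fin n) : (tGens M N n).Hat := (tGens M N n).toHat (tx i)
def hy (i : Fin n) : (tGens M N n).Hat := (tGens M N n).toHat (ty i)
def ht (α : ZMod M × ZMod N) (i j : Fin n) : (tGens M N n).Hat := (tGens M N n).toHat (tt α i j)

/-! ### The bundles -/

variable (M N n)

/-- The complement in `ℂ^n` of the twisted diagonals
`z i - z j ∈ (1/M) ℤ + (τ/N) ℤ`, `i ≠ j`. -/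
def twistedConf (τ : ℍ) : Set (Fin n → ℂ) :=
  {z | ∀ i j, i ≠ j → ∀ a b : ℤ, z i - z j ≠ (a : ℂ) / M + (b : ℂ) / N * τ}

/-- The principal bundle over the twisted configuration space: the quotient of
`twistedConf × exp` by `(ℤ + τ ℤ)^n`, where the element `(a i + b i τ)_i` acts by
translation on the first factor and by left multiplication with `exp (-2πi ∑ b i x i)`
on the second one. -/
def bundle (τ : ℍ) : CocycleData (tGens M N n) (Fin n → ℂ) where
  Y := twistedConf M N n τ
  H := (Fin n → ℤ) × (Fin n → ℤ)
  trans h := fun i => (h.1 i : ℂ) + (h.2 i : ℂ) * τ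
  coc h := -(2 * Real.pi * Complex.I) • ∑ i, (h.2 i : ℂ) • hx i

/-- The diagonal line `ℂ (1, …, 1)`. -/
def diagLine : Submodule ℂ (Fin n → ℂ) := Submodule.span ℂ {fun _ => 1}

/-- The reduced bundle over the quotient of the twisted configuration space by the diagonal
translations: the quotient of `(twistedConf / ℂ) × exp` by `(ℤ + τ ℤ)^n`, with the image of the
cocycle above. -/
def reducedBundle (τ : ℍ) : CocycleData (tbarGens M N n) ((Fin n → ℂ) ⧸ diagLine n) where
  Y := (diagLine n).mkQ '' twistedConf M N n τ
  H := (bundle M N n τ).H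
  trans h := (diagLine n).mkQ ((bundle M N n τ).trans h)
  coc h := reduce M N n ((bundle M N n τ).coc h)

/-! ### The theta function, the twisted Kronecker functions and the connection -/

/-- The odd theta function with zero set `ℤ + τ ℤ`, normalised by `θ'(0) = 1`: with
`q = exp (2πi τ)`,
`θ(z) = (sin πz / π) ∏_{m ≥ 1} (1 - q^m exp(2πi z)) (1 - q^m exp(-2πi z)) / (1 - q^m)^2`.
It satisfies `θ(z + 1) = -θ(z) = θ(-z)` and `θ(z + τ) = -exp(-πi τ) exp(-2πi z) θ(z)`. -/
def theta (τ : ℍ) (z : ℂ) : ℂ :=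
  Complex.sin (Real.pi * z) / Real.pi *
    ∏' m : ℕ,
      ((1 - Complex.exp (2 * Real.pi * Complex.I * ((m + 1) * τ + z))) *
        (1 - Complex.exp (2 * Real.pi * Complex.I * ((m + 1) * τ - z))) /
        (1 - Complex.exp (2 * Real.pi * Complex.I * ((m + 1) * τ))) ^ 2)

variable {M N n}

/-- The coefficient of `τ` in the lift of `α` to `(1/M) ℤ + (τ/N) ℤ`. -/
def liftTau (α : ZMod M × ZMod N) : ℂ := (α.2.val : ℂ) / N

/-- The lift of `α` to `(1/M) ℤ + (τ/N) ℤ`. -/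
def lift (τ : ℍ) (α : ZMod M × ZMod N) : ℂ := (α.1.val : ℂ) / M + liftTau α * τ

/-- The twisted Kronecker function `k_α(x, z)`. -/
def kron (τ : ℍ) (α : ZMod M × ZMod N) (x z : ℂ) : ℂ :=
  Complex.exp (-(2 * Real.pi * Complex.I) * liftTau α * x) * theta τ (z - lift τ α + x) /
    (theta τ (z - lift τ α) * theta τ x) - 1 / x

/-- The coefficient of `x ^ m` in the Taylor series of `k_α(x, z)` at `x = 0`, where the removable
singularity at `x = 0` is removed. -/
def kronCoeff (τ : ℍ) (α : ZMod M × ZMod N) (z : ℂ) (m : ℕ) : ℂ :=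
  iteratedDeriv m (Function.update (fun x => kron τ α x z) 0
    (Filter.limUnder (𝓝[≠] 0) fun x => kron τ α x z)) 0 / (m.factorial : ℂ)

/-- `K_{ij}(z) = ∑_α k_α(ad x_i, z)(t^α_{ij})`. -/
def Kij (τ : ℍ) (i j : Fin n) (z : ℂ) : (tGens M N n).Hat :=
  ∑ α : ZMod M × ZMod N, (tGens M N n).adSeries (kronCoeff τ α z) (hx i) (ht α i j)

/-- `K_i(z) = -y_i + ∑_{j ≠ i} K_{ij}(z_i - z_j)`. -/
def K (τ : ℍ) (i : Fin n) (z : Fin n → ℂ) : (tGens M N n).Hat :=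
  -hy i + ∑ j ∈ Finset.univ.erase i, Kij τ i j (z i - z j)

/-- A function with values in the completion is meromorphic on `ℂ^n` with poles only outside of
`Y`: componentwise, it is holomorphic on `Y`, and near each point of `ℂ^n` it is a quotient of
analytic functions whose denominator is not identically zero near the point. -/
def MeromorphicWithPolesOff {L : Type} [LieRing L] [LieAlgebra ℂ L] {W : WeightedGens L}
    (Y : Set (Fin n → ℂ)) (f : (Fin n → ℂ) → W.Hat) : Prop :=
  ∀ (d : ℕ) (φ : W.Trunc d →ₗ[ℂ] ℂ),
    AnalyticOnNhd ℂ (fun z => φ ((f z).1 d)) Y ∧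
    ∀ z₀, ∃ g h : (Fin n → ℂ) → ℂ, AnalyticAt ℂ g z₀ ∧ AnalyticAt ℂ h z₀ ∧
      (¬ ∀ᶠ z in 𝓝 z₀, h z = 0) ∧ ∀ᶠ z in 𝓝 z₀, z ∈ Y → h z * φ ((f z).1 d) = g z

end Connections

end EllKZB

end

open scoped Topology UpperHalfPlane

noncomputable section

namespace EllKZB

set_option linter.unusedSectionVars false

section

open Filter

/-! Flatness of d - ∑ K_i dz_i splits into closedness of the form and [K_i, K_j] = 0; descent to the
bundle is the equality of K_i(z + a + bτ) with the conjugate of K_i(z) by exp(-2πi ∑ b_l x_l). All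
of this is checked in the truncations, where every power series in ad x_i is a finite sum.

The working object is not k_α but 1 + x k_α(x, z) = e^{-2πiax} θ(w + x) x / (θ(w) θ(x)) with w = z -
α̃, which has constant term 1 and is regular at x = 0 (`kronFun`, `kronSeries`). It is multiplied by
e^{-2πiqx} when z moves by p + qτ. Removing the constant term and dividing by x turns this into
k_α(x, z + p + qτ) = e^{-2πiqx} k_α(x, z) + (e^{-2πiqx} - 1)/x. The multiplicative part is the
action of exp(ad) on the t_{ij}, and the additive part is what the same exponential produces from
-y_i (`kronCoeff_add_lattice`, `exp_KAbs`).

The commutation [K_i, K_j] = 0 rests on the Fay identity. The three-term relation for theta follows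
from Liouville's theorem (`theta_three_term`). It becomes an identity of power series in two complex
scalars, then, through polynomials in two variables, one for any commuting pair of operators
(`fayExpr_kronSeries`, `fay_coeff`). On the Lie side, the part of [K_i, K_j] involving a third index
k is a sum of polynomials in A = ad x_i and B = ad x_j applied to the single brackets [t_{ij}^α,
t_{ik}^{α+β}]; the polynomial obtained is exactly the Fay expression in A and B
(`lie_triple_eq_zero`, `lie_KAbs_eq_zero`). Contributions with four distinct indices vanish, and
those with only i and j cancel.

Closedness comes from K_{ji}(-ζ) = -K_{ij}(ζ) (`Kij_neg`, `closed_kzbForm`). The same antisymmetry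
gives ∑ K_i = -∑ y_i, which dies in the reduced algebra; since K_i depends only on the differences
of the z_j, the reduced form lives on the quotient by the diagonal (`reduce_kzbForm_diagSection`).
-/

/-! ### The product defining theta -/

/-- The entire function `u ↦ ∏_{m ≥ 1} (1 - q ^ m u)`. -/
def eulerProd (q u : ℂ) : ℂ := ∏' m : ℕ, (1 + -(q ^ (m + 1) * u))

theorem summable_norm_pow_succ_mul {q : ℂ} (hq : ‖q‖ < 1) (u : ℂ) :
    Summable fun m : ℕ => ‖-(q ^ (m + 1) * u)‖ := by
  simp only [norm_neg, norm_mul, norm_pow]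
  exact ((summable_nat_add_iff 1).2 (summable_geometric_of_lt_one (norm_nonneg _) hq)).mul_right _

theorem multipliable_eulerProd {q : ℂ} (hq : ‖q‖ < 1) (u : ℂ) :
    Multipliable fun m : ℕ => 1 + -(q ^ (m + 1) * u) :=
  multipliable_one_add_of_summable (summable_norm_pow_succ_mul hq u)

theorem differentiable_eulerProd {q : ℂ} (hq : ‖q‖ < 1) : Differentiable ℂ (eulerProd q) := by
  intro u
  have hU : u ∈ Metric.ball (0 : ℂ) (‖u‖ + 1) := by simp
  have hs : Summable fun m : ℕ => ‖q‖ ^ (m + 1) * (‖u‖ + 1) :=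
    ((summable_nat_add_iff 1).2 (summable_geometric_of_lt_one (norm_nonneg _) hq)).mul_right _
  have h := hs.hasProdLocallyUniformlyOn_nat_one_add (K := Metric.ball (0 : ℂ) (‖u‖ + 1))
    (f := fun m v => -(q ^ (m + 1) * v)) Metric.isOpen_ball
    (Eventually.of_forall fun m v hv => by
      rw [norm_neg, norm_mul, norm_pow]
      have : ‖v‖ < ‖u‖ + 1 := by simpa using hv
      gcongr)
    (fun m => by fun_prop)
  have h2 := h.differentiableOn (.of_forall fun s => by
    simpa [Finset.prod_fn] using DifferentiableOn.finsetProd (fun _ _ => by fun_prop))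
    Metric.isOpen_ball
  exact h2.differentiableAt (Metric.isOpen_ball.mem_nhds hU)

theorem eulerProd_eq_mul {q : ℂ} (hq : ‖q‖ < 1) (u : ℂ) :
    eulerProd q u = (1 - q * u) * eulerProd q (q * u) := by
  have h : ∀ m : ℕ, 1 + -(q ^ (m + 1 + 1) * u) = 1 + -(q ^ (m + 1) * (q * u)) := fun m => by ring
  unfold eulerProd
  rw [tprod_eq_zero_mul']
  · simp only [h]; ring
  · simp only [h]; exact multipliable_eulerProd hq _

theorem eulerProd_ne_zero {q : ℂ} (hq : ‖q‖ < 1) {u : ℂ} (h : ∀ m : ℕ, q ^ (m + 1) * u ≠ 1) :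
    eulerProd q u ≠ 0 :=
  tprod_one_add_ne_zero_of_summable
    (fun m h0 => h m (by linear_combination -h0)) (summable_norm_pow_succ_mul hq u)

/-- The exponential `exp (2πi z)`. -/
def cexp1 (z : ℂ) : ℂ := Complex.exp (2 * Real.pi * Complex.I * z)

theorem cexp1_add (z w : ℂ) : cexp1 (z + w) = cexp1 z * cexp1 w := by
  simp [cexp1, mul_add, Complex.exp_add]

theorem cexp1_ne_zero (z : ℂ) : cexp1 z ≠ 0 := Complex.exp_ne_zero _

theorem cexp1_neg (z : ℂ) : cexp1 (-z) = (cexp1 z)⁻¹ := by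
  simp [cexp1, Complex.exp_neg]

theorem cexp1_zero : cexp1 0 = 1 := by simp [cexp1]

theorem cexp1_int (k : ℤ) : cexp1 k = 1 := by
  rw [cexp1, mul_comm]; exact Complex.exp_int_mul_two_pi_mul_I k

theorem cexp1_one : cexp1 1 = 1 := by exact_mod_cast cexp1_int 1

theorem cexp1_nat_mul (m : ℕ) (z : ℂ) : cexp1 (m * z) = cexp1 z ^ m := by
  rw [cexp1, cexp1, ← Complex.exp_nat_mul]; congr 1; ring

theorem cexp1_eq_one_iff {z : ℂ} : cexp1 z = 1 ↔ ∃ k : ℤ, z = k := by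
  rw [cexp1, Complex.exp_eq_one_iff]
  refine exists_congr fun k => ?_
  rw [mul_comm]
  exact mul_left_inj' Complex.two_pi_I_ne_zero

theorem differentiable_cexp1 : Differentiable ℂ cexp1 := by
  unfold cexp1; fun_prop

theorem norm_nome_lt_one (τ : ℍ) : ‖cexp1 (τ : ℂ)‖ < 1 := by
  simpa [cexp1] using UpperHalfPlane.norm_exp_two_pi_I_lt_one τ

theorem nome_pow_ne_one (τ : ℍ) (m : ℕ) : cexp1 (τ : ℂ) ^ (m + 1) * 1 ≠ 1 := by
  intro h
  have h1 : ‖cexp1 (τ : ℂ) ^ (m + 1)‖ < 1 := by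
    rw [norm_pow]; exact pow_lt_one₀ (norm_nonneg _) (norm_nome_lt_one τ) (by omega)
  rw [mul_one] at h
  rw [h] at h1
  simp at h1

/-- This form exhibits the sine as the missing factor u - 1, with u = `cexp1 z`, of the Euler
products in theta, so that a shift by τ can be compared factor by factor. -/
theorem sin_pi_mul_eq (z : ℂ) :
    Complex.sin (Real.pi * z) = cexp1 (-(z / 2)) * (cexp1 z - 1) / (2 * Complex.I) := by
  have h1 : cexp1 (-(z / 2)) * cexp1 z = Complex.exp (Real.pi * z * Complex.I) := by
    rw [← cexp1_add, cexp1]; congr 1; ring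
  have h2 : cexp1 (-(z / 2)) = Complex.exp (-(Real.pi * z) * Complex.I) := by
    rw [cexp1]; congr 1; ring
  rw [mul_sub, h1, mul_one, h2, Complex.sin]
  have hI : Complex.I ≠ 0 := Complex.I_ne_zero
  field_simp
  linear_combination (Complex.exp (-(Real.pi * z * Complex.I)) -
    Complex.exp (Real.pi * z * Complex.I)) * Complex.I_sq

theorem theta_eq (τ : ℍ) (z : ℂ) :
    theta τ z = Complex.sin (Real.pi * z) / Real.pi *
      (eulerProd (cexp1 τ) (cexp1 z) * eulerProd (cexp1 τ) (cexp1 (-z)) /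
        eulerProd (cexp1 τ) 1 ^ 2) := by
  have hq := norm_nome_lt_one τ
  have h1 : ∀ m : ℕ, Complex.exp (2 * Real.pi * Complex.I * ((m + 1) * τ)) =
      cexp1 τ ^ (m + 1) := fun m => by
    rw [← cexp1_nat_mul, cexp1]; push_cast; rfl
  have h2 : ∀ m : ℕ, Complex.exp (2 * Real.pi * Complex.I * ((m + 1) * τ + z)) =
      cexp1 τ ^ (m + 1) * cexp1 z := fun m => by
    rw [← h1, cexp1, ← Complex.exp_add]; congr 1; ring
  have h3 : ∀ m : ℕ, Complex.exp (2 * Real.pi * Complex.I * ((m + 1) * τ - z)) =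
      cexp1 τ ^ (m + 1) * cexp1 (-z) := fun m => by
    rw [← h1, cexp1, ← Complex.exp_add]; congr 1; ring
  rw [theta]
  congr 1
  simp only [h1, h2, h3]
  have hP := multipliable_eulerProd hq
  have e1 := (hP (cexp1 z)).hasProd
  have e2 := (hP (cexp1 (-z))).hasProd
  have e3 := (hP 1).hasProd
  have h4 := ((e1.mul e2).div₀ (e3.mul e3)
    (mul_ne_zero (eulerProd_ne_zero hq (nome_pow_ne_one τ))
      (eulerProd_ne_zero hq (nome_pow_ne_one τ)))).tprod_eq
  rw [sq]
  refine Eq.trans ?_ h4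
  refine tprod_congr fun m => ?_
  simp only [mul_one, sub_eq_add_neg, sq]

/-! ### Analytic properties of theta -/

variable (τ : ℍ)

theorem differentiable_theta : Differentiable ℂ (theta τ) := by
  have h := differentiable_eulerProd (norm_nome_lt_one τ)
  have h1 := h.comp differentiable_cexp1
  have h2 := h1.comp (differentiable_id (𝕜 := ℂ) (E := ℂ)).neg
  have : theta τ = fun z => Complex.sin (Real.pi * z) / Real.pi *
      (eulerProd (cexp1 τ) (cexp1 z) * eulerProd (cexp1 τ) (cexp1 (-z)) /
        eulerProd (cexp1 τ) 1 ^ 2) := funext (theta_eq τ)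
  rw [this]
  refine Differentiable.mul (by fun_prop) (Differentiable.div_const (h1.mul h2) _)

theorem theta_neg (z : ℂ) : theta τ (-z) = -theta τ z := by
  simp only [theta_eq, mul_neg, Complex.sin_neg, neg_neg]; ring

theorem theta_zero : theta τ 0 = 0 := by simp [theta_eq]

theorem theta_add_one (z : ℂ) : theta τ (z + 1) = -theta τ z := by
  have h : cexp1 (-(z + 1)) = cexp1 (-z) := by
    rw [neg_add, cexp1_add, cexp1_neg 1, cexp1_one]; simp
  simp only [theta_eq, mul_add, mul_one, Complex.sin_add_pi, cexp1_add z, cexp1_one, h]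
  ring

/-- With u = `cexp1 z` and q = `cexp1 τ`, the shift removes the factor 1 - qu from the Euler product
in u and adds the factor 1 - 1/u to the one in 1/u. The sine contributes qu - 1 in place of u - 1,
which compensates both up to the exponential. -/
theorem theta_add_tau (z : ℂ) :
    theta τ (z + τ) = -(cexp1 (-(τ / 2)) * cexp1 (-z)) * theta τ z := by
  have hq := norm_nome_lt_one τ
  have h1 := eulerProd_eq_mul hq (cexp1 z)
  have h2 := eulerProd_eq_mul hq (cexp1 (-(z + τ)))
  have h3 : cexp1 τ * cexp1 (-(z + τ)) = cexp1 (-z) := by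
    rw [← cexp1_add]; congr 1; ring
  rw [h3] at h2
  rw [theta_eq, theta_eq, h2, sin_pi_mul_eq, sin_pi_mul_eq, h1, cexp1_add z τ, mul_comm (cexp1 z)]
  have h4 : cexp1 (-((z + τ) / 2)) = cexp1 (-(τ / 2)) * cexp1 (-(z / 2)) := by
    rw [← cexp1_add]; congr 1; ring
  have h5 : cexp1 (-z) * cexp1 z = 1 := by
    rw [← cexp1_add, neg_add_cancel, cexp1_zero]
  rw [h4]
  linear_combination (cexp1 (-(τ / 2)) * cexp1 (-(z / 2)) * (cexp1 τ * cexp1 z - 1)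
    / (2 * Complex.I) / Real.pi * (eulerProd (cexp1 τ) (cexp1 τ * cexp1 z) *
    eulerProd (cexp1 τ) (cexp1 (-z)) / eulerProd (cexp1 τ) 1 ^ 2)) * (-h5)

theorem theta_eq_zero {z : ℂ} (h : theta τ z = 0) : ∃ a b : ℤ, z = a + b * τ := by
  have hq := norm_nome_lt_one τ
  have hpow : ∀ (w : ℂ) (m : ℕ), cexp1 τ ^ (m + 1) * cexp1 w = cexp1 (w + ((m + 1 : ℕ) : ℂ) * τ) :=
    fun w m => by rw [cexp1_add, cexp1_nat_mul, mul_comm]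
  rw [theta_eq] at h
  rcases mul_eq_zero.1 h with h | h
  · have hs : Complex.sin (Real.pi * z) = 0 := by
      rcases div_eq_zero_iff.1 h with h | h
      · exact h
      · exact absurd h (by exact_mod_cast Real.pi_ne_zero)
    obtain ⟨k, hk⟩ := Complex.sin_eq_zero_iff.1 hs
    refine ⟨k, 0, ?_⟩
    have : (Real.pi : ℂ) ≠ 0 := by exact_mod_cast Real.pi_ne_zero
    have hz : z = k := mul_left_cancel₀ this (by rw [hk]; ring)
    simp [hz]
  · rcases div_eq_zero_iff.1 h with h | h
    · rcases mul_eq_zero.1 h with h | h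
      · by_contra hc
        refine eulerProd_ne_zero hq (fun m hm => hc ?_) h
        rw [hpow, cexp1_eq_one_iff] at hm
        obtain ⟨k, hk⟩ := hm
        exact ⟨k, -((m + 1 : ℕ) : ℤ), by rw [← hk]; push_cast; ring⟩
      · by_contra hc
        refine eulerProd_ne_zero hq (fun m hm => hc ?_) h
        rw [hpow, cexp1_eq_one_iff] at hm
        obtain ⟨k, hk⟩ := hm
        exact ⟨-k, ((m + 1 : ℕ) : ℤ), by push_cast; rw [← hk]; push_cast; ring⟩
    · exact absurd h (pow_ne_zero 2 (eulerProd_ne_zero hq (nome_pow_ne_one τ)))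

theorem hasDerivAt_theta_zero : HasDerivAt (theta τ) 1 0 := by
  have hq := norm_nome_lt_one τ
  have hpi : (Real.pi : ℂ) ≠ 0 := by exact_mod_cast Real.pi_ne_zero
  have h0 := eulerProd_ne_zero hq (nome_pow_ne_one τ)
  have h := differentiable_eulerProd hq
  have h1 := h.comp differentiable_cexp1
  have h2 := h1.comp (differentiable_id (𝕜 := ℂ) (E := ℂ)).neg
  have h3 := ((h1.mul h2).div_const (eulerProd (cexp1 τ) 1 ^ 2)) 0
  have h4 : HasDerivAt (fun z : ℂ => Complex.sin (Real.pi * z) / Real.pi) 1 0 := by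
    have := (((hasDerivAt_id (0 : ℂ)).const_mul (Real.pi : ℂ)).csin).div_const (Real.pi : ℂ)
    simpa [hpi] using this
  have h5 := h4.mul h3.hasDerivAt
  have : theta τ = fun z => Complex.sin (Real.pi * z) / Real.pi *
      (eulerProd (cexp1 τ) (cexp1 z) * eulerProd (cexp1 τ) (cexp1 (-z)) /
        eulerProd (cexp1 τ) 1 ^ 2) := funext (theta_eq τ)
  rw [this]
  have h6 : (eulerProd (cexp1 τ) (cexp1 0) * eulerProd (cexp1 τ) (cexp1 (-0)) /
      eulerProd (cexp1 τ) 1 ^ 2) = 1 := by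
    rw [neg_zero, cexp1_zero]; field_simp
  refine HasDerivAt.congr_deriv h5 ?_
  simp only [mul_zero, Complex.sin_zero, zero_div, zero_mul, add_zero, one_mul]
  exact h6

/-- Quasi-periodicity of theta with respect to the lattice. -/
theorem theta_add_lattice (a b : ℤ) :
    ∃ C : ℂ, C ≠ 0 ∧ ∀ z, theta τ (z + a + b * τ) = C * cexp1 (-(b * z)) * theta τ z := by
  -- The constants depend only on the lattice vector and later cancel between numerators and
  -- denominators, so only their nonvanishing is recorded.
  have key1 : ∀ a : ℤ, ∃ C : ℂ, C ≠ 0 ∧ ∀ z, theta τ (z + a) = C * theta τ z := by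
    intro a
    induction a using Int.induction_on with
    | zero => exact ⟨1, one_ne_zero, fun z => by simp⟩
    | succ i ih =>
      obtain ⟨C, hC, h⟩ := ih
      refine ⟨-C, neg_ne_zero.2 hC, fun z => ?_⟩
      push_cast at h ⊢
      rw [← add_assoc, theta_add_one, h]; ring
    | pred i ih =>
      obtain ⟨C, hC, h⟩ := ih
      refine ⟨-C, neg_ne_zero.2 hC, fun z => ?_⟩
      have h1 := theta_add_one τ (z + (-(i : ℂ) - 1))
      have h2 := h z
      push_cast at h2 ⊢
      rw [show z + (-(i : ℂ) - 1) + 1 = z + -i by ring, h2] at h1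
      linear_combination h1
  have key2 : ∀ b : ℤ, ∃ C : ℂ, C ≠ 0 ∧ ∀ z,
      theta τ (z + b * τ) = C * cexp1 (-(b * z)) * theta τ z := by
    intro b
    induction b using Int.induction_on with
    | zero => exact ⟨1, one_ne_zero, fun z => by simp [cexp1_zero]⟩
    | succ i ih =>
      obtain ⟨C, hC, h⟩ := ih
      refine ⟨-(C * cexp1 (-(τ / 2)) * cexp1 (-(i * τ))), by simp [hC, cexp1_ne_zero], fun z => ?_⟩
      push_cast at h ⊢
      rw [show z + ((i : ℂ) + 1) * τ = z + i * τ + τ by ring, theta_add_tau, h,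
        show -(((i : ℂ) + 1) * z) = -(i * z) + -z by ring, neg_add z, cexp1_add, cexp1_add]
      ring
    | pred i ih =>
      obtain ⟨C, hC, h⟩ := ih
      refine ⟨-(C * cexp1 (τ / 2) * cexp1 ((-i - 1) * τ)), by simp [hC, cexp1_ne_zero],
        fun z => ?_⟩
      have h1 := theta_add_tau τ (z + (-(i : ℂ) - 1) * τ)
      have h2 := h z
      push_cast at h2 ⊢
      rw [show z + (-(i : ℂ) - 1) * τ + τ = z + -i * τ by ring, h2, neg_add, cexp1_add,
        cexp1_neg (τ / 2), cexp1_neg ((-(i : ℂ) - 1) * τ)] at h1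
      rw [show -((-(i : ℂ) - 1) * z) = -(-i * z) + z by ring, cexp1_add]
      have e : cexp1 z * cexp1 (-z) = 1 := by rw [← cexp1_add, add_neg_cancel, cexp1_zero]
      have n1 := cexp1_ne_zero (τ / 2)
      have n2 := cexp1_ne_zero ((-(i : ℂ) - 1) * τ)
      have h3 : theta τ (z + (-(i : ℂ) - 1) * τ) * cexp1 (-z) =
          -(C * cexp1 (τ / 2) * cexp1 ((-(i : ℂ) - 1) * τ) * cexp1 (-(-i * z)) * theta τ z) := by
        generalize cexp1 (τ / 2) = p at *
        generalize cexp1 ((-(i : ℂ) - 1) * τ) = q at *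
        generalize theta τ (z + (-(i : ℂ) - 1) * τ) = Θ at *
        generalize cexp1 (-(-(i : ℂ) * z)) = r at *
        field_simp at h1
        linear_combination h1
      linear_combination cexp1 z * h3 - theta τ (z + (-(i : ℂ) - 1) * τ) * e
  obtain ⟨C, hC, h⟩ := key1 a
  obtain ⟨D, hD, h'⟩ := key2 b
  refine ⟨D * cexp1 (-(b * a)) * C, by simp [hC, hD, cexp1_ne_zero], fun z => ?_⟩
  rw [h', h, mul_add, neg_add, cexp1_add]; ring

theorem theta_lattice_eq_zero (a b : ℤ) : theta τ (a + b * τ) = 0 := by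
  obtain ⟨C, -, h⟩ := theta_add_lattice τ a b
  simpa [theta_zero] using h 0

/-- All zeros of theta are simple. -/
theorem deriv_theta_ne_zero {z : ℂ} (h : theta τ z = 0) : deriv (theta τ) z ≠ 0 := by
  obtain ⟨a, b, rfl⟩ := theta_eq_zero τ h
  obtain ⟨C, hC, hth⟩ := theta_add_lattice τ a b
  -- The quasi-periodicity is differentiated at 0: theta vanishes there with derivative 1, so the
  -- exponential factor contributes only its value 1 and the result is C.
  have e1 : HasDerivAt (fun z => C * cexp1 (-(b * z)) * theta τ z) C 0 := by
    have hd : DifferentiableAt ℂ (fun z : ℂ => C * cexp1 (-(b * z))) 0 := by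
      unfold cexp1; fun_prop
    have := hd.hasDerivAt.mul (hasDerivAt_theta_zero τ)
    simp only [theta_zero, cexp1_zero, mul_zero, neg_zero, mul_one, zero_add] at this
    exact this
  have e2 : HasDerivAt (fun z => theta τ (z + (a + b * τ))) (deriv (theta τ) (a + b * τ)) 0 := by
    have := ((differentiable_theta τ) (0 + (a + b * τ))).hasDerivAt.comp_add_const (0 : ℂ) (a + b * τ)
    simpa using this
  have e3 : (fun z => theta τ (z + (a + b * τ))) = fun z => C * cexp1 (-(b * z)) * theta τ z := by
    funext z; rw [← hth]; congr 1; ring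
  rw [e3] at e2
  rw [e2.unique e1]; exact hC

end

section

open Filter

/-! ### The three-term identity for theta -/

/-- Near a simple zero x₀ of D, the quotient G / D is the quotient of the slopes of G and D at x₀,
and the slope of D takes the value D'(x₀) ≠ 0 there. The removed value is therefore G'(x₀) / D'(x₀).
-/
theorem exists_entire_quotient {G D : ℂ → ℂ} (hG : Differentiable ℂ G) (hD : Differentiable ℂ D)
    (h0 : ∀ x, D x = 0 → G x = 0) (h1 : ∀ x, D x = 0 → deriv D x ≠ 0) :
    ∃ Q : ℂ → ℂ, Differentiable ℂ Q ∧ ∀ x, G x = D x * Q x := by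
  classical
  refine ⟨fun x => if D x = 0 then deriv G x / deriv D x else G x / D x, fun x₀ => ?_, fun x => ?_⟩
  · by_cases hx : D x₀ = 0
    · have dG : Differentiable ℂ (dslope G x₀) := by
        rw [← differentiableOn_univ] at hG ⊢
        exact (Complex.differentiableOn_dslope univ_mem).2 hG
      have dD : Differentiable ℂ (dslope D x₀) := by
        rw [← differentiableOn_univ] at hD ⊢
        exact (Complex.differentiableOn_dslope univ_mem).2 hD
      have hne : dslope D x₀ x₀ ≠ 0 := by rw [dslope_same]; exact h1 x₀ hx
      refine ((dG x₀).div (dD x₀) hne).congr_of_eventuallyEq ?_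
      filter_upwards [dD.continuous.continuousAt.eventually_ne hne] with x hxne
      have eG := sub_smul_dslope G x₀ x
      have eD := sub_smul_dslope D x₀ x
      rw [h0 x₀ hx, sub_zero, smul_eq_mul] at eG
      rw [hx, sub_zero, smul_eq_mul] at eD
      by_cases hxx : x = x₀
      · subst hxx; simp [hx, dslope_same]
      · have hs : x - x₀ ≠ 0 := sub_ne_zero.2 hxx
        have hDx : D x ≠ 0 := by rw [← eD]; exact mul_ne_zero hs hxne
        rw [if_neg hDx, ← eG, ← eD]
        exact mul_div_mul_left _ _ hs
    · refine ((hG x₀).div (hD x₀) hx).congr_of_eventuallyEq ?_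
      filter_upwards [hD.continuous.continuousAt.eventually_ne hx] with x hxne
      simp [hxne]
  · by_cases hx : D x = 0
    · simp [hx, h0 x hx]
    · simp only [hx, if_false]; field_simp

variable (τ : ℍ)

/-- Countability suffices for its uses: the complement of a countable subset of ℂ is dense, so
identities extend across zeros by continuity and products of thetas do not vanish identically. -/
theorem countable_theta_zeros (c : ℂ) : {x : ℂ | theta τ (x + c) = 0}.Countable := by
  refine (Set.countable_range fun p : ℤ × ℤ => (p.1 : ℂ) + p.2 * τ - c).mono ?_
  intro x hx
  obtain ⟨a, b, h⟩ := theta_eq_zero τ hx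
  exact ⟨(a, b), by simp [← h]⟩

/-- A continuous function on `ℂ` that is periodic with respect to the lattice is bounded. -/
theorem bounded_range_of_periodic {Q : ℂ → ℂ} (hQ : Continuous Q)
    (h : ∀ (a b : ℤ) z, Q (z + a + b * τ) = Q z) : Bornology.IsBounded (Set.range Q) := by
  have him : τ.im ≠ 0 := τ.im_pos.ne'
  let p : ℝ × ℝ → ℂ := fun s => s.1 + s.2 * τ
  have hc : IsCompact (p '' (Set.Icc 0 1 ×ˢ Set.Icc 0 1)) :=
    (isCompact_Icc.prod isCompact_Icc).image (by fun_prop)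
  refine (hc.image hQ).isBounded.subset ?_
  rintro _ ⟨z, rfl⟩
  -- The numbers a and b are the real coordinates of z in the basis 1, τ; their fractional parts
  -- place z in the compact period parallelogram.
  set b : ℝ := z.im / τ.im
  set a : ℝ := z.re - b * τ.re
  have hz : z = a + b * τ := by
    apply Complex.ext
    · simp [a]
    · simp [b, him]
  refine ⟨p (Int.fract a, Int.fract b), ⟨_, ⟨⟨Int.fract_nonneg _, (Int.fract_lt_one _).le⟩,
    ⟨Int.fract_nonneg _, (Int.fract_lt_one _).le⟩⟩, rfl⟩, ?_⟩
  rw [← h ⌊a⌋ ⌊b⌋]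
  congr 1
  have e1 : (a : ℂ) = ⌊a⌋ + Int.fract a := by exact_mod_cast (Int.floor_add_fract a).symm
  have e2 : (b : ℂ) = ⌊b⌋ + Int.fract b := by exact_mod_cast (Int.floor_add_fract b).symm
  rw [hz, e1, e2]
  simp only [p]
  ring

/-- An entire function that has the same quasi-periodicity as `theta (x + u) * theta (x + v)`,
`u - v` not in the lattice, vanishes at `-u`, at `-v` and at one further point, is zero. -/
theorem eq_zero_of_theta_quasiperiodic {G : ℂ → ℂ} (hG : Differentiable ℂ G) {u v w : ℂ}
    (huv : theta τ (u - v) ≠ 0) (hu : G (-u) = 0) (hv : G (-v) = 0) (hw : G w = 0)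
    (hwu : theta τ (w + u) ≠ 0) (hwv : theta τ (w + v) ≠ 0)
    (hper : ∀ a b : ℤ, ∃ C : ℂ, C ≠ 0 ∧ ∀ x,
      G (x + a + b * τ) = C * cexp1 (-(b * (2 * x + u + v))) * G x ∧
      theta τ (x + a + b * τ + u) * theta τ (x + a + b * τ + v) =
        C * cexp1 (-(b * (2 * x + u + v))) * (theta τ (x + u) * theta τ (x + v))) :
    ∀ x, G x = 0 := by
  have hth := differentiable_theta τ
  have hdu : Differentiable ℂ fun x => theta τ (x + u) := hth.comp (by fun_prop)
  have hdv : Differentiable ℂ fun x => theta τ (x + v) := hth.comp (by fun_prop)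
  set D : ℂ → ℂ := fun x => theta τ (x + u) * theta τ (x + v) with hDdef
  have hD : Differentiable ℂ D := hdu.mul hdv
  have hderiv : ∀ x, deriv D x = deriv (theta τ) (x + u) * theta τ (x + v) +
      theta τ (x + u) * deriv (theta τ) (x + v) := fun x => by
    rw [hDdef, deriv_fun_mul (hdu x) (hdv x), deriv_comp_add_const, deriv_comp_add_const]
  -- Zeros of the first factor are lattice translates of -u. Since u - v is not in the lattice they
  -- avoid the zeros of the second factor, so all zeros of D are simple.
  have hlat : ∀ x, theta τ (x + u) = 0 → G x = 0 ∧ theta τ (x + v) ≠ 0 := by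
    intro x hx
    obtain ⟨a, b, h⟩ := theta_eq_zero τ hx
    obtain rfl : x = -u + a + b * τ := by linear_combination h
    obtain ⟨C, hC, hG'⟩ := hper a b
    refine ⟨by rw [(hG' _).1, hu, mul_zero], ?_⟩
    obtain ⟨C', hC', hth'⟩ := theta_add_lattice τ a b
    rw [show -u + a + b * (τ : ℂ) + v = -(u - v) + a + b * τ by ring, hth', theta_neg]
    exact mul_ne_zero (mul_ne_zero hC' (cexp1_ne_zero _)) (neg_ne_zero.2 huv)
  have hlat' : ∀ x, theta τ (x + v) = 0 → G x = 0 := by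
    intro x hx
    obtain ⟨a, b, h⟩ := theta_eq_zero τ hx
    obtain rfl : x = -v + a + b * τ := by linear_combination h
    obtain ⟨C, hC, hG'⟩ := hper a b
    rw [(hG' _).1, hv, mul_zero]
  obtain ⟨Q, hQ, hGQ⟩ := exists_entire_quotient hG hD
    (fun x hx => by
      rcases mul_eq_zero.1 hx with h | h
      · exact (hlat x h).1
      · exact hlat' x h)
    (fun x hx => by
      rw [hderiv]
      by_cases h : theta τ (x + u) = 0
      · rw [h, zero_mul, add_zero]
        exact mul_ne_zero (deriv_theta_ne_zero τ h) (hlat x h).2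
      · have h' := (mul_eq_zero.1 hx).resolve_left h
        rw [h', mul_zero, zero_add]
        exact mul_ne_zero h (deriv_theta_ne_zero τ h'))
  have hdense : Dense {x | D x ≠ 0} := by
    have h := ((countable_theta_zeros τ u).union (countable_theta_zeros τ v)).dense_compl ℂ
    refine h.mono fun x hx => ?_
    simp only [Set.mem_compl_iff, Set.mem_union, not_or] at hx
    exact mul_ne_zero hx.1 hx.2
  -- G and D have the same multiplier, so Q is periodic where D does not vanish, and everywhere by
  -- continuity.
  have hQper : ∀ (a b : ℤ) z, Q (z + a + b * τ) = Q z := by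
    intro a b
    obtain ⟨C, hC, h⟩ := hper a b
    have : (fun z => Q (z + a + b * τ)) = Q := by
      refine Continuous.ext_on hdense (hQ.continuous.comp (by fun_prop)) hQ.continuous ?_
      intro x hx
      have e := hGQ (x + a + b * τ)
      have e2 : D (x + a + b * τ) = _ := (h x).2
      rw [(h x).1, e2, hGQ x] at e
      refine (mul_left_cancel₀ (mul_ne_zero (mul_ne_zero hC (cexp1_ne_zero (-(b * (2 * x + u + v)))))
        hx) ?_).symm
      linear_combination e
    exact fun z => congrFun this z
  -- Liouville: an entire doubly periodic function is bounded, hence constant, and the extra zero w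
  -- of G makes the constant 0.
  have hconst := fun x => hQ.apply_eq_apply_of_bounded (bounded_range_of_periodic τ hQ.continuous
    hQper) x w
  have hQw : Q w = 0 := by
    have := hGQ w
    rw [hw] at this
    exact (mul_eq_zero.1 this.symm).resolve_left (mul_ne_zero hwu hwv)
  intro x
  rw [hGQ, hconst, hQw, mul_zero]

/-- The left side is viewed as a function of A. In each of its three terms the two factors
containing A have shifts adding up to B + w, so each term has the multipliers of θ(A + B) θ(A + w).
The sum vanishes at A = -B, at A = -w and at A = 0. The hypotheses say that -B and -w are distinct
modulo the lattice and that 0 is equivalent to neither. -/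
theorem theta_three_term_aux {z w B : ℂ} (hw : theta τ w ≠ 0) (hB : theta τ B ≠ 0)
    (hBw : theta τ (B - w) ≠ 0) (A : ℂ) :
    -(theta τ (z - B) * theta τ (w + A + B) * theta τ A * theta τ (w - z))
      - theta τ (z + A) * theta τ (w - z + A + B) * theta τ w * theta τ B
      + theta τ (w + A) * theta τ (w - z + B) * theta τ z * theta τ (A + B) = 0 := by
  have hth := differentiable_theta τ
  have hd : ∀ c : ℂ, Differentiable ℂ fun x => theta τ (x + c) := fun c => hth.comp (by fun_prop)
  let G : ℂ → ℂ := fun x =>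
    -(theta τ (z - B) * theta τ (x + (w + B)) * theta τ (x + 0) * theta τ (w - z))
      - theta τ (x + z) * theta τ (x + (w - z + B)) * theta τ w * theta τ B
      + theta τ (x + w) * theta τ (w - z + B) * theta τ z * theta τ (x + B)
  have hG : Differentiable ℂ G := by
    refine Differentiable.add (Differentiable.sub (Differentiable.neg ?_) ?_) ?_
    · exact (((hd _).const_mul _).mul (hd _)).mul_const _
    · exact (((hd _).mul (hd _)).mul_const _).mul_const _
    · exact (((hd _).mul_const _).mul_const _).mul (hd _)
  have key := eq_zero_of_theta_quasiperiodic τ hG (u := B) (v := w) (w := 0) hBw ?_ ?_ ?_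
    (by rwa [zero_add]) (by rwa [zero_add]) ?_
  · have := key A
    simp only [G] at this
    rw [← this, add_zero, show A + (w + B) = w + A + B by ring,
      show A + (w - z + B) = w - z + A + B by ring, add_comm A z, add_comm A w]
  · simp only [G]
    rw [show -B + (w + B) = w by ring, show -B + 0 = -B by ring, show -B + z = z - B by ring,
      show -B + (w - z + B) = w - z by ring, neg_add_cancel, theta_zero, theta_neg]
    ring
  · simp only [G]
    rw [show -w + (w + B) = B by ring, show -w + 0 = -w by ring, show -w + z = -(w - z) by ring,
      show -w + (w - z + B) = -(z - B) by ring, neg_add_cancel, theta_zero, theta_neg, theta_neg,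
      theta_neg]
    ring
  · simp only [G, zero_add, theta_zero]
    rw [show z - B = -(B - z) by ring, theta_neg, show w + B = B + w by ring]
    ring
  · intro a b
    obtain ⟨C, hC, h⟩ := theta_add_lattice τ a b
    have h' : ∀ x c, theta τ (x + a + b * τ + c) = C * cexp1 (-(b * (x + c))) * theta τ (x + c) :=
      fun x c => by rw [← h]; congr 1; ring
    have hm : ∀ x c d, c + d = B + w → cexp1 (-(b * (x + c))) * cexp1 (-(b * (x + d))) =
        cexp1 (-(b * (2 * x + B + w))) := fun x c d hcd => by
      rw [← cexp1_add]; congr 1; linear_combination (-b : ℂ) * hcd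
    refine ⟨C * C, mul_ne_zero hC hC, fun x => ⟨?_, ?_⟩⟩
    · simp only [G, h']
      have h1 := hm x (w + B) 0 (by ring)
      have h2 := hm x z (w - z + B) (by ring)
      have h3 := hm x w B (by ring)
      linear_combination
        (-(C * C * theta τ (z - B) * theta τ (x + (w + B)) * theta τ (x + 0) * theta τ (w - z))) * h1
        - (C * C * theta τ (x + z) * theta τ (x + (w - z + B)) * theta τ w * theta τ B) * h2
        + (C * C * theta τ (x + w) * theta τ (w - z + B) * theta τ z * theta τ (x + B)) * h3
    · rw [h', h', ← hm x B w rfl]; ring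

/-- The three-term identity, in the form of the Fay identity for Kronecker functions. -/
theorem theta_three_term {z w : ℂ} (hw : theta τ w ≠ 0) (A B : ℂ) :
    -(theta τ (z - B) * theta τ (w + A + B) * theta τ A * theta τ (w - z))
      - theta τ (z + A) * theta τ (w - z + A + B) * theta τ w * theta τ B
      + theta τ (w + A) * theta τ (w - z + B) * theta τ z * theta τ (A + B) = 0 := by
  have hc := (differentiable_theta τ).continuous
  -- The genericity conditions on B exclude only a countable set, and the identity is continuous in
  -- B.
  have hdense : Dense {x | theta τ x ≠ 0 ∧ theta τ (x - w) ≠ 0} := by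
    have h := ((countable_theta_zeros τ 0).union (countable_theta_zeros τ (-w))).dense_compl ℂ
    refine h.mono fun x hx => ?_
    simp only [Set.mem_compl_iff, Set.mem_union, not_or, Set.mem_ofPred_eq, add_zero,
      ← sub_eq_add_neg] at hx
    exact hx
  have := Continuous.ext_on (f := fun B => -(theta τ (z - B) * theta τ (w + A + B) * theta τ A *
      theta τ (w - z)) - theta τ (z + A) * theta τ (w - z + A + B) * theta τ w * theta τ B
      + theta τ (w + A) * theta τ (w - z + B) * theta τ z * theta τ (A + B)) (g := fun _ => 0)
    hdense (by fun_prop) continuous_const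
    (fun x hx => theta_three_term_aux τ hw hx.1 hx.2 A)
  exact congrFun this B

end

section

open Filter PowerSeries

/-! ### Taylor series as formal power series -/

/-- The Taylor series at `0`. -/
def taylor (f : ℂ → ℂ) : ℂ⟦X⟧ :=
  PowerSeries.mk fun m => iteratedDeriv m f 0 / (m.factorial : ℂ)

theorem coeff_taylor (f : ℂ → ℂ) (m : ℕ) :
    coeff m (taylor f) = iteratedDeriv m f 0 / (m.factorial : ℂ) := coeff_mk _ _

theorem taylor_congr {f g : ℂ → ℂ} (h : f =ᶠ[𝓝 0] g) : taylor f = taylor g := by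
  ext m
  rw [coeff_taylor, coeff_taylor, h.iteratedDeriv_eq]

theorem taylor_const (c : ℂ) : taylor (fun _ => c) = C c := by
  ext m
  rw [coeff_taylor, iteratedDeriv_const, coeff_C]
  split_ifs with h <;> simp [h]

theorem taylor_id : taylor (fun x => x) = X := by
  ext m
  rw [coeff_taylor, iteratedDeriv_fun_id_zero, coeff_X]
  split_ifs with h <;> simp [h]

theorem taylor_add {f g : ℂ → ℂ} (hf : AnalyticAt ℂ f 0) (hg : AnalyticAt ℂ g 0) :
    taylor (fun x => f x + g x) = taylor f + taylor g := by
  ext m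
  rw [map_add, coeff_taylor, coeff_taylor, coeff_taylor,
    iteratedDeriv_fun_add hf.contDiffAt hg.contDiffAt, add_div]

theorem taylor_mul {f g : ℂ → ℂ} (hf : AnalyticAt ℂ f 0) (hg : AnalyticAt ℂ g 0) :
    taylor (fun x => f x * g x) = taylor f * taylor g := by
  ext m
  rw [coeff_taylor, iteratedDeriv_fun_mul hf.contDiffAt hg.contDiffAt, coeff_mul,
    Finset.Nat.sum_antidiagonal_eq_sum_range_succ_mk, Finset.sum_div]
  refine Finset.sum_congr rfl fun i hi => ?_
  have hi' : i ≤ m := by simpa [Nat.lt_succ_iff] using hi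
  rw [coeff_taylor, coeff_taylor, Nat.cast_choose _ hi']
  have h1 := Nat.factorial_ne_zero m
  have h2 := Nat.factorial_ne_zero i
  have h3 := Nat.factorial_ne_zero (m - i)
  field_simp

theorem taylor_const_mul (c : ℂ) {f : ℂ → ℂ} (hf : AnalyticAt ℂ f 0) :
    taylor (fun x => c * f x) = C c * taylor f := by
  rw [taylor_mul analyticAt_const hf, taylor_const]

theorem taylor_comp_mul (a : ℂ) (f : ℂ → ℂ) :
    taylor (fun x => f (a * x)) = rescale a (taylor f) := by
  have key : ∀ m, iteratedDeriv m (fun x => f (a * x)) =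
      fun x => a ^ m * iteratedDeriv m f (a * x) := by
    intro m
    induction m with
    | zero => simp
    | succ m ih =>
      funext x
      rw [iteratedDeriv_succ, ih, deriv_const_mul_field]
      rw [deriv_comp_mul_left, iteratedDeriv_succ, smul_eq_mul]
      ring
  ext m
  rw [coeff_taylor, coeff_rescale, coeff_taylor, key]
  simp only [mul_zero, mul_div_assoc]

theorem taylor_exp_mul (c : ℂ) :
    taylor (fun x => Complex.exp (c * x)) = rescale c (PowerSeries.exp ℂ) := by
  rw [taylor_comp_mul c Complex.exp]
  congr 1
  ext m
  rw [coeff_taylor, iteratedDeriv_eq_iterate, Complex.iter_deriv_exp, coeff_exp]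
  simp

theorem analyticAt_dslope {f : ℂ → ℂ} {c : ℂ} (hf : AnalyticAt ℂ f c) :
    AnalyticAt ℂ (dslope f c) c := by
  obtain ⟨p, hp⟩ := hf
  exact hp.has_fpower_series_dslope_fslope.analyticAt

/-- Since f = f(0) + x · `dslope f 0`, taking the slope shifts the coefficients by one. The function
k_α is such a slope, namely that of `kronFun` at 0. -/
theorem coeff_taylor_dslope {f : ℂ → ℂ} (hf : AnalyticAt ℂ f 0) (m : ℕ) :
    coeff m (taylor (dslope f 0)) = coeff (m + 1) (taylor f) := by
  have h : f = fun x => f 0 + x * dslope f 0 x := by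
    funext x
    have := sub_smul_dslope f 0 x
    simp only [sub_zero, smul_eq_mul] at this
    rw [this]; ring
  have hd := analyticAt_dslope hf
  have hx : AnalyticAt ℂ (fun x : ℂ => x) 0 := analyticAt_id
  have h2 : taylor f = C (f 0) + X * taylor (dslope f 0) := by
    conv_lhs => rw [h]
    rw [taylor_add analyticAt_const (hx.fun_mul hd), taylor_const, taylor_mul hx hd, taylor_id]
  rw [h2, map_add, coeff_succ_X_mul, coeff_C]
  simp

/-! ### Kronecker functions -/

variable (τ : ℍ)

/-- The function `theta x / x`. -/
def thetaSlope : ℂ → ℂ := dslope (theta τ) 0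

theorem theta_eq_mul_slope (x : ℂ) : theta τ x = x * thetaSlope τ x := by
  have := sub_smul_dslope (theta τ) 0 x
  simp only [sub_zero, smul_eq_mul, theta_zero] at this
  exact this.symm

theorem thetaSlope_zero : thetaSlope τ 0 = 1 := by
  rw [thetaSlope, dslope_same, (hasDerivAt_theta_zero τ).deriv]

theorem thetaSlope_neg (x : ℂ) : thetaSlope τ (-x) = thetaSlope τ x := by
  by_cases hx : x = 0
  · simp [hx]
  · have h := theta_neg τ x
    rw [theta_eq_mul_slope, theta_eq_mul_slope τ x] at h
    exact mul_left_cancel₀ hx (by linear_combination -h)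

theorem differentiable_thetaSlope : Differentiable ℂ (thetaSlope τ) := by
  have := differentiable_theta τ
  rw [← differentiableOn_univ] at this ⊢
  exact (Complex.differentiableOn_dslope univ_mem).2 this

/-- The function `x ↦ exp (-2πi a x) (θ (w + x) / θ w) (x / θ x)`, the product of `x` with the
twisted Kronecker function. -/
def kronFun (a w x : ℂ) : ℂ :=
  (theta τ w)⁻¹ * (cexp1 (-(a * x)) * (thetaSlope τ x)⁻¹ * theta τ (w + x))

/-- The part of `kronFun` that does not depend on `w`. -/
def kronFactor (a x : ℂ) : ℂ := cexp1 (-(a * x)) * (thetaSlope τ x)⁻¹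

theorem analyticAt_kronFactor (a : ℂ) : AnalyticAt ℂ (kronFactor τ a) 0 := by
  have h1 : AnalyticAt ℂ (fun x => cexp1 (-(a * x))) 0 :=
    (differentiable_cexp1.comp (g := cexp1) (f := fun x => -(a * x)) (by fun_prop)).analyticAt 0
  exact h1.mul (((differentiable_thetaSlope τ).analyticAt 0).inv (by simp [thetaSlope_zero]))

theorem analyticAt_theta_add (w : ℂ) : AnalyticAt ℂ (fun x => theta τ (w + x)) 0 :=
  ((differentiable_theta τ).comp (f := fun x => w + x) (by fun_prop)).analyticAt 0

theorem analyticAt_kronFun (a w : ℂ) : AnalyticAt ℂ (kronFun τ a w) 0 :=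
  analyticAt_const.mul ((analyticAt_kronFactor τ a).mul (analyticAt_theta_add τ w))

theorem kronFun_zero (a : ℂ) {w : ℂ} (hw : theta τ w ≠ 0) : kronFun τ a w 0 = 1 := by
  simp [kronFun, thetaSlope_zero, cexp1_zero, hw]

theorem kronFun_add_lattice (a w x : ℂ) (p q : ℤ) :
    kronFun τ a (w + p + q * τ) x = cexp1 (-(q * x)) * kronFun τ a w x := by
  obtain ⟨C, hC, h⟩ := theta_add_lattice τ p q
  have e : theta τ (w + p + q * τ + x) = C * cexp1 (-(q * (w + x))) * theta τ (w + x) := by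
    rw [← h]; congr 1; ring
  have hq := cexp1_ne_zero (-(q * w))
  rw [kronFun, kronFun, e, h, mul_add, neg_add, cexp1_add]
  -- At a zero of theta both sides are 0, because the inverse of 0 is 0; elsewhere the constant C
  -- cancels.
  by_cases hw : theta τ w = 0
  · simp [hw]
  · field_simp

theorem kronFun_add_int (a w x : ℂ) (q : ℤ) :
    kronFun τ (a + q) w x = cexp1 (-(q * x)) * kronFun τ a w x := by
  rw [kronFun, kronFun, add_mul, neg_add, cexp1_add]; ring

/-- Changing the lift α̃ by p + qτ changes a by q and w by -p - qτ. The exponential prefactor and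
the multiplier of theta compensate each other, which is the independence of the lift. -/
theorem kronFun_lift_indep (a w x : ℂ) (p q : ℤ) :
    kronFun τ (a + q) (w - p - q * τ) x = kronFun τ a w x := by
  have h := kronFun_add_lattice τ a w x (-p) (-q)
  push_cast at h
  rw [kronFun_add_int, show w - p - q * (τ : ℂ) = w + -p + -q * τ by ring, h, ← mul_assoc,
    ← cexp1_add, show -((q : ℂ) * x) + -(-q * x) = 0 by ring, cexp1_zero, one_mul]

theorem kronFun_neg (a w x : ℂ) : kronFun τ (-a) (-w) (-x) = kronFun τ a w x := by
  rw [kronFun, kronFun, show -w + -x = -(w + x) by ring, theta_neg, theta_neg, thetaSlope_neg,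
    neg_mul_neg, inv_neg]
  ring

/-- The Fay identity. -/
theorem kronFun_fay {a₁ a₂ w₁ w₂ : ℂ} (h₁ : theta τ w₁ ≠ 0) (h₂ : theta τ w₂ ≠ 0)
    (h₃ : theta τ (w₁ + w₂) ≠ 0) {A B : ℂ} (hA : thetaSlope τ A ≠ 0) (hB : thetaSlope τ B ≠ 0)
    (hAB : thetaSlope τ (A + B) ≠ 0) :
    -(A * (kronFun τ a₁ w₁ (-B) * kronFun τ (a₁ + a₂) (w₁ + w₂) (A + B)))
      - B * (kronFun τ a₁ w₁ A * kronFun τ a₂ w₂ (A + B))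
      + (A + B) * (kronFun τ (a₁ + a₂) (w₁ + w₂) A * kronFun τ a₂ w₂ B) = 0 := by
  -- With these values w - z is w₂, so the thetas in the three-term relation are the numerators and
  -- denominators of the three Kronecker functions.
  have key := theta_three_term τ (z := w₁) (w := w₁ + w₂) h₃ A B
  rw [theta_eq_mul_slope τ A, theta_eq_mul_slope τ B, theta_eq_mul_slope τ (A + B),
    show w₁ + w₂ - w₁ = w₂ by ring] at key
  -- The exponential prefactors of the three products all equal E, so they do not affect the theta
  -- identity.
  set E := cexp1 (-((a₁ + a₂) * A)) * cexp1 (-(a₂ * B)) with hE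
  have e1 : cexp1 (-(a₁ * -B)) * cexp1 (-((a₁ + a₂) * (A + B))) = E := by
    rw [hE, ← cexp1_add, ← cexp1_add]; congr 1; ring
  have e2 : cexp1 (-(a₁ * A)) * cexp1 (-(a₂ * (A + B))) = E := by
    rw [hE, ← cexp1_add, ← cexp1_add]; congr 1; ring
  simp only [kronFun, thetaSlope_neg]
  rw [show w₁ + -B = w₁ - B by ring, show w₁ + w₂ + (A + B) = w₁ + w₂ + A + B by ring,
    show w₂ + (A + B) = w₂ + A + B by ring]
  have f1 : (theta τ w₁)⁻¹ * theta τ w₁ = 1 := inv_mul_cancel₀ h₁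
  have f2 : (theta τ w₂)⁻¹ * theta τ w₂ = 1 := inv_mul_cancel₀ h₂
  have f3 : (theta τ (w₁ + w₂))⁻¹ * theta τ (w₁ + w₂) = 1 := inv_mul_cancel₀ h₃
  have g1 : (thetaSlope τ A)⁻¹ * thetaSlope τ A = 1 := inv_mul_cancel₀ hA
  have g2 : (thetaSlope τ B)⁻¹ * thetaSlope τ B = 1 := inv_mul_cancel₀ hB
  have g3 : (thetaSlope τ (A + B))⁻¹ * thetaSlope τ (A + B) = 1 := inv_mul_cancel₀ hAB
  have t1 : cexp1 (-(a₁ * -B)) * cexp1 (-((a₁ + a₂) * (A + B))) * theta τ (w₁ - B) *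
      theta τ (w₁ + w₂ + A + B) * thetaSlope τ A * theta τ w₂ * A
      + cexp1 (-(a₁ * A)) * cexp1 (-(a₂ * (A + B))) * theta τ (w₁ + A) *
      theta τ (w₂ + A + B) * thetaSlope τ B * theta τ (w₁ + w₂) * B
      - E * theta τ (w₁ + w₂ + A) * theta τ (w₂ + B) * thetaSlope τ (A + B) * theta τ w₁ *
      (A + B) = 0 := by
    rw [e1, e2]; linear_combination -E * key
  rw [hE] at t1
  generalize cexp1 (-(a₁ * -B)) = x1 at *
  generalize cexp1 (-((a₁ + a₂) * (A + B))) = x2 at *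
  generalize cexp1 (-(a₁ * A)) = x3 at *
  generalize cexp1 (-(a₂ * (A + B))) = x4 at *
  generalize cexp1 (-((a₁ + a₂) * A)) = x5 at *
  generalize cexp1 (-(a₂ * B)) = x6 at *
  generalize theta τ w₁ = y1 at *
  generalize theta τ w₂ = y2 at *
  generalize theta τ (w₁ + w₂) = y3 at *
  generalize thetaSlope τ A = s1 at *
  generalize thetaSlope τ B = s2 at *
  generalize thetaSlope τ (A + B) = s3 at *
  generalize theta τ (w₁ - B) = z1 at *
  generalize theta τ (w₁ + w₂ + A + B) = z2 at *
  generalize theta τ (w₁ + A) = z3 at *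
  generalize theta τ (w₂ + A + B) = z4 at *
  generalize theta τ (w₁ + w₂ + A) = z5 at *
  generalize theta τ (w₂ + B) = z6 at *
  clear key hE e1 e2 f1 f2 f3 g1 g2 g3
  field_simp
  linear_combination -t1

/-- The Taylor series of `kronFun` at `x = 0`. -/
def kronSeries (a w : ℂ) : ℂ⟦X⟧ := taylor (kronFun τ a w)

/-- This isolates the dependence on w: derivatives of theta at w, with constant coefficients, over
θ(w). Holomorphy off the zeros and the denominators needed for meromorphy are read off from it. -/
theorem coeff_kronSeries (a w : ℂ) (m : ℕ) :
    coeff m (kronSeries τ a w) = (theta τ w)⁻¹ * ∑ p ∈ Finset.HasAntidiagonal.antidiagonal m,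
      coeff p.1 (taylor (kronFactor τ a)) * (iteratedDeriv p.2 (theta τ) w / p.2.factorial) := by
  have h1 := analyticAt_kronFactor τ a
  have h2 := analyticAt_theta_add τ w
  have : kronSeries τ a w = C (theta τ w)⁻¹ *
      (taylor (kronFactor τ a) * taylor (fun x => theta τ (w + x))) := by
    rw [← taylor_mul h1 h2, ← taylor_const_mul _ (h1.fun_mul h2)]; rfl
  rw [this, coeff_C_mul, coeff_mul]
  congr 1
  refine Finset.sum_congr rfl fun p _ => ?_
  rw [coeff_taylor (fun x => theta τ (w + x)), iteratedDeriv_comp_const_add]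
  simp

theorem coeff_zero_kronSeries (a : ℂ) {w : ℂ} (hw : theta τ w ≠ 0) :
    coeff 0 (kronSeries τ a w) = 1 := by
  rw [kronSeries, coeff_taylor]; simp [kronFun_zero τ a hw]

theorem kronSeries_lift_indep (a w : ℂ) (p q : ℤ) :
    kronSeries τ (a + q) (w - p - q * τ) = kronSeries τ a w := by
  unfold kronSeries; congr 1; funext x; exact kronFun_lift_indep τ a w x p q

theorem kronSeries_neg (a w : ℂ) :
    kronSeries τ (-a) (-w) = rescale (-1) (kronSeries τ a w) := by
  unfold kronSeries
  rw [← taylor_comp_mul]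
  congr 1; funext x
  rw [← kronFun_neg τ a]; congr 1; ring

theorem kronSeries_add_lattice (a w : ℂ) (p q : ℤ) :
    kronSeries τ a (w + p + q * τ) =
      rescale (-(2 * Real.pi * Complex.I) * q) (PowerSeries.exp ℂ) * kronSeries τ a w := by
  have h1 : AnalyticAt ℂ (fun x => Complex.exp (-(2 * Real.pi * Complex.I) * q * x)) 0 := by
    fun_prop
  rw [← taylor_exp_mul, kronSeries, kronSeries, ← taylor_mul h1 (analyticAt_kronFun τ a w)]
  congr 1; funext x
  rw [kronFun_add_lattice, cexp1]
  congr 2; ring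

/-- The functional identity is applied to the pair (At, Bt) for t near 0, where the slopes of theta
are nonzero, and expanded in t. -/
theorem kronSeries_fay {a₁ a₂ w₁ w₂ : ℂ} (h₁ : theta τ w₁ ≠ 0) (h₂ : theta τ w₂ ≠ 0)
    (h₃ : theta τ (w₁ + w₂) ≠ 0) (A B : ℂ) :
    -(C A * (rescale (-B) (kronSeries τ a₁ w₁) *
        rescale (A + B) (kronSeries τ (a₁ + a₂) (w₁ + w₂))))
      - C B * (rescale A (kronSeries τ a₁ w₁) * rescale (A + B) (kronSeries τ a₂ w₂))
      + C (A + B) * (rescale A (kronSeries τ (a₁ + a₂) (w₁ + w₂)) *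
        rescale B (kronSeries τ a₂ w₂)) = 0 := by
  have hk : ∀ a w c, AnalyticAt ℂ (fun t => kronFun τ a w (c * t)) 0 := fun a w c => by
    have := analyticAt_kronFun τ a w
    rw [← mul_zero c] at this
    exact AnalyticAt.comp (g := kronFun τ a w) (f := fun t => c * t) this (by fun_prop)
  have hs : ∀ c, ∀ᶠ t in 𝓝 (0 : ℂ), thetaSlope τ (c * t) ≠ 0 := fun c => by
    have : ContinuousAt (fun t => thetaSlope τ (c * t)) 0 :=
      ((differentiable_thetaSlope τ).continuous.comp (by fun_prop)).continuousAt
    exact this.eventually_ne (by simp [thetaSlope_zero])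
  have hx : AnalyticAt ℂ (fun x : ℂ => x) 0 := analyticAt_id
  have key : taylor (fun t => t * (((-A) * (kronFun τ a₁ w₁ (-B * t) *
      kronFun τ (a₁ + a₂) (w₁ + w₂) ((A + B) * t)) +
      (-B) * (kronFun τ a₁ w₁ (A * t) * kronFun τ a₂ w₂ ((A + B) * t)))
      + (A + B) * (kronFun τ (a₁ + a₂) (w₁ + w₂) (A * t) * kronFun τ a₂ w₂ (B * t)))) = C 0 := by
    rw [← taylor_const]
    refine taylor_congr ?_
    filter_upwards [hs A, hs B, hs (A + B)] with t hA hB hAB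
    rw [add_mul] at hAB
    have := kronFun_fay τ (a₁ := a₁) (a₂ := a₂) h₁ h₂ h₃ hA hB hAB
    rw [add_mul, neg_mul B t]
    linear_combination this
  have m1 := (hk a₁ w₁ (-B)).fun_mul (hk (a₁ + a₂) (w₁ + w₂) (A + B))
  have m2 := (hk a₁ w₁ A).fun_mul (hk a₂ w₂ (A + B))
  have m3 := (hk (a₁ + a₂) (w₁ + w₂) A).fun_mul (hk a₂ w₂ B)
  have c1 := (analyticAt_const (v := -A)).fun_mul m1
  have c2 := (analyticAt_const (v := -B)).fun_mul m2
  have c3 := (analyticAt_const (v := A + B)).fun_mul m3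
  have e1 := taylor_mul hx ((c1.fun_add c2).fun_add c3)
  have e2 := taylor_add (c1.fun_add c2) c3
  have e3 := taylor_add c1 c2
  have e4 := taylor_const_mul (-A) m1
  have e5 := taylor_const_mul (-B) m2
  have e6 := taylor_const_mul (A + B) m3
  have e7 := taylor_mul (hk a₁ w₁ (-B)) (hk (a₁ + a₂) (w₁ + w₂) (A + B))
  have e8 := taylor_mul (hk a₁ w₁ A) (hk a₂ w₂ (A + B))
  have e9 := taylor_mul (hk (a₁ + a₂) (w₁ + w₂) A) (hk a₂ w₂ B)
  rw [e1, e2, e3, e4, e5, e6, e7, e8, e9] at key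
  simp only [taylor_comp_mul, taylor_id, map_zero] at key
  -- The coefficients At, Bt and (A + B)t carry a common factor t, which cancels since power series
  -- over ℂ form a domain.
  have key2 := (mul_eq_zero.1 key).resolve_left X_ne_zero
  simp only [map_neg] at key2 
  unfold kronSeries
  linear_combination key2

/-- The Taylor coefficients of the twisted Kronecker function. -/
theorem kronCoeff_eq {M N : ℕ} (α : ZMod M × ZMod N) {z : ℂ} (hz : theta τ (z - lift τ α) ≠ 0)
    (m : ℕ) :
    kronCoeff τ α z m = coeff (m + 1) (kronSeries τ (liftTau α) (z - lift τ α)) := by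
  set H := kronFun τ (liftTau α) (z - lift τ α) with hH
  have hd := analyticAt_dslope (analyticAt_kronFun τ (liftTau α) (z - lift τ α))
  rw [← hH] at hd
  -- Off 0, k_α(x, z) is (H x - H 0) / x: the value H 0 = 1 accounts for the term -1/x.
  have hk : (fun x => kron τ α x z) =ᶠ[𝓝[≠] 0] dslope H 0 := by
    filter_upwards [self_mem_nhdsWithin] with x hx
    have hx : x ≠ 0 := hx
    rw [dslope_of_ne _ hx, slope_def_field, hH, kronFun_zero τ _ hz, kron, kronFun,
      theta_eq_mul_slope τ x, cexp1,
      show -(2 * Real.pi * Complex.I) * liftTau α * x =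
        2 * Real.pi * Complex.I * -(liftTau α * x) by ring]
    -- At a nonzero zero x of theta both sides are -1/x by the convention for division by 0.
    by_cases hs : thetaSlope τ x = 0
    · simp [hs]; ring
    · field_simp
      ring
  have hlim : Filter.limUnder (𝓝[≠] 0) (fun x => kron τ α x z) = dslope H 0 0 := by
    refine Tendsto.limUnder_eq (Tendsto.congr' hk.symm ?_)
    exact hd.continuousAt.tendsto.mono_left nhdsWithin_le_nhds
  have hup : Function.update (fun x => kron τ α x z) 0
      (Filter.limUnder (𝓝[≠] 0) fun x => kron τ α x z) =ᶠ[𝓝 0] dslope H 0 := by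
    rw [hlim]
    rw [EventuallyEq, eventually_nhdsWithin_iff] at hk
    filter_upwards [hk] with x hx
    by_cases h0 : x = 0
    · subst h0; simp
    · rw [Function.update_of_ne h0]; exact hx h0
  rw [kronCoeff, ← coeff_taylor, taylor_congr hup,
    coeff_taylor_dslope (analyticAt_kronFun τ _ _)]
  rfl

end

section

open Filter PowerSeries

/-! ### The Fay identity for commuting operators -/

section Generic

variable {S : Type*} [CommRing S] [Algebra ℂ S]

/-- The power series `f (x t)` in `t`. -/
def scaled (x : S) (f : ℂ⟦X⟧) : S⟦X⟧ := rescale x (PowerSeries.map (algebraMap ℂ S) f)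

theorem coeff_scaled (x : S) (f : ℂ⟦X⟧) (m : ℕ) :
    coeff m (scaled x f) = x ^ m * algebraMap ℂ S (coeff m f) := by
  simp [scaled, coeff_rescale]

/-- The series `f` without its constant term, divided by the variable. -/
def tailSeries (f : ℂ⟦X⟧) : ℂ⟦X⟧ := PowerSeries.mk fun m => coeff (m + 1) f

theorem scaled_eq_tail (x : S) {f : ℂ⟦X⟧} (hf : coeff 0 f = 1) :
    scaled x f = 1 + C x * X * scaled x (tailSeries f) := by
  ext m
  rw [map_add, coeff_scaled]
  rcases m with _ | m
  · rw [hf]; simp [mul_assoc]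
  · rw [mul_assoc, coeff_C_mul, coeff_succ_X_mul, coeff_scaled, tailSeries, coeff_mk, coeff_one]
    simp only [Nat.succ_ne_zero, if_false]
    ring

/-- The divided difference `(f (x t) - f (y t)) / ((x - y) t)`. -/
def dividedDiff (x y : S) (f : ℂ⟦X⟧) : S⟦X⟧ := PowerSeries.mk fun m =>
  algebraMap ℂ S (coeff (m + 1) f) * ∑ s ∈ Finset.range (m + 1), x ^ s * y ^ (m - s)

theorem dividedDiff_mul (x y : S) (f : ℂ⟦X⟧) :
    C (x - y) * X * dividedDiff x y f = scaled x f - scaled y f := by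
  ext m
  rw [map_sub (coeff m), coeff_scaled, coeff_scaled, mul_assoc, coeff_C_mul]
  rcases m with _ | m
  · simp
  · rw [coeff_succ_X_mul, dividedDiff, coeff_mk]
    have := (Commute.all x y).geom_sum₂_mul (m + 1)
    simp only [Nat.add_sub_cancel] at this
    rw [← sub_mul, ← this]
    ring_nf

/-- The left hand side of the Fay identity without poles. -/
def fayExpr (k₁ k₂ k₃ : ℂ⟦X⟧) (A B : S) : S⟦X⟧ :=
  scaled (-B) k₁ * scaled (A + B) k₃ - scaled A k₁ * scaled (A + B) k₂ + scaled A k₃ * scaled B k₂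
    - dividedDiff A (-B) k₁ - dividedDiff B (A + B) k₂ - dividedDiff A (A + B) k₃

/-- Writing each Φ as 1 + X k with the argument scaled, the constant terms cancel because -A - B +
(A + B) = 0. The terms linear in the k's group into three differences of the same series at two
arguments, and each of these is a divided difference times C · X; everything then has the factor X²
A B (A + B). -/
theorem fayExpr_mul (Φ₁ Φ₂ Φ₃ : ℂ⟦X⟧) (h₁ : coeff 0 Φ₁ = 1) (h₂ : coeff 0 Φ₂ = 1)
    (h₃ : coeff 0 Φ₃ = 1) (A B : S) :
    X ^ 2 * C (A * B * (A + B)) * fayExpr (tailSeries Φ₁) (tailSeries Φ₂) (tailSeries Φ₃) A B =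
      -(C A * (scaled (-B) Φ₁ * scaled (A + B) Φ₃)) - C B * (scaled A Φ₁ * scaled (A + B) Φ₂)
      + C (A + B) * (scaled A Φ₃ * scaled B Φ₂) := by
  have d1 := dividedDiff_mul A (-B) (tailSeries Φ₁)
  have d2 := dividedDiff_mul B (A + B) (tailSeries Φ₂)
  have d3 := dividedDiff_mul A (A + B) (tailSeries Φ₃)
  simp only [map_sub, map_neg, map_add] at d1 d2 d3
  rw [scaled_eq_tail (-B) h₁, scaled_eq_tail A h₁, scaled_eq_tail (A + B) h₂,
    scaled_eq_tail B h₂, scaled_eq_tail (A + B) h₃, scaled_eq_tail A h₃, fayExpr]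
  simp only [map_mul, map_add, map_neg]
  linear_combination (-C A * C B * X : S⟦X⟧) * d1 + (C B * (C A + C B) * X : S⟦X⟧) * d2 +
    (C A * (C A + C B) * X : S⟦X⟧) * d3

variable {S' : Type*} [CommRing S'] [Algebra ℂ S']

theorem map_scaled (φ : S →ₐ[ℂ] S') (x : S) (f : ℂ⟦X⟧) :
    PowerSeries.map (φ : S →+* S') (scaled x f) = scaled (φ x) f := by
  ext m
  simp [coeff_scaled]

theorem map_dividedDiff (φ : S →ₐ[ℂ] S') (x y : S) (f : ℂ⟦X⟧) :
    PowerSeries.map (φ : S →+* S') (dividedDiff x y f) = dividedDiff (φ x) (φ y) f := by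
  ext m
  simp [dividedDiff, map_sum]

theorem map_fayExpr (φ : S →ₐ[ℂ] S') (k₁ k₂ k₃ : ℂ⟦X⟧) (A B : S) :
    PowerSeries.map (φ : S →+* S') (fayExpr k₁ k₂ k₃ A B) = fayExpr k₁ k₂ k₃ (φ A) (φ B) := by
  simp only [fayExpr, map_sub, map_add, map_mul, map_scaled, map_dividedDiff, map_neg]

theorem scaled_complex (x : ℂ) (f : ℂ⟦X⟧) : scaled x f = rescale x f := by
  ext m; simp [coeff_scaled, coeff_rescale]

variable (τ : ℍ)

/-- The factor A B (A + B) need not be cancellable in S. The identity is therefore proved for the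
two variables of ℂ[x, y], where it can be tested at all complex points and the factor cancels in a
domain, and then specialised to A and B. -/
theorem fayExpr_kronSeries {a₁ a₂ w₁ w₂ : ℂ} (h₁ : theta τ w₁ ≠ 0) (h₂ : theta τ w₂ ≠ 0)
    (h₃ : theta τ (w₁ + w₂) ≠ 0) (A B : S) :
    fayExpr (tailSeries (kronSeries τ a₁ w₁)) (tailSeries (kronSeries τ a₂ w₂))
      (tailSeries (kronSeries τ (a₁ + a₂) (w₁ + w₂))) A B = 0 := by
  set k₁ := tailSeries (kronSeries τ a₁ w₁)
  set k₂ := tailSeries (kronSeries τ a₂ w₂)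
  set k₃ := tailSeries (kronSeries τ (a₁ + a₂) (w₁ + w₂))
  let P := MvPolynomial (Fin 2) ℂ
  let x : P := MvPolynomial.X 0
  let y : P := MvPolynomial.X 1
  have key : X ^ 2 * C (x * y * (x + y)) * fayExpr k₁ k₂ k₃ x y = 0 := by
    refine PowerSeries.ext fun m => MvPolynomial.funext (R := ℂ) (σ := Fin 2) fun s => ?_
    let φ : P →ₐ[ℂ] ℂ := MvPolynomial.aeval s
    have h := kronSeries_fay τ (a₁ := a₁) (a₂ := a₂) h₁ h₂ h₃ (s 0) (s 1)
    simp only [← scaled_complex] at h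
    rw [← fayExpr_mul _ _ _ (coeff_zero_kronSeries τ _ h₁) (coeff_zero_kronSeries τ _ h₂)
      (coeff_zero_kronSeries τ _ h₃)] at h
    have hφ : PowerSeries.map (φ : P →+* ℂ) (X ^ 2 * C (x * y * (x + y)) * fayExpr k₁ k₂ k₃ x y) =
        0 := by
      have hx : φ x = s 0 := MvPolynomial.aeval_X s 0
      have hy : φ y = s 1 := MvPolynomial.aeval_X s 1
      rw [← h, map_mul, map_mul, map_pow, map_fayExpr, PowerSeries.map_X, PowerSeries.map_C, hx, hy]
      congr 3
      simp only [RingHom.coe_coe, map_mul, map_add, hx, hy]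
    have := congrArg (coeff m) hφ
    rw [PowerSeries.coeff_map] at this
    rw [map_zero, map_zero, ← MvPolynomial.aeval_eq_eval]
    exact this
  have hx : x ≠ 0 := MvPolynomial.X_ne_zero 0
  have hy : y ≠ 0 := MvPolynomial.X_ne_zero 1
  have hxy : x + y ≠ 0 := fun h => by
    have := congrArg (MvPolynomial.eval (fun _ => (1 : ℂ))) h
    simp [x, y] at this
  have hP : fayExpr k₁ k₂ k₃ x y = 0 := by
    refine (mul_eq_zero.1 key).resolve_left (mul_ne_zero (pow_ne_zero 2 X_ne_zero) ?_)
    rw [Ne, map_eq_zero_iff _ PowerSeries.C_injective]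
    exact mul_ne_zero (mul_ne_zero hx hy) hxy
  have := map_fayExpr (MvPolynomial.aeval ![A, B] : P →ₐ[ℂ] S) k₁ k₂ k₃ x y
  rw [hP, map_zero] at this
  simpa [x, y] using this.symm

end Generic

/-- The Fay identity, coefficientwise, for a pair of commuting elements of an algebra. -/
theorem fay_coeff {E : Type*} [Ring E] [Algebra ℂ E] (τ : ℍ) {a₁ a₂ w₁ w₂ : ℂ}
    (h₁ : theta τ w₁ ≠ 0) (h₂ : theta τ w₂ ≠ 0) (h₃ : theta τ (w₁ + w₂) ≠ 0) {A B : E}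
    (hAB : Commute A B) (k₁ k₂ k₃ : ℕ → ℂ)
    (e₁ : ∀ m, k₁ m = coeff (m + 1) (kronSeries τ a₁ w₁))
    (e₂ : ∀ m, k₂ m = coeff (m + 1) (kronSeries τ a₂ w₂))
    (e₃ : ∀ m, k₃ m = coeff (m + 1) (kronSeries τ (a₁ + a₂) (w₁ + w₂))) (m : ℕ) :
    (∑ p ∈ Finset.HasAntidiagonal.antidiagonal m,
      ((k₁ p.1 * k₃ p.2) • ((-B) ^ p.1 * (A + B) ^ p.2) -
        (k₁ p.1 * k₂ p.2) • (A ^ p.1 * (A + B) ^ p.2) +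
        (k₃ p.1 * k₂ p.2) • (A ^ p.1 * B ^ p.2))) -
      k₁ (m + 1) • ∑ s ∈ Finset.range (m + 1), A ^ s * (-B) ^ (m - s) -
      k₂ (m + 1) • ∑ s ∈ Finset.range (m + 1), B ^ s * (A + B) ^ (m - s) -
      k₃ (m + 1) • ∑ s ∈ Finset.range (m + 1), A ^ s * (A + B) ^ (m - s) = 0 := by
  -- The subalgebra generated by two commuting elements is commutative, so the identity over
  -- commutative rings applies inside it.
  have _ : IsMulCommutative (Algebra.adjoin ℂ {A, B}) := Algebra.isMulCommutative_adjoin ℂ (by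
    rintro a (rfl | rfl) b (rfl | rfl)
    exacts [rfl, hAB.eq, hAB.eq.symm, rfl])
  let _ : CommRing (Algebra.adjoin ℂ {A, B}) :=
    { (inferInstance : Ring (Algebra.adjoin ℂ {A, B})) with
      mul_comm := fun a b => IsMulCommutative.is_comm.comm a b }
  let A' : Algebra.adjoin ℂ {A, B} := ⟨A, Algebra.subset_adjoin (by simp)⟩
  let B' : Algebra.adjoin ℂ {A, B} := ⟨B, Algebra.subset_adjoin (by simp)⟩
  have h := congrArg (coeff m) (fayExpr_kronSeries (a₁ := a₁) (a₂ := a₂) τ h₁ h₂ h₃ A' B')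
  simp only [fayExpr, map_sub, map_add, coeff_mul, coeff_scaled, dividedDiff, coeff_mk,
    tailSeries, ← e₁, ← e₂, ← e₃, map_zero] at h
  have h' := congrArg (Algebra.adjoin ℂ {A, B}).val h
  simp only [map_sub, map_add, map_sum, map_mul, map_pow, map_neg, AlgHom.commutes, map_zero] at h'
  have hA : (Algebra.adjoin ℂ {A, B}).val A' = A := rfl
  have hB : (Algebra.adjoin ℂ {A, B}).val B' = B := rfl
  simp only [hA, hB] at h'
  rw [← h', Finset.sum_add_distrib, Finset.sum_sub_distrib]
  have c : ∀ (P Q : E) (a b : ℂ), (a * b) • (P * Q) =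
      P * algebraMap ℂ E a * (Q * algebraMap ℂ E b) := fun P Q a b => by
    rw [Algebra.algebraMap_eq_smul_one, Algebra.algebraMap_eq_smul_one]
    simp [mul_smul, smul_comm a b]
  simp only [c, Algebra.smul_def]

end

/-! ### Iterated brackets -/

section LieLemmas

variable {E : Type*} [LieRing E] [LieAlgebra ℂ E]

/-- The adjoint endomorphism. -/
abbrev adE (x : E) : Module.End ℂ E := LieAlgebra.ad ℂ E x

theorem commute_adE {x y : E} (h : ⁅x, y⁆ = 0) : Commute (adE x) (adE y) := by
  refine LinearMap.ext fun v => ?_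
  simp only [Module.End.mul_apply, LieAlgebra.ad_apply]
  rw [leibniz_lie x y v, h, zero_lie, zero_add]

theorem pow_apply_eq_of_commute {f g : Module.End ℂ E} (h : Commute f g) {v : E} (hv : f v = g v)
    (p : ℕ) : (f ^ p) v = (g ^ p) v := by
  induction p with
  | zero => rfl
  | succ p ih =>
    rw [pow_succ, Module.End.mul_apply, hv, ← Module.End.mul_apply, (h.pow_left p).eq,
      Module.End.mul_apply, ih, ← Module.End.mul_apply, ← pow_succ']

theorem adE_pow_lie {x u : E} (h : ⁅x, u⁆ = 0) (v : E) (p : ℕ) :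
    ⁅(adE x ^ p) v, u⁆ = (adE x ^ p) ⁅v, u⁆ := by
  induction p with
  | zero => rfl
  | succ p ih =>
    rw [pow_succ', Module.End.mul_apply, Module.End.mul_apply, ← ih, LieAlgebra.ad_apply,
      LieAlgebra.ad_apply, leibniz_lie x, h, lie_zero, add_zero]

theorem lie_adE_pow {x u : E} (h : ⁅x, u⁆ = 0) (v : E) (p : ℕ) :
    ⁅u, (adE x ^ p) v⁆ = (adE x ^ p) ⁅u, v⁆ := by
  rw [← lie_skew, adE_pow_lie h, ← map_neg, lie_skew]

theorem lie_adE_pow_eq_zero {x u v : E} (h : ⁅x, u⁆ = 0) (hv : ⁅u, v⁆ = 0) (p : ℕ) :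
    ⁅u, (adE x ^ p) v⁆ = 0 := by rw [lie_adE_pow h, hv, map_zero]

/-- The Leibniz rule for iterated brackets. -/
theorem lie_adE_pow_leibniz (x y t : E) (m : ℕ) :
    ⁅y, (adE x ^ m) t⁆ = (adE x ^ m) ⁅y, t⁆ +
      ∑ s ∈ Finset.range m, (adE x ^ s) ⁅⁅y, x⁆, (adE x ^ (m - 1 - s)) t⁆ := by
  induction m with
  | zero => simp
  | succ m ih =>
    rw [pow_succ', Module.End.mul_apply, LieAlgebra.ad_apply, leibniz_lie y, ih,
      Finset.sum_range_succ', lie_add, Module.End.mul_apply, LieAlgebra.ad_apply, lie_sum]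
    have : ∀ s ∈ Finset.range m, ⁅x, (adE x ^ s) ⁅⁅y, x⁆, (adE x ^ (m - 1 - s)) t⁆⁆ =
        (adE x ^ (s + 1)) ⁅⁅y, x⁆, (adE x ^ (m + 1 - 1 - (s + 1))) t⁆ := fun s hs => by
      rw [pow_succ', Module.End.mul_apply, LieAlgebra.ad_apply]
      congr 5
      omega
    rw [Finset.sum_congr rfl this]
    simp only [Nat.add_sub_cancel, Nat.sub_zero, pow_zero, Module.End.one_apply]
    abel

/-- The vanishing for p + q ≥ D cuts the square down to a triangle, which is the shape of a product
of power series. -/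
theorem sum_range_eq_sum_antidiagonal {G : Type*} [AddCommMonoid G] {D : ℕ} (f : ℕ → ℕ → G)
    (h : ∀ p q, D ≤ p + q → f p q = 0) :
    ∑ p ∈ Finset.range (D + 1), ∑ q ∈ Finset.range (D + 1), f p q =
      ∑ m ∈ Finset.range D, ∑ p ∈ Finset.HasAntidiagonal.antidiagonal m, f p.1 p.2 := by
  rw [← Finset.sum_product', Finset.sum_sigma']
  symm
  refine Finset.sum_of_injOn (fun s => s.2) ?_ ?_ ?_ ?_
  · rintro ⟨m, p⟩ hm ⟨m', p'⟩ hm' (rfl : p = p')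
    simp only [Finset.coe_sigma, Set.mem_sigma_iff, Finset.mem_coe,
      Finset.HasAntidiagonal.mem_antidiagonal] at hm hm'
    obtain rfl := hm.2.symm.trans hm'.2
    rfl
  · rintro ⟨m, p⟩ hm
    simp only [Finset.coe_sigma, Set.mem_sigma_iff, Finset.mem_coe, Finset.mem_range,
      Finset.HasAntidiagonal.mem_antidiagonal] at hm
    simp only [Finset.coe_product, Set.mem_prod, Finset.mem_coe, Finset.mem_range]
    omega
  · rintro ⟨p, q⟩ _ hpq
    refine h p q (not_lt.1 fun hlt => hpq ⟨⟨p + q, (p, q)⟩, ?_, rfl⟩)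
    simpa using hlt
  · intro _ _; rfl

theorem lie_series_series {ι κ : Type*} [Fintype ι] [Fintype κ] {D : ℕ} (f : ι → ℕ → ℂ)
    (g : κ → ℕ → ℂ) (U : ι → ℕ → E) (V : κ → ℕ → E)
    (h : ∀ a b p q, D ≤ p + q → ⁅U a p, V b q⁆ = 0) :
    ⁅∑ a, ∑ p ∈ Finset.range (D + 1), f a p • U a p,
      ∑ b, ∑ q ∈ Finset.range (D + 1), g b q • V b q⁆ =
    ∑ a, ∑ b, ∑ m ∈ Finset.range D, ∑ p ∈ Finset.HasAntidiagonal.antidiagonal m,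
      (f a p.1 * g b p.2) • ⁅U a p.1, V b p.2⁆ := by
  rw [sum_lie]
  refine Finset.sum_congr rfl fun a _ => ?_
  rw [lie_sum]
  refine Finset.sum_congr rfl fun b _ => ?_
  rw [← sum_range_eq_sum_antidiagonal (fun p q => (f a p * g b q) • ⁅U a p, V b q⁆)
    (fun p q hpq => by rw [h a b p q hpq, smul_zero])]
  rw [sum_lie]
  refine Finset.sum_congr rfl fun p _ => ?_
  rw [lie_sum]
  refine Finset.sum_congr rfl fun q _ => ?_
  rw [smul_lie, lie_smul, mul_smul]

/-- As y commutes with each `t a`, only the brackets of y with one of the factors x survive. The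
term m = 0 has no such factor, hence the shift to `c a (m + 1)`. -/
theorem lie_series {ι : Type*} [Fintype ι] {D : ℕ} (c : ι → ℕ → ℂ) (x y : E) (t : ι → E)
    (h : ∀ a, ⁅y, t a⁆ = 0) :
    ⁅y, ∑ a, ∑ m ∈ Finset.range (D + 1), c a m • (adE x ^ m) (t a)⁆ =
      ∑ a, ∑ m ∈ Finset.range D, c a (m + 1) •
        ∑ s ∈ Finset.range (m + 1), (adE x ^ s) ⁅⁅y, x⁆, (adE x ^ (m - s)) (t a)⁆ := by
  simp only [lie_sum]
  refine Finset.sum_congr rfl fun a _ => ?_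
  rw [Finset.sum_range_succ']
  have h0 : ⁅y, c a 0 • (adE x ^ 0) (t a)⁆ = 0 := by
    rw [lie_smul, pow_zero, Module.End.one_apply, h, smul_zero]
  rw [h0, add_zero]
  refine Finset.sum_congr rfl fun m _ => ?_
  rw [lie_smul, lie_adE_pow_leibniz, h, map_zero, zero_add, Nat.add_sub_cancel]

end LieLemmas

/-! ### The relations of the ellipsitomic Lie algebra in a given Lie algebra -/

section Relations

variable {ι Γ E : Type*} [Fintype ι] [DecidableEq ι] [AddCommGroup Γ] [Fintype Γ]
  [LieRing E] [LieAlgebra ℂ E]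

/-- The defining relations of `𝔱_{1,n}^Γ`. -/
structure EllRel (X Y : ι → E) (T : Γ → ι → ι → E) : Prop where
  T_symm : ∀ α i j, i ≠ j → T α i j = T (-α) j i
  XY : ∀ i j, i ≠ j → ⁅X i, Y j⁆ = ∑ α, T α i j
  XY' : ∀ i j, i ≠ j → ⁅X j, Y i⁆ = ∑ α, T α i j
  XX : ∀ i j, ⁅X i, X j⁆ = 0
  YY : ∀ i j, ⁅Y i, Y j⁆ = 0
  XYi : ∀ i, ⁅X i, Y i⁆ = -∑ j ∈ Finset.univ.erase i, ∑ α, T α i j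
  TT : ∀ α β i j k l, i ≠ j → i ≠ k → i ≠ l → j ≠ k → j ≠ l → k ≠ l → ⁅T α i j, T β k l⁆ = 0
  XT : ∀ α i j k, i ≠ j → i ≠ k → j ≠ k → ⁅X i, T α j k⁆ = 0
  YT : ∀ α i j k, i ≠ j → i ≠ k → j ≠ k → ⁅Y i, T α j k⁆ = 0
  TTT : ∀ α β i j k, i ≠ j → i ≠ k → j ≠ k → ⁅T α i j, T (α + β) i k + T β j k⁆ = 0
  XXT : ∀ α i j, i ≠ j → ⁅X i + X j, T α i j⁆ = 0
  YYT : ∀ α i j, i ≠ j → ⁅Y i + Y j, T α i j⁆ = 0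

theorem adE_neg (x : E) : adE (-x) = -adE x := map_neg _ _

namespace EllRel

variable {X Y : ι → E} {T : Γ → ι → ι → E}

theorem X_eq_neg (R : EllRel X Y T) {α : Γ} {i j : ι} (hij : i ≠ j) (p : ℕ) :
    (adE (X i) ^ p) (T α i j) = (adE (-X j) ^ p) (T α i j) := by
  refine pow_apply_eq_of_commute (commute_adE (by rw [lie_neg, R.XX, neg_zero])) ?_ p
  have := R.XXT α i j hij
  rw [add_lie] at this
  simpa [LieAlgebra.ad_apply] using eq_neg_of_add_eq_zero_left this

theorem X_eq_neg' (R : EllRel X Y T) {α : Γ} {i j : ι} (hij : i ≠ j) (p : ℕ) :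
    (adE (X j) ^ p) (T α i j) = (adE (-X i) ^ p) (T α i j) := by
  have := R.X_eq_neg (α := -α) hij.symm p
  rwa [← R.T_symm α i j hij] at this

theorem neg_XT (R : EllRel X Y T) {α : Γ} {i j k : ι} (hij : i ≠ j) (hik : i ≠ k) (hjk : j ≠ k) :
    ⁅-X i, T α j k⁆ = 0 := by rw [neg_lie, R.XT α i j k hij hik hjk, neg_zero]

theorem lie_T_jk (R : EllRel X Y T) (α β : Γ) {i j k : ι} (hij : i ≠ j) (hik : i ≠ k) (hjk : j ≠ k) :
    ⁅T α i j, T β j k⁆ = -⁅T α i j, T (α + β) i k⁆ := by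
  have := R.TTT α β i j k hij hik hjk
  rw [lie_add] at this
  exact eq_neg_of_add_eq_zero_right this

/-- This is the t-relation for the triple (i, k, j) with labels α + β and -β. Together with
`lie_T_jk` it expresses every bracket of two of t_{ij}^α, t_{ik}^{α+β}, t_{jk}^β through the single
element [t_{ij}^α, t_{ik}^{α+β}]. -/
theorem lie_T_ik_jk (R : EllRel X Y T) (α β : Γ) {i j k : ι} (hij : i ≠ j) (hik : i ≠ k) (hjk : j ≠ k) :
    ⁅T (α + β) i k, T β j k⁆ = ⁅T α i j, T (α + β) i k⁆ := by
  have := R.TTT (α + β) (-β) i k j hik hij hjk.symm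
  rw [add_neg_cancel_right, lie_add, R.T_symm (-β) k j hjk.symm, neg_neg] at this
  rw [eq_neg_of_add_eq_zero_right this, lie_skew]

/-- The sum x_i + x_j + x_k commutes with t_{ij} and with t_{ik}, hence with their bracket. This
removes ad x_k in favour of ad x_i and ad x_j. -/
theorem X_sum_lie (R : EllRel X Y T) (α β : Γ) {i j k : ι} (hij : i ≠ j) (hik : i ≠ k) (hjk : j ≠ k) (q : ℕ) :
    (adE (-X k) ^ q) ⁅T α i j, T (α + β) i k⁆ =
      ((adE (X i) + adE (X j)) ^ q) ⁅T α i j, T (α + β) i k⁆ := by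
  rw [← map_add]
  refine pow_apply_eq_of_commute (commute_adE (by
    rw [lie_add, neg_lie, neg_lie, R.XX, R.XX, neg_zero, add_zero])) ?_ q
  have h1 : ⁅X i + X j + X k, T α i j⁆ = 0 := by
    rw [add_lie, R.XXT α i j hij, R.XT α k i j hik.symm hjk.symm hij, add_zero]
  have h2 : ⁅X i + X j + X k, T (α + β) i k⁆ = 0 := by
    rw [add_right_comm, add_lie, R.XXT _ i k hik, R.XT _ j i k hij.symm hjk hik, add_zero]
  have h3 : ⁅X i + X j + X k, ⁅T α i j, T (α + β) i k⁆⁆ = 0 := by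
    rw [leibniz_lie, h1, h2, zero_lie, lie_zero, add_zero]
  rw [add_lie] at h3
  rw [LieAlgebra.ad_apply, LieAlgebra.ad_apply, neg_lie]
  exact (eq_neg_of_add_eq_zero_left h3).symm

/-- On t_{ij} the operator ad x_i equals -ad x_j, and x_j commutes with t_{ik}; on t_{ik} it equals
-ad x_k, and x_k commutes with t_{ij}. After these replacements both powers come out of the bracket.
The lemmas that follow rest on the same choice of which variable acts. -/
theorem lie_ij_ik (R : EllRel X Y T) (α β : Γ) {i j k : ι} (hij : i ≠ j) (hik : i ≠ k) (hjk : j ≠ k) (p q : ℕ) :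
    ⁅(adE (X i) ^ p) (T α i j), (adE (X i) ^ q) (T (α + β) i k)⁆ =
      ((-adE (X j)) ^ p * (adE (X i) + adE (X j)) ^ q) ⁅T α i j, T (α + β) i k⁆ := by
  rw [R.X_eq_neg hij, adE_pow_lie (lie_adE_pow_eq_zero (by rw [lie_neg, R.XX, neg_zero])
    (R.neg_XT hij.symm hjk hik) q), R.X_eq_neg hik,
    lie_adE_pow (R.neg_XT hik.symm hjk.symm hij), R.X_sum_lie α β hij hik hjk, adE_neg]
  rfl

theorem lie_ij_jk (R : EllRel X Y T) (α β : Γ) {i j k : ι} (hij : i ≠ j) (hik : i ≠ k) (hjk : j ≠ k) (p q : ℕ) :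
    ⁅(adE (X i) ^ p) (T α i j), (adE (X j) ^ q) (T β j k)⁆ =
      -(adE (X i) ^ p * (adE (X i) + adE (X j)) ^ q) ⁅T α i j, T (α + β) i k⁆ := by
  rw [adE_pow_lie (lie_adE_pow_eq_zero (R.XX _ _) (R.XT _ _ _ _ hij hik hjk) q),
    R.X_eq_neg hjk, lie_adE_pow (R.neg_XT hik.symm hjk.symm hij), R.lie_T_jk α β hij hik hjk,
    map_neg, R.X_sum_lie α β hij hik hjk, map_neg]
  rfl

theorem lie_ik_jk (R : EllRel X Y T) (α β : Γ) {i j k : ι} (hij : i ≠ j) (hik : i ≠ k) (hjk : j ≠ k) (p q : ℕ) :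
    ⁅(adE (X i) ^ p) (T (α + β) i k), (adE (X j) ^ q) (T β j k)⁆ =
      (adE (X i) ^ p * adE (X j) ^ q) ⁅T α i j, T (α + β) i k⁆ := by
  rw [adE_pow_lie (lie_adE_pow_eq_zero (R.XX _ _) (R.XT _ _ _ _ hij hik hjk) q),
    lie_adE_pow (R.XT _ _ _ _ hij.symm hjk hik), R.lie_T_ik_jk α β hij hik hjk]
  rfl

theorem lie_ik_T_ij (R : EllRel X Y T) (α β : Γ) {i j k : ι} (hij : i ≠ j) (hik : i ≠ k) (hjk : j ≠ k) (s r : ℕ) :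
    (adE (X i) ^ s) ⁅T (α + β) i k, (adE (X i) ^ r) (T α i j)⁆ =
      -(adE (X i) ^ s * (-adE (X j)) ^ r) ⁅T α i j, T (α + β) i k⁆ := by
  rw [R.X_eq_neg hij, lie_adE_pow (R.neg_XT hij.symm hjk hik), ← lie_skew, map_neg, map_neg,
    adE_neg]
  rfl

theorem lie_ij_T_jk (R : EllRel X Y T) (α β : Γ) {i j k : ι} (hij : i ≠ j) (hik : i ≠ k) (hjk : j ≠ k) (s r : ℕ) :
    (adE (X j) ^ s) ⁅T α i j, (adE (X j) ^ r) (T β j k)⁆ =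
      -(adE (X j) ^ s * (adE (X i) + adE (X j)) ^ r) ⁅T α i j, T (α + β) i k⁆ := by
  have := R.lie_ij_jk α β hij hik hjk 0 r
  rw [pow_zero, one_mul, Module.End.one_apply] at this
  rw [this, map_neg]
  rfl

theorem lie_ij_T_ik (R : EllRel X Y T) (α β : Γ) {i j k : ι} (hij : i ≠ j) (hik : i ≠ k) (hjk : j ≠ k) (s r : ℕ) :
    (adE (X i) ^ s) ⁅T α i j, (adE (X i) ^ r) (T (α + β) i k)⁆ =
      (adE (X i) ^ s * (adE (X i) + adE (X j)) ^ r) ⁅T α i j, T (α + β) i k⁆ := by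
  have := R.lie_ij_ik α β hij hik hjk 0 r
  rw [pow_zero, pow_zero, one_mul, Module.End.one_apply] at this
  rw [this]
  rfl

theorem lie_disjoint (R : EllRel X Y T) (α β : Γ) {i j k l : ι} (hij : i ≠ j) (hik : i ≠ k) (hil : i ≠ l)
    (hjk : j ≠ k) (hjl : j ≠ l) (hkl : k ≠ l) (p q : ℕ) :
    ⁅(adE (X i) ^ p) (T α i k), (adE (X j) ^ q) (T β j l)⁆ = 0 := by
  rw [adE_pow_lie (lie_adE_pow_eq_zero (R.XX _ _) (R.XT _ _ _ _ hij hil hjl) q),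
    lie_adE_pow (R.XT _ _ _ _ hij.symm hjk hik), R.TT _ _ _ _ _ _ hik hij hil hjk.symm hkl hjl,
    map_zero, map_zero]

/-- The t_{ij} in [x_i, y_i] cancel against [x_i, y_j], so only indices k different from i and j are
left. -/
theorem lie_YY_X (R : EllRel X Y T) {i j : ι} (hij : i ≠ j) :
    ⁅Y i + Y j, X i⁆ = ∑ k ∈ (Finset.univ.erase i).erase j, ∑ α, T α i k := by
  have h1 := R.XYi i
  have h2 := R.XY i j hij
  rw [← Finset.add_sum_erase _ _ (Finset.mem_erase.2 ⟨hij.symm, Finset.mem_univ j⟩)] at h1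
  rw [add_lie, ← lie_skew, h1, ← lie_skew (Y j), h2]
  abel

theorem lie_Y_X (R : EllRel X Y T) {i j : ι} (hij : i ≠ j) : ⁅Y i, X j⁆ = -∑ α, T α i j := by
  rw [← lie_skew, R.XY' i j hij]

theorem lie_Y_X' (R : EllRel X Y T) {i j : ι} (hij : i ≠ j) : ⁅Y j, X i⁆ = -∑ α, T α i j := by
  rw [← lie_skew, R.XY i j hij]

end EllRel

/-! ### Commutation of the connection coefficients -/

variable (X Y : ι → E) (T : Γ → ι → ι → E) (D : ℕ) (c : ι → ι → Γ → ℕ → ℂ)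

/-- The element `∑_α c_α (ad x_i) t^α_{ij}`, for truncated power series `c_α`. -/
def KijAbs (i j : ι) : E :=
  ∑ α, ∑ m ∈ Finset.range (D + 1), c i j α m • (adE (X i) ^ m) (T α i j)

/-- The element `- y_i + ∑_j ∑_α c_α (ad x_i) t^α_{ij}`. -/
def KAbs (i : ι) : E := -Y i + ∑ j ∈ Finset.univ.erase i, KijAbs X T D c i j

/-- The sum of the terms of `[K_i, K_j]` in which the index `k` occurs. -/
def fayOp (k₁ k₂ k₃ : ℕ → ℂ) (A B : Module.End ℂ E) (m : ℕ) : Module.End ℂ E :=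
  (∑ p ∈ Finset.HasAntidiagonal.antidiagonal m,
      ((k₁ p.1 * k₃ p.2) • ((-B) ^ p.1 * (A + B) ^ p.2) -
        (k₁ p.1 * k₂ p.2) • (A ^ p.1 * (A + B) ^ p.2) +
        (k₃ p.1 * k₂ p.2) • (A ^ p.1 * B ^ p.2))) -
      k₁ (m + 1) • ∑ s ∈ Finset.range (m + 1), A ^ s * (-B) ^ (m - s) -
      k₂ (m + 1) • ∑ s ∈ Finset.range (m + 1), B ^ s * (A + B) ^ (m - s) -
      k₃ (m + 1) • ∑ s ∈ Finset.range (m + 1), A ^ s * (A + B) ^ (m - s)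

variable {X Y T D c}

theorem neg_pow_apply (f : Module.End ℂ E) (m : ℕ) (v : E) :
    ((-f) ^ m) v = (-1 : ℂ) ^ m • (f ^ m) v := by
  rw [← neg_one_smul ℂ f, smul_pow, LinearMap.smul_apply]

/-- After α ↦ -α, the sign (-1)^m from ad x_j = -ad x_i on t_{ij} cancels the one in the parity of
the coefficients, leaving a single minus sign. -/
theorem KijAbs_symm (R : EllRel X Y T) {i j : ι} (hij : i ≠ j)
    (hs : ∀ α m, c j i (-α) m = -((-1) ^ m * c i j α m)) :
    KijAbs X T D c j i = -KijAbs X T D c i j := by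
  rw [KijAbs, KijAbs, ← Equiv.sum_comp (Equiv.neg Γ), ← Finset.sum_neg_distrib]
  refine Finset.sum_congr rfl fun α _ => ?_
  rw [← Finset.sum_neg_distrib]
  refine Finset.sum_congr rfl fun m _ => ?_
  rw [Equiv.neg_apply, hs, ← R.T_symm α i j hij, R.X_eq_neg' hij, adE_neg, neg_pow_apply, neg_smul,
    smul_smul, mul_right_comm, ← mul_pow]
  simp


/-- This and the next reindexing make the label on the edge ik the sum of those on ij and jk, the
form in which the t-relation and the Fay identity apply. -/
theorem sum_shift_right (f : Γ → Γ → E) : ∑ α, ∑ γ, f α γ = ∑ α, ∑ β, f α (α + β) :=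
  Finset.sum_congr rfl fun α _ => (Equiv.sum_comp (Equiv.addLeft α) (f α)).symm

theorem sum_shift_left (f : Γ → Γ → E) : ∑ γ, ∑ β, f γ β = ∑ α, ∑ β, f (α + β) β := by
  rw [Finset.sum_comm, Finset.sum_comm (f := fun α β => f (α + β) β)]
  exact Finset.sum_congr rfl fun β _ =>
    (Equiv.sum_comp (Equiv.addRight β) (fun γ => f γ β)).symm

/-! ### Three-index brackets as operators applied to [t_{ij}^α, t_{ik}^{α+β}]. -/

section Triple

variable {i j k : ι}

theorem lie_Kij_Kik (R : EllRel X Y T)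
    (hN : ∀ (p q : ℕ) (a b u v : E), D ≤ p + q → ⁅(adE a ^ p) u, (adE b ^ q) v⁆ = 0)
    (hij : i ≠ j) (hik : i ≠ k) (hjk : j ≠ k) :
    ⁅KijAbs X T D c i j, KijAbs X T D c i k⁆ = ∑ α, ∑ β, ∑ m ∈ Finset.range D,
      (∑ p ∈ Finset.HasAntidiagonal.antidiagonal m, (c i j α p.1 * c i k (α + β) p.2) •
        ((-adE (X j)) ^ p.1 * (adE (X i) + adE (X j)) ^ p.2)) ⁅T α i j, T (α + β) i k⁆ := by
  rw [KijAbs, KijAbs, lie_series_series _ _ _ _ (fun _ _ p q h => hN p q _ _ _ _ h),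
    sum_shift_right]
  simp only [R.lie_ij_ik _ _ hij hik hjk, LinearMap.sum_apply, LinearMap.smul_apply]

theorem lie_Kij_Kjk (R : EllRel X Y T)
    (hN : ∀ (p q : ℕ) (a b u v : E), D ≤ p + q → ⁅(adE a ^ p) u, (adE b ^ q) v⁆ = 0)
    (hij : i ≠ j) (hik : i ≠ k) (hjk : j ≠ k) :
    ⁅KijAbs X T D c i j, KijAbs X T D c j k⁆ = ∑ α, ∑ β, ∑ m ∈ Finset.range D,
      (∑ p ∈ Finset.HasAntidiagonal.antidiagonal m, -((c i j α p.1 * c j k β p.2) •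
        (adE (X i) ^ p.1 * (adE (X i) + adE (X j)) ^ p.2))) ⁅T α i j, T (α + β) i k⁆ := by
  rw [KijAbs, KijAbs, lie_series_series _ _ _ _ (fun _ _ p q h => hN p q _ _ _ _ h)]
  simp only [R.lie_ij_jk _ _ hij hik hjk, LinearMap.sum_apply, LinearMap.smul_apply,
    LinearMap.neg_apply, smul_neg]

theorem lie_Kik_Kjk (R : EllRel X Y T)
    (hN : ∀ (p q : ℕ) (a b u v : E), D ≤ p + q → ⁅(adE a ^ p) u, (adE b ^ q) v⁆ = 0)
    (hij : i ≠ j) (hik : i ≠ k) (hjk : j ≠ k) :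
    ⁅KijAbs X T D c i k, KijAbs X T D c j k⁆ = ∑ α, ∑ β, ∑ m ∈ Finset.range D,
      (∑ p ∈ Finset.HasAntidiagonal.antidiagonal m, (c i k (α + β) p.1 * c j k β p.2) •
        (adE (X i) ^ p.1 * adE (X j) ^ p.2)) ⁅T α i j, T (α + β) i k⁆ := by
  rw [KijAbs, KijAbs, lie_series_series _ _ _ _ (fun _ _ p q h => hN p q _ _ _ _ h),
    sum_shift_left]
  simp only [R.lie_ik_jk _ _ hij hik hjk, LinearMap.sum_apply, LinearMap.smul_apply]

/-- Since y_i + y_j commutes with t_{ij}, only its brackets with the factors x_i contribute, and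
these introduce a third index. This is the source of the first divided difference in the Fay
expression. -/
theorem lie_YY_Kij (R : EllRel X Y T) (hij : i ≠ j) :
    ⁅Y i + Y j, KijAbs X T D c i j⁆ = ∑ k ∈ (Finset.univ.erase i).erase j,
      ∑ α, ∑ β, ∑ m ∈ Finset.range D, (-(c i j α (m + 1) • ∑ s ∈ Finset.range (m + 1),
        adE (X i) ^ s * (-adE (X j)) ^ (m - s))) ⁅T α i j, T (α + β) i k⁆ := by
  have key : ∀ (α : Γ) (s r : ℕ), (adE (X i) ^ s) ⁅∑ k ∈ (Finset.univ.erase i).erase j,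
      ∑ γ, T γ i k, (adE (X i) ^ r) (T α i j)⁆ = ∑ k ∈ (Finset.univ.erase i).erase j, ∑ β,
        -(adE (X i) ^ s * (-adE (X j)) ^ r) ⁅T α i j, T (α + β) i k⁆ := fun α s r => by
    rw [sum_lie, map_sum]
    refine Finset.sum_congr rfl fun k hk => ?_
    obtain ⟨hkj, hki⟩ : k ≠ j ∧ k ≠ i := by simpa using hk
    rw [← Equiv.sum_comp (Equiv.addLeft α), sum_lie, map_sum]
    exact Finset.sum_congr rfl fun β _ => R.lie_ik_T_ij α β hij hki.symm hkj.symm s r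
  rw [KijAbs, lie_series _ _ _ _ (fun α => R.YYT α i j hij), R.lie_YY_X hij]
  refine Eq.trans (Finset.sum_congr rfl fun α _ => ?_) Finset.sum_comm
  simp only [key]
  have swap : ∀ m ∈ Finset.range D, c i j α (m + 1) • ∑ s ∈ Finset.range (m + 1),
      ∑ k ∈ (Finset.univ.erase i).erase j, ∑ β,
        -(adE (X i) ^ s * (-adE (X j)) ^ (m - s)) ⁅T α i j, T (α + β) i k⁆ =
      ∑ k ∈ (Finset.univ.erase i).erase j, ∑ β, (-(c i j α (m + 1) • ∑ s ∈ Finset.range (m + 1),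
        adE (X i) ^ s * (-adE (X j)) ^ (m - s))) ⁅T α i j, T (α + β) i k⁆ := fun m _ => by
    rw [Finset.sum_comm, Finset.smul_sum]
    refine Finset.sum_congr rfl fun k _ => ?_
    rw [Finset.sum_comm, Finset.smul_sum]
    refine Finset.sum_congr rfl fun β _ => ?_
    simp only [LinearMap.neg_apply, LinearMap.smul_apply, LinearMap.sum_apply,
      Finset.sum_neg_distrib, smul_neg]
  rw [Finset.sum_congr rfl swap, Finset.sum_comm]
  refine Finset.sum_congr rfl fun k _ => ?_
  rw [Finset.sum_comm]

theorem lie_Y_Kjk (R : EllRel X Y T) (hij : i ≠ j) (hik : i ≠ k) (hjk : j ≠ k) :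
    ⁅Y i, KijAbs X T D c j k⁆ =
      ∑ α, ∑ β, ∑ m ∈ Finset.range D, (c j k β (m + 1) • ∑ s ∈ Finset.range (m + 1),
        adE (X j) ^ s * (adE (X i) + adE (X j)) ^ (m - s)) ⁅T α i j, T (α + β) i k⁆ := by
  rw [KijAbs, lie_series _ _ _ _ (fun β => R.YT β i j k hij hik hjk), R.lie_Y_X hij]
  refine Eq.trans (Finset.sum_congr rfl fun β _ => ?_) Finset.sum_comm
  refine Eq.trans (Finset.sum_congr rfl fun m _ => ?_) Finset.sum_comm
  simp only [neg_lie, sum_lie, map_neg, map_sum, R.lie_ij_T_jk _ _ hij hik hjk,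
    Finset.sum_neg_distrib, neg_neg, LinearMap.smul_apply, LinearMap.sum_apply, Finset.smul_sum]
  rw [Finset.sum_comm]

theorem lie_Y_Kik (R : EllRel X Y T) (hij : i ≠ j) (hik : i ≠ k) (hjk : j ≠ k) :
    ⁅Y j, KijAbs X T D c i k⁆ =
      ∑ α, ∑ β, ∑ m ∈ Finset.range D, (-(c i k (α + β) (m + 1) • ∑ s ∈ Finset.range (m + 1),
        adE (X i) ^ s * (adE (X i) + adE (X j)) ^ (m - s))) ⁅T α i j, T (α + β) i k⁆ := by
  rw [KijAbs, lie_series _ _ _ _ (fun γ => R.YT γ j i k hij.symm hjk hik), R.lie_Y_X' hij]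
  have key : ∀ (γ : Γ) (s r : ℕ), (adE (X i) ^ s) ⁅-∑ α, T α i j, (adE (X i) ^ r) (T γ i k)⁆ =
      ∑ α, -(adE (X i) ^ s) ⁅T α i j, (adE (X i) ^ r) (T γ i k)⁆ := fun γ s r => by
    rw [neg_lie, sum_lie, map_neg, map_sum, Finset.sum_neg_distrib]
  simp only [key]
  have swap : ∀ γ, ∑ m ∈ Finset.range D, c i k γ (m + 1) • ∑ s ∈ Finset.range (m + 1),
      ∑ α, -(adE (X i) ^ s) ⁅T α i j, (adE (X i) ^ (m - s)) (T γ i k)⁆ =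
      ∑ α, ∑ m ∈ Finset.range D, c i k γ (m + 1) • ∑ s ∈ Finset.range (m + 1),
        -(adE (X i) ^ s) ⁅T α i j, (adE (X i) ^ (m - s)) (T γ i k)⁆ := fun γ => by
    rw [Finset.sum_comm]
    refine Finset.sum_congr rfl fun m _ => ?_
    rw [← Finset.smul_sum, Finset.sum_comm]
  rw [Finset.sum_congr rfl fun γ _ => swap γ, Finset.sum_comm, sum_shift_right]
  simp only [R.lie_ij_T_ik _ _ hij hik hjk, LinearMap.neg_apply, LinearMap.smul_apply,
    LinearMap.sum_apply, Finset.sum_neg_distrib, smul_neg]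

/-- All six terms are polynomials in A = ad x_i and B = ad x_j applied to the same brackets. The
three involving y's give the divided differences, the three involving two K's give the products, and
together they form `fayOp`. -/
theorem lie_triple_eq_zero (R : EllRel X Y T)
    (hN : ∀ (p q : ℕ) (a b u v : E), D ≤ p + q → ⁅(adE a ^ p) u, (adE b ^ q) v⁆ = 0)
    (hij : i ≠ j) (hik : i ≠ k) (hjk : j ≠ k)
    (hF : ∀ α β (A B : Module.End ℂ E), Commute A B → ∀ m,
      fayOp (c i j α) (c j k β) (c i k (α + β)) A B m = 0) :
    (∑ α, ∑ β, ∑ m ∈ Finset.range D, (-(c i j α (m + 1) • ∑ s ∈ Finset.range (m + 1),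
        adE (X i) ^ s * (-adE (X j)) ^ (m - s))) ⁅T α i j, T (α + β) i k⁆)
      - ⁅Y i, KijAbs X T D c j k⁆ + ⁅Y j, KijAbs X T D c i k⁆
      + ⁅KijAbs X T D c i j, KijAbs X T D c j k⁆ + ⁅KijAbs X T D c i j, KijAbs X T D c i k⁆
      + ⁅KijAbs X T D c i k, KijAbs X T D c j k⁆ = 0 := by
  rw [lie_Y_Kjk R hij hik hjk, lie_Y_Kik R hij hik hjk, lie_Kij_Kjk R hN hij hik hjk,
    lie_Kij_Kik R hN hij hik hjk, lie_Kik_Kjk R hN hij hik hjk]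
  simp only [← Finset.sum_add_distrib, ← Finset.sum_sub_distrib]
  refine Finset.sum_eq_zero fun α _ => Finset.sum_eq_zero fun β _ => Finset.sum_eq_zero fun m _ => ?_
  have h := congrArg (fun f : Module.End ℂ E => f ⁅T α i j, T (α + β) i k⁆)
    (hF α β _ _ (commute_adE (R.XX i j)) m)
  simp only [LinearMap.zero_apply] at h
  rw [← h, fayOp, Finset.sum_add_distrib, Finset.sum_sub_distrib, Finset.sum_neg_distrib]
  simp only [LinearMap.sub_apply, LinearMap.add_apply, LinearMap.neg_apply]
  abel

end Triple

/-- The coefficients of the connection commute. -/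
theorem lie_KAbs_eq_zero (R : EllRel X Y T)
    (hN : ∀ (p q : ℕ) (a b u v : E), D ≤ p + q → ⁅(adE a ^ p) u, (adE b ^ q) v⁆ = 0)
    (hs : ∀ i j, i ≠ j → ∀ α m, c j i (-α) m = -((-1) ^ m * c i j α m))
    (hF : ∀ i j k, i ≠ j → i ≠ k → j ≠ k → ∀ α β (A B : Module.End ℂ E), Commute A B → ∀ m,
      fayOp (c i j α) (c j k β) (c i k (α + β)) A B m = 0) (i j : ι) :
    ⁅KAbs X Y T D c i, KAbs X Y T D c j⁆ = 0 := by
  by_cases hij : i = j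
  · rw [hij, lie_self]
  set S := (Finset.univ.erase i).erase j with hS
  have hS' : (Finset.univ.erase j).erase i = S := Finset.erase_right_comm
  have hmem : ∀ k ∈ S, k ≠ j ∧ k ≠ i := fun k hk => by simpa [hS] using hk
  have e1 : KAbs X Y T D c i = -Y i + KijAbs X T D c i j + ∑ k ∈ S, KijAbs X T D c i k := by
    rw [KAbs, ← Finset.add_sum_erase _ _ (Finset.mem_erase.2 ⟨Ne.symm hij, Finset.mem_univ j⟩),
      add_assoc]
  have e2 : KAbs X Y T D c j = -Y j - KijAbs X T D c i j + ∑ k ∈ S, KijAbs X T D c j k := by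
    rw [KAbs, ← Finset.add_sum_erase _ _ (Finset.mem_erase.2 ⟨hij, Finset.mem_univ i⟩), hS',
      KijAbs_symm R hij (hs i j hij)]
    abel
  -- Only k = l contributes, since terms on disjoint pairs of indices commute.
  have e3 : ⁅∑ k ∈ S, KijAbs X T D c i k, ∑ l ∈ S, KijAbs X T D c j l⁆ =
      ∑ k ∈ S, ⁅KijAbs X T D c i k, KijAbs X T D c j k⁆ := by
    rw [sum_lie]
    refine Finset.sum_congr rfl fun k hk => ?_
    rw [lie_sum]
    refine Finset.sum_eq_single_of_mem k hk fun l hl hlk => ?_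
    obtain ⟨hkj, hki⟩ := hmem k hk
    obtain ⟨hlj, hli⟩ := hmem l hl
    rw [KijAbs, KijAbs, lie_series_series _ _ _ _ (fun _ _ p q h => hN p q _ _ _ _ h)]
    simp only [R.lie_disjoint _ _ hij (Ne.symm hki) (Ne.symm hli) (Ne.symm hkj) (Ne.symm hlj)
      (Ne.symm hlk), smul_zero, Finset.sum_const_zero]
  -- The brackets of -y_i and -y_j with ∓K_{ij} assemble into [y_i + y_j, K_{ij}], which distributes
  -- over the third indices.
  have e4 := lie_YY_Kij (D := D) (c := c) R hij
  have e5 : ∑ k ∈ S, _ = ∑ k ∈ S, (0 : E) := Finset.sum_congr rfl fun k hk =>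
    lie_triple_eq_zero R hN hij (Ne.symm (hmem k hk).2) (Ne.symm (hmem k hk).1)
      (hF i j k hij (Ne.symm (hmem k hk).2) (Ne.symm (hmem k hk).1))
  simp only [Finset.sum_add_distrib, Finset.sum_sub_distrib, Finset.sum_const_zero] at e5
  rw [← hS] at e4
  rw [← e4, ← lie_sum, ← lie_sum, ← lie_sum, ← lie_sum, ← e3] at e5
  rw [e1, e2]
  simp only [add_lie, lie_add, neg_lie, lie_neg, lie_sub, R.YY, lie_self] at e5 ⊢
  have f1 := lie_skew (∑ k ∈ S, KijAbs X T D c i k) (Y j)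
  have f2 := lie_skew (∑ k ∈ S, KijAbs X T D c i k) (KijAbs X T D c i j)
  have f3 := lie_skew (KijAbs X T D c i j) (Y j)
  rw [← f1, ← f2, ← f3, ← e5]
  abel

end Relations

/-! ### Conjugation of the coefficients by exponentials of combinations of the x_l. -/

section Equivariance

variable {ι Γ E : Type*} [Fintype ι] [DecidableEq ι] [AddCommGroup Γ] [Fintype Γ]
  [LieRing E] [LieAlgebra ℂ E]
variable {X Y : ι → E} {T : Γ → ι → ι → E} {D : ℕ}

/-- Only x_i and x_j act nontrivially, and x_j acts as -x_i. So a combination of the x_l acts on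
these elements as a scalar multiple of ad x_i, and its exponential is multiplication of power
series. -/
theorem lie_sum_X_T (R : EllRel X Y T) (b : ι → ℂ) (α : Γ) {i j : ι} (hij : i ≠ j) (m : ℕ) :
    ⁅∑ l, b l • X l, (adE (X i) ^ m) (T α i j)⁆ =
      (b i - b j) • (adE (X i) ^ (m + 1)) (T α i j) := by
  have hi : ⁅X i, (adE (X i) ^ m) (T α i j)⁆ = (adE (X i) ^ (m + 1)) (T α i j) := by
    rw [pow_succ', Module.End.mul_apply, LieAlgebra.ad_apply]
  have hj : ⁅X j, (adE (X i) ^ m) (T α i j)⁆ = -(adE (X i) ^ (m + 1)) (T α i j) := by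
    have h1 := R.X_eq_neg' (α := α) hij 1
    rw [pow_one, pow_one, LieAlgebra.ad_apply, LieAlgebra.ad_apply, neg_lie] at h1
    rw [lie_adE_pow (R.XX i j), h1, map_neg, pow_succ, Module.End.mul_apply, LieAlgebra.ad_apply]
  rw [sum_lie, ← Finset.add_sum_erase _ _ (Finset.mem_univ i),
    ← Finset.add_sum_erase _ _ (Finset.mem_erase.2 ⟨hij.symm, Finset.mem_univ j⟩),
    Finset.sum_eq_zero (fun l hl => ?_), smul_lie, smul_lie, hi, hj, add_zero, smul_neg, sub_smul,
    sub_eq_add_neg]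
  obtain ⟨hlj, hli⟩ : l ≠ j ∧ l ≠ i := by simpa using hl
  rw [smul_lie, lie_adE_pow_eq_zero (R.XX i l) (R.XT α l i j hli hlj hij), smul_zero]

theorem ad_sum_X_pow_T (R : EllRel X Y T) (lam : ℂ) (b : ι → ℂ) (α : Γ) {i j : ι} (hij : i ≠ j)
    (k m : ℕ) :
    (adE (lam • ∑ l, b l • X l) ^ k) ((adE (X i) ^ m) (T α i j)) =
      (lam * (b i - b j)) ^ k • (adE (X i) ^ (k + m)) (T α i j) := by
  induction k with
  | zero => simp
  | succ k ih =>
    rw [pow_succ', Module.End.mul_apply, ih, map_smul, LieAlgebra.ad_apply, smul_lie,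
      lie_sum_X_T R b α hij, smul_smul, smul_smul, pow_succ, add_right_comm]
    congr 1; ring

theorem lie_sum_X_Y (R : EllRel X Y T) (b : ι → ℂ) (i : ι) :
    ⁅∑ l, b l • X l, Y i⁆ = -∑ j ∈ Finset.univ.erase i, ∑ α, (b i - b j) • T α i j := by
  rw [sum_lie, ← Finset.add_sum_erase _ _ (Finset.mem_univ i), smul_lie, R.XYi, smul_neg,
    Finset.smul_sum, ← Finset.sum_neg_distrib, ← Finset.sum_neg_distrib, ← Finset.sum_add_distrib]
  refine Finset.sum_congr rfl fun j hj => ?_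
  rw [smul_lie, R.XY' i j (Finset.ne_of_mem_erase hj).symm, ← Finset.smul_sum, sub_smul]
  abel

theorem ad_sum_X_pow_Y (R : EllRel X Y T) (lam : ℂ) (b : ι → ℂ) (i : ι) (k : ℕ) :
    (adE (lam • ∑ l, b l • X l) ^ (k + 1)) (Y i) =
      -∑ j ∈ Finset.univ.erase i, ∑ α,
        (lam * (b i - b j)) ^ (k + 1) • (adE (X i) ^ k) (T α i j) := by
  rw [pow_succ, Module.End.mul_apply, LieAlgebra.ad_apply, smul_lie, lie_sum_X_Y R, smul_neg,
    map_neg, map_smul, map_sum, Finset.smul_sum]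
  congr 1
  refine Finset.sum_congr rfl fun j hj => ?_
  rw [map_sum, Finset.smul_sum]
  refine Finset.sum_congr rfl fun α _ => ?_
  have := ad_sum_X_pow_T R lam b α (Finset.ne_of_mem_erase hj).symm k 0
  rw [pow_zero, Module.End.one_apply, add_zero] at this
  rw [map_smul, this, smul_smul, smul_smul, pow_succ']

/-- The exponential of `ad (lam ∑ b_l x_l)` maps the coefficients of the connection to those with
the shifted power series. -/
theorem exp_KAbs (R : EllRel X Y T) (hN : ∀ (p : ℕ) (a u : E), D ≤ p → (adE a ^ p) u = 0)
    (lam : ℂ) (b : ι → ℂ) (c c' : ι → ι → Γ → ℕ → ℂ) (i : ι)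
    (hc : ∀ j, i ≠ j → ∀ α m, c' i j α m =
      ((m + 1).factorial : ℂ)⁻¹ * (lam * (b i - b j)) ^ (m + 1) +
      ∑ p ∈ Finset.HasAntidiagonal.antidiagonal m,
        (p.1.factorial : ℂ)⁻¹ * (lam * (b i - b j)) ^ p.1 * c i j α p.2) :
    ∑ k ∈ Finset.range (D + 1), (k.factorial : ℂ)⁻¹ •
      (adE (lam • ∑ l, b l • X l) ^ k) (KAbs X Y T D c i) = KAbs X Y T D c' i := by
  set U := adE (lam • ∑ l, b l • X l) with hU
  -- On the t_{ij} part the exponential multiplies the power series by e^{sx}, where s = lam (b_i -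
  -- b_j).
  have hT : ∀ j, i ≠ j → ∀ α, ∑ k ∈ Finset.range (D + 1), (k.factorial : ℂ)⁻¹ •
      (U ^ k) (∑ m ∈ Finset.range (D + 1), c i j α m • (adE (X i) ^ m) (T α i j)) =
      ∑ m ∈ Finset.range D, (∑ p ∈ Finset.HasAntidiagonal.antidiagonal m,
        (p.1.factorial : ℂ)⁻¹ * (lam * (b i - b j)) ^ p.1 * c i j α p.2) •
          (adE (X i) ^ m) (T α i j) := by
    intro j hij α
    have e : ∀ k ∈ Finset.range (D + 1), (k.factorial : ℂ)⁻¹ •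
        (U ^ k) (∑ m ∈ Finset.range (D + 1), c i j α m • (adE (X i) ^ m) (T α i j)) =
        ∑ m ∈ Finset.range (D + 1), ((k.factorial : ℂ)⁻¹ * (lam * (b i - b j)) ^ k * c i j α m) •
          (adE (X i) ^ (k + m)) (T α i j) := fun k _ => by
      rw [map_sum, Finset.smul_sum]
      refine Finset.sum_congr rfl fun m _ => ?_
      rw [map_smul, hU, ad_sum_X_pow_T R lam b α hij, smul_smul, smul_smul]
      congr 1; ring
    rw [Finset.sum_congr rfl e, sum_range_eq_sum_antidiagonal
      (fun k m => ((k.factorial : ℂ)⁻¹ * (lam * (b i - b j)) ^ k * c i j α m) •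
          (adE (X i) ^ (k + m)) (T α i j)) (fun p q h => by simp only [hN _ _ _ h, smul_zero])]
    refine Finset.sum_congr rfl fun m _ => ?_
    rw [Finset.sum_smul]
    refine Finset.sum_congr rfl fun p hp => ?_
    rw [Finset.HasAntidiagonal.mem_antidiagonal.1 hp]
  -- On y_i the first bracket already produces t_{ij}, so one power of x is lost and the series
  -- (e^{sx} - 1)/x appears: the additive term in hc.
  have hY : ∑ k ∈ Finset.range (D + 1), (k.factorial : ℂ)⁻¹ • (U ^ k) (Y i) =
      Y i - ∑ j ∈ Finset.univ.erase i, ∑ α, ∑ m ∈ Finset.range D,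
        (((m + 1).factorial : ℂ)⁻¹ * (lam * (b i - b j)) ^ (m + 1)) •
          (adE (X i) ^ m) (T α i j) := by
    rw [Finset.sum_range_succ', sub_eq_neg_add]
    congr 1
    · have e : ∀ k ∈ Finset.range D, ((k + 1).factorial : ℂ)⁻¹ • (U ^ (k + 1)) (Y i) =
          -∑ j ∈ Finset.univ.erase i, ∑ α, (((k + 1).factorial : ℂ)⁻¹ *
            (lam * (b i - b j)) ^ (k + 1)) • (adE (X i) ^ k) (T α i j) := fun k _ => by
        rw [hU, ad_sum_X_pow_Y R, smul_neg, Finset.smul_sum]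
        simp only [Finset.smul_sum, smul_smul]
      rw [Finset.sum_congr rfl e, Finset.sum_neg_distrib]
      congr 1
      refine Eq.trans Finset.sum_comm (Finset.sum_congr rfl fun j _ => ?_)
      exact Finset.sum_comm
    · simp
  have hK : ∀ j, i ≠ j → KijAbs X T D c' i j = (∑ α, ∑ m ∈ Finset.range D,
      (((m + 1).factorial : ℂ)⁻¹ * (lam * (b i - b j)) ^ (m + 1)) • (adE (X i) ^ m) (T α i j)) +
      ∑ k ∈ Finset.range (D + 1), (k.factorial : ℂ)⁻¹ • (U ^ k) (KijAbs X T D c i j) := by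
    intro j hij
    have e : ∑ k ∈ Finset.range (D + 1), (k.factorial : ℂ)⁻¹ • (U ^ k) (KijAbs X T D c i j) =
        ∑ α, ∑ m ∈ Finset.range D, (∑ p ∈ Finset.HasAntidiagonal.antidiagonal m,
        (p.1.factorial : ℂ)⁻¹ * (lam * (b i - b j)) ^ p.1 * c i j α p.2) •
          (adE (X i) ^ m) (T α i j) := by
      simp only [← hT j hij]
      rw [Finset.sum_comm]
      refine Finset.sum_congr rfl fun k _ => ?_
      rw [KijAbs, map_sum, Finset.smul_sum]
    rw [e, KijAbs, ← Finset.sum_add_distrib]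
    refine Finset.sum_congr rfl fun α _ => ?_
    rw [Finset.sum_range_succ, hN D _ _ le_rfl, smul_zero, add_zero, ← Finset.sum_add_distrib]
    refine Finset.sum_congr rfl fun m _ => ?_
    rw [hc j hij, add_smul]
  have hsum : ∑ k ∈ Finset.range (D + 1), (k.factorial : ℂ)⁻¹ • (U ^ k) (KAbs X Y T D c i) =
      -(∑ k ∈ Finset.range (D + 1), (k.factorial : ℂ)⁻¹ • (U ^ k) (Y i)) +
      ∑ j ∈ Finset.univ.erase i, ∑ k ∈ Finset.range (D + 1), (k.factorial : ℂ)⁻¹ •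
        (U ^ k) (KijAbs X T D c i j) := by
    rw [Finset.sum_comm, ← Finset.sum_neg_distrib, ← Finset.sum_add_distrib]
    refine Finset.sum_congr rfl fun k _ => ?_
    rw [KAbs, map_add, map_neg, map_sum, smul_add, smul_neg, Finset.smul_sum]
  rw [hsum, hY, KAbs, Finset.sum_congr rfl fun j hj => hK j (Finset.ne_of_mem_erase hj).symm,
    Finset.sum_add_distrib]
  abel

end Equivariance

/-! ### Lifts of elements of `Γ` -/

section Lifts

variable {M N : ℕ} [NeZero M] [NeZero N] (τ : ℍ)

theorem zmod_val_div_eq (M : ℕ) [NeZero M] {a : ZMod M} {x : ℤ} (h : (x : ZMod M) = a) :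
    ∃ p : ℤ, (a.val : ℂ) / M = (x : ℂ) / M + p := by
  have h1 : (((a.val : ℤ) : ZMod M)) = (x : ZMod M) := by
    rw [h]; simp
  rw [ZMod.intCast_eq_intCast_iff_dvd_sub] at h1
  obtain ⟨k, hk⟩ := h1
  have hM : (M : ℂ) ≠ 0 := Nat.cast_ne_zero.2 (NeZero.ne M)
  have hk' : (x : ℂ) - a.val = M * k := by exact_mod_cast congrArg (fun t : ℤ => (t : ℂ)) hk
  refine ⟨-k, ?_⟩
  field_simp
  push_cast
  linear_combination -hk'

/-- The lift uses `ZMod.val`, which is not additive. Comparison with arbitrary integer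
representatives shows that lifts respect negation and addition up to the lattice. -/
theorem lift_eq_of_cast {α : ZMod M × ZMod N} {x y : ℤ} (hx : (x : ZMod M) = α.1)
    (hy : (y : ZMod N) = α.2) :
    ∃ p q : ℤ, liftTau α = (y : ℂ) / N + q ∧
      lift τ α = (x : ℂ) / M + (y : ℂ) / N * τ + p + q * τ := by
  obtain ⟨p, hp⟩ := zmod_val_div_eq M hx
  obtain ⟨q, hq⟩ := zmod_val_div_eq N hy
  refine ⟨p, q, hq, ?_⟩
  rw [lift, liftTau, hp, hq]; ring

theorem lift_neg (α : ZMod M × ZMod N) :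
    ∃ p q : ℤ, liftTau (-α) = -liftTau α + q ∧ lift τ (-α) = -lift τ α + p + q * τ := by
  obtain ⟨p, q, h1, h2⟩ := lift_eq_of_cast τ (α := -α) (x := -(α.1.val : ℤ))
    (y := -(α.2.val : ℤ)) (by simp) (by simp)
  refine ⟨p, q, ?_, ?_⟩
  · rw [h1, liftTau]; push_cast; ring
  · rw [h2, lift, liftTau]; push_cast; ring

theorem lift_add (α β : ZMod M × ZMod N) :
    ∃ p q : ℤ, liftTau (α + β) = liftTau α + liftTau β + q ∧
      lift τ (α + β) = lift τ α + lift τ β + p + q * τ := by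
  obtain ⟨p, q, h1, h2⟩ := lift_eq_of_cast τ (α := α + β) (x := (α.1.val : ℤ) + β.1.val)
    (y := (α.2.val : ℤ) + β.2.val) (by simp) (by simp)
  refine ⟨p, q, ?_, ?_⟩
  · rw [h1, liftTau, liftTau]; push_cast; ring
  · rw [h2, lift, lift, liftTau, liftTau]; push_cast; ring

variable (M N) in
/-- The point `ζ` does not lie in `(1/M) ℤ + (τ/N) ℤ`. -/
def Regular (ζ : ℂ) : Prop := ∀ α : ZMod M × ZMod N, theta τ (ζ - lift τ α) ≠ 0

theorem regular_iff {ζ : ℂ} :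
    Regular M N τ ζ ↔ ∀ a b : ℤ, ζ ≠ (a : ℂ) / M + (b : ℂ) / N * τ := by
  have hM : (M : ℂ) ≠ 0 := Nat.cast_ne_zero.2 (NeZero.ne M)
  have hN : (N : ℂ) ≠ 0 := Nat.cast_ne_zero.2 (NeZero.ne N)
  constructor
  · rintro h a b rfl
    obtain ⟨p, q, -, h2⟩ := lift_eq_of_cast (M := M) (N := N) τ (α := (a, b)) (x := a) (y := b) rfl rfl
    refine h (a, b) ?_
    have := theta_lattice_eq_zero τ (-p) (-q)
    rw [h2, ← this]
    congr 1; push_cast; ring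
  · intro h α h0
    obtain ⟨a, b, hab⟩ := theta_eq_zero τ h0
    refine h (α.1.val + a * M) (α.2.val + b * N) ?_
    rw [sub_eq_iff_eq_add] at hab
    rw [hab, lift, liftTau]
    push_cast
    field_simp
    ring

theorem Regular.theta_sub_sub_ne_zero {τ : ℍ} {ζ : ℂ} (h : Regular M N τ ζ)
    (α β : ZMod M × ZMod N) : theta τ (ζ - lift τ α - lift τ β) ≠ 0 := by
  obtain ⟨p, q, -, h2⟩ := lift_add τ α β
  obtain ⟨C, hC, hth⟩ := theta_add_lattice τ p q
  rw [show ζ - lift τ α - lift τ β = ζ - lift τ (α + β) + p + q * τ by rw [h2]; ring, hth]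
  exact mul_ne_zero (mul_ne_zero hC (cexp1_ne_zero _)) (h _)

theorem Regular.neg {τ : ℍ} {ζ : ℂ} (h : Regular M N τ ζ) : Regular M N τ (-ζ) := by
  rw [regular_iff] at h ⊢
  intro a b hab
  refine h (-a) (-b) ?_
  push_cast
  linear_combination -hab

/-- This is k_{-α}(-x, -ζ) = -k_α(x, ζ), the overall sign coming from the division by x. -/
theorem kronCoeff_neg {ζ : ℂ} (h : Regular M N τ ζ) (α : ZMod M × ZMod N) (m : ℕ) :
    kronCoeff τ (-α) (-ζ) m = -((-1) ^ m * kronCoeff τ α ζ m) := by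
  obtain ⟨p, q, h1, h2⟩ := lift_neg τ α
  rw [kronCoeff_eq τ _ (h.neg _), kronCoeff_eq τ _ (h _), h1, h2,
    show -ζ - (-lift τ α + p + q * τ) = -(ζ - lift τ α) - p - q * τ by ring,
    kronSeries_lift_indep, kronSeries_neg, PowerSeries.coeff_rescale, pow_succ]
  ring

/-- The third function in the Fay identity has the sums of the first two sets of parameters, whereas
the chosen lift of α + β differs from the sum of lifts by a lattice vector. -/
theorem kronCoeff_add {ζ : ℂ} (h : Regular M N τ ζ) (α β : ZMod M × ZMod N) (m : ℕ) :
    kronCoeff τ (α + β) ζ m = PowerSeries.coeff (m + 1)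
      (kronSeries τ (liftTau α + liftTau β) (ζ - lift τ α - lift τ β)) := by
  obtain ⟨p, q, h1, h2⟩ := lift_add τ α β
  rw [kronCoeff_eq τ _ (h _), h1, h2,
    show ζ - (lift τ α + lift τ β + p + q * τ) = ζ - lift τ α - lift τ β - p - q * τ by ring,
    kronSeries_lift_indep]

theorem Regular.add_lattice {τ : ℍ} {ζ : ℂ} (h : Regular M N τ ζ) (p q : ℤ) :
    Regular M N τ (ζ + p + q * τ) := by
  intro α
  obtain ⟨C, hC, hth⟩ := theta_add_lattice τ p q
  rw [show ζ + p + q * τ - lift τ α = ζ - lift τ α + p + q * τ by ring, hth]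
  exact mul_ne_zero (mul_ne_zero hC (cexp1_ne_zero _)) (h _)

theorem kronCoeff_add_lattice {ζ : ℂ} (h : Regular M N τ ζ) (α : ZMod M × ZMod N) (p q : ℤ)
    (m : ℕ) :
    kronCoeff τ α (ζ + p + q * τ) m =
      ((m + 1).factorial : ℂ)⁻¹ * (-(2 * Real.pi * Complex.I) * q) ^ (m + 1) +
      ∑ s ∈ Finset.HasAntidiagonal.antidiagonal m,
        (s.1.factorial : ℂ)⁻¹ * (-(2 * Real.pi * Complex.I) * q) ^ s.1 * kronCoeff τ α ζ s.2 := by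
  rw [kronCoeff_eq τ _ (h.add_lattice p q _),
    show ζ + p + q * τ - lift τ α = ζ - lift τ α + p + q * τ by ring, kronSeries_add_lattice,
    -- The separated term pairs the top exponential coefficient with the constant term 1 of the
    -- series; it is the additive part of the transformation.
    PowerSeries.coeff_mul, Finset.Nat.sum_antidiagonal_succ', coeff_zero_kronSeries τ _ (h α)]
  have hE : ∀ s, PowerSeries.coeff s (PowerSeries.rescale (-(2 * Real.pi * Complex.I) * q)
      (PowerSeries.exp ℂ)) = (s.factorial : ℂ)⁻¹ * (-(2 * Real.pi * Complex.I) * q) ^ s := by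
    intro s
    rw [PowerSeries.coeff_rescale, PowerSeries.coeff_exp, mul_comm]
    simp
  congr 1
  · rw [hE, mul_one]
  · refine Finset.sum_congr rfl fun s _ => ?_
    dsimp only
    rw [hE, kronCoeff_eq τ _ (h _)]

end Lifts

/-! ### The relations in the truncations -/

section Trunc

variable {M N n : ℕ} [NeZero M] [NeZero N]

theorem EllRel.map {ι Γ E E' : Type*} [Fintype ι] [DecidableEq ι] [AddCommGroup Γ] [Fintype Γ]
    [LieRing E] [LieAlgebra ℂ E] [LieRing E'] [LieAlgebra ℂ E'] {X Y : ι → E} {T : Γ → ι → ι → E}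
    (R : EllRel X Y T) (f : E →ₗ⁅ℂ⁆ E') :
    EllRel (fun i => f (X i)) (fun i => f (Y i)) (fun α i j => f (T α i j)) where
  T_symm α i j h := congrArg f (R.T_symm α i j h)
  XY i j h := by rw [← LieHom.map_lie, R.XY i j h, map_sum]
  XY' i j h := by rw [← LieHom.map_lie, R.XY' i j h, map_sum]
  XX i j := by rw [← LieHom.map_lie, R.XX, map_zero]
  YY i j := by rw [← LieHom.map_lie, R.YY, map_zero]
  XYi i := by rw [← LieHom.map_lie, R.XYi, map_neg, map_sum]; simp only [map_sum]
  TT α β i j k l h1 h2 h3 h4 h5 h6 := by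
    rw [← LieHom.map_lie, R.TT α β i j k l h1 h2 h3 h4 h5 h6, map_zero]
  XT α i j k h1 h2 h3 := by rw [← LieHom.map_lie, R.XT α i j k h1 h2 h3, map_zero]
  YT α i j k h1 h2 h3 := by rw [← LieHom.map_lie, R.YT α i j k h1 h2 h3, map_zero]
  TTT α β i j k h1 h2 h3 := by
    rw [← map_add, ← LieHom.map_lie, R.TTT α β i j k h1 h2 h3, map_zero]
  XXT α i j h := by rw [← map_add, ← LieHom.map_lie, R.XXT α i j h, map_zero]
  YYT α i j h := by rw [← map_add, ← LieHom.map_lie, R.YYT α i j h, map_zero]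

theorem quotHom_relator {u : Free M N n} (h : Relator M N n u) : quotHom (relIdeal M N n) u = 0 :=
  LieSubmodule.Quotient.mk_eq_zero'.2 (LieSubmodule.subset_lieSpan h)

theorem ellRel_T1 : EllRel (tx (M := M) (N := N) (n := n)) ty tt where
  T_symm α i j h := sub_eq_zero.1 ((map_sub _ _ _).symm.trans (quotHom_relator (.tS1 α i j h)))
  XY i j h := by
    have := quotHom_relator (M := M) (N := N) (.tS2 i j h)
    rw [map_sub, LieHom.map_lie, map_sum] at this
    exact sub_eq_zero.1 this
  XY' i j h := by
    have := quotHom_relator (M := M) (N := N) (.tS2' i j h)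
    rw [map_sub, LieHom.map_lie, map_sum] at this
    exact sub_eq_zero.1 this
  XX i j := by
    by_cases h : i = j
    · rw [h, lie_self]
    · have := quotHom_relator (M := M) (N := N) (.tNx i j h)
      rwa [LieHom.map_lie] at this
  YY i j := by
    by_cases h : i = j
    · rw [h, lie_self]
    · have := quotHom_relator (M := M) (N := N) (.tNy i j h)
      rwa [LieHom.map_lie] at this
  XYi i := by
    have := quotHom_relator (M := M) (N := N) (.tT i)
    rw [map_add, LieHom.map_lie, map_sum] at this
    simp only [map_sum] at this
    exact eq_neg_of_add_eq_zero_left this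
  TT α β i j k l h1 h2 h3 h4 h5 h6 := by
    have := quotHom_relator (.tL1 α β i j k l h1 h2 h3 h4 h5 h6)
    rwa [LieHom.map_lie] at this
  XT α i j k h1 h2 h3 := by
    have := quotHom_relator (.tL2x α i j k h1 h2 h3)
    rwa [LieHom.map_lie] at this
  YT α i j k h1 h2 h3 := by
    have := quotHom_relator (.tL2y α i j k h1 h2 h3)
    rwa [LieHom.map_lie] at this
  TTT α β i j k h1 h2 h3 := by
    have := quotHom_relator (.t4T1 α β i j k h1 h2 h3)
    rwa [LieHom.map_lie, map_add] at this
  XXT α i j h := by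
    have := quotHom_relator (.t4T2x α i j h)
    rwa [LieHom.map_lie, map_add] at this
  YYT α i j h := by
    have := quotHom_relator (.t4T2y α i j h)
    rwa [LieHom.map_lie, map_add] at this

namespace WeightedGens

variable {L : Type} [LieRing L] [LieAlgebra ℂ L] (W : WeightedGens L)

/-- This gains one degree over `ad_pow_mem`, since u itself has weight at least 1. Hence the power D
of ad already vanishes in the truncation of index D + 1. -/
theorem ad_pow_mem_succ (m : ℕ) (a u : L) :
    ((LieAlgebra.ad ℂ L a) ^ m) u ∈ W.monoSpan (m + 1) := by
  induction m with
  | zero => rw [W.monoSpan_one]; trivial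
  | succ m ih =>
    rw [pow_succ', Module.End.mul_apply, LieAlgebra.ad_apply, add_comm]
    exact W.lie_mem_monoSpan (by rw [W.monoSpan_one]; trivial) ih

theorem ad_pow_eq_zero_of_le {D p : ℕ} (h : D ≤ p) (a u : W.Trunc (D + 1)) :
    (adE a ^ p) u = 0 := by
  obtain ⟨a, rfl⟩ := W.proj_surj _ a
  obtain ⟨u, rfl⟩ := W.proj_surj _ u
  rw [← proj_ad_pow]
  exact W.proj_eq_zero.2 (W.monoSpan_anti (by omega) (W.ad_pow_mem_succ p a u))

theorem lie_ad_pow_eq_zero_of_le {D p q : ℕ} (h : D ≤ p + q) (a b u v : W.Trunc (D + 1)) :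
    ⁅(adE a ^ p) u, (adE b ^ q) v⁆ = 0 := by
  obtain ⟨a, rfl⟩ := W.proj_surj _ a
  obtain ⟨b, rfl⟩ := W.proj_surj _ b
  obtain ⟨u, rfl⟩ := W.proj_surj _ u
  obtain ⟨v, rfl⟩ := W.proj_surj _ v
  rw [← proj_ad_pow, ← proj_ad_pow, ← proj_lie]
  exact W.proj_eq_zero.2 (W.monoSpan_anti (by omega)
    (W.lie_mem_monoSpan (W.ad_pow_mem_succ p a u) (W.ad_pow_mem_succ q b v)))

theorem trunc_zero_eq (a b : W.Trunc 0) : a = b := by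
  have h : ∀ a : W.Trunc 0, a = 0 := fun a => by
    obtain ⟨a, rfl⟩ := W.proj_surj _ a
    exact W.proj_eq_zero.2 (W.monoSpan_anti (Nat.zero_le 1) (by rw [W.monoSpan_one]; trivial))
  rw [h a, h b]

/-- The truncation of index 0 is trivial, so components may be written with index D + 1, D being the
nilpotency bound. -/
theorem hat_ext {a b : W.Hat} (h : ∀ D, a.1 (D + 1) = b.1 (D + 1)) : a = b := by
  refine Subtype.ext (funext fun d => ?_)
  rcases d with _ | D
  · exact W.trunc_zero_eq _ _
  · exact h D

/-- The component of index `d`. -/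
def comp (d : ℕ) : W.Hat →ₗ[ℂ] W.Trunc d := (LinearMap.proj d).comp W.hatSubmodule.subtype

theorem comp_apply (d : ℕ) (a : W.Hat) : W.comp d a = a.1 d := rfl

end WeightedGens

theorem ellRel_trunc (d : ℕ) :
    EllRel (fun i => (hx (M := M) (N := N) (n := n) i).1 d) (fun i => (hy i).1 d)
      (fun α i j => (ht α i j).1 d) :=
  ellRel_T1.map (quotHom ((tGens M N n).fil d))

variable (τ : ℍ)

/-- The arguments form an arbitrary matrix so that both z_i - z_j and a single prescribed pair of
arguments are covered. -/
theorem Kij_trunc (D : ℕ) (i j : Fin n) (ζ : Fin n → Fin n → ℂ) :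
    (Kij (M := M) (N := N) τ i j (ζ i j)).1 (D + 1) =
      KijAbs (fun i => (hx (M := M) (N := N) i).1 (D + 1)) (fun α i j => (ht α i j).1 (D + 1)) D
        (fun i j α m => kronCoeff τ α (ζ i j) m) i j := by
  rw [← WeightedGens.comp_apply, Kij, map_sum]
  rfl

theorem K_trunc (D : ℕ) (i : Fin n) (z : Fin n → ℂ) :
    (K (M := M) (N := N) τ i z).1 (D + 1) =
      KAbs (fun i => (hx (M := M) (N := N) i).1 (D + 1)) (fun i => (hy i).1 (D + 1))
        (fun α i j => (ht α i j).1 (D + 1)) D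
        (fun i j α m => kronCoeff τ α (z i - z j) m) i := by
  rw [← WeightedGens.comp_apply, K, map_add, map_neg, map_sum, KAbs]
  simp only [WeightedGens.comp_apply, Kij_trunc τ D _ _ (fun i j => z i - z j)]

theorem mem_twistedConf {z : Fin n → ℂ} :
    z ∈ twistedConf M N n τ ↔ ∀ i j, i ≠ j → Regular M N τ (z i - z j) := by
  simp only [regular_iff]; rfl

theorem Kij_neg {i j : Fin n} (hij : i ≠ j) {ζ : ℂ} (h : Regular M N τ ζ) :
    Kij (M := M) (N := N) τ j i (-ζ) = -Kij τ i j ζ := by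
  refine WeightedGens.hat_ext _ fun D => ?_
  -- The matrix is chosen to have entry ζ at (i, j) and -ζ at (j, i).
  have e1 := Kij_trunc (M := M) (N := N) τ D i j (fun a _ => if a = i then ζ else -ζ)
  have e2 := Kij_trunc (M := M) (N := N) τ D j i (fun a _ => if a = i then ζ else -ζ)
  simp only [if_true, hij.symm, if_false] at e1 e2
  change _ = -(Kij (M := M) (N := N) τ i j ζ).1 (D + 1)
  rw [e1, e2]
  refine KijAbs_symm (ellRel_trunc _) hij fun α m => ?_
  simp only [if_true, hij.symm, if_false]
  exact kronCoeff_neg τ h α m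

theorem lie_K {z : Fin n → ℂ} (hz : z ∈ twistedConf M N n τ) (i j : Fin n) :
    ⁅K (M := M) (N := N) τ i z, K (M := M) (N := N) τ j z⁆ = 0 := by
  rw [mem_twistedConf] at hz
  refine WeightedGens.hat_ext _ fun D => ?_
  rw [WeightedGens.hat_lie_apply, K_trunc, K_trunc]
  refine lie_KAbs_eq_zero (ellRel_trunc _)
    (fun p q a b u v h => WeightedGens.lie_ad_pow_eq_zero_of_le _ h a b u v) ?_ ?_ i j
  · intro i j hij α m
    rw [← kronCoeff_neg τ (hz i j hij), neg_sub]
  · intro i j k hij hik hjk α β A B hAB m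
    have hw : z i - z j - lift τ α + (z j - z k - lift τ β) = z i - z k - lift τ α - lift τ β := by
      ring
    refine fay_coeff τ (a₁ := liftTau α) (a₂ := liftTau β) (w₁ := z i - z j - lift τ α)
      (w₂ := z j - z k - lift τ β) (hz i j hij α) (hz j k hjk β) ?_ hAB _ _ _
      (fun m => kronCoeff_eq τ _ (hz i j hij α) m) (fun m => kronCoeff_eq τ _ (hz j k hjk β) m)
      (fun m => ?_) m
    · rw [hw]; exact (hz i k hik).theta_sub_sub_ne_zero α β
    · rw [hw]; exact kronCoeff_add τ (hz i k hik) α β m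

theorem Ad_exp_apply {L : Type} [LieRing L] [LieAlgebra ℂ L] (W : WeightedGens L) (u w : W.Hat) :
    W.Ad (W.exp u) w = W.adSeries (fun k => (k.factorial : ℂ)⁻¹) u w :=
  Subtype.ext (funext fun d => W.expUnit_snd u w d)

theorem Ad_exp_K {z : Fin n → ℂ} (hz : z ∈ twistedConf M N n τ)
    (h : (Fin n → ℤ) × (Fin n → ℤ)) (i : Fin n) :
    (tGens M N n).Ad ((tGens M N n).exp ((bundle M N n τ).coc h)) (K τ i z) =
      K τ i (z + (bundle M N n τ).trans h) := by
  rw [mem_twistedConf] at hz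
  refine WeightedGens.hat_ext _ fun D => ?_
  rw [Ad_exp_apply, K_trunc]
  have hcoc : ((bundle M N n τ).coc h).1 (D + 1) = (-(2 * Real.pi * Complex.I) : ℂ) •
      ∑ l, (h.2 l : ℂ) • (hx (M := M) (N := N) l).1 (D + 1) := by
    rw [← WeightedGens.comp_apply]
    change WeightedGens.comp _ _ ((-(2 * Real.pi * Complex.I) : ℂ) • ∑ l, (h.2 l : ℂ) • hx l) = _
    rw [map_smul, map_sum]
    rfl
  change ∑ k ∈ Finset.range (D + 1), (k.factorial : ℂ)⁻¹ •
    (adE (((bundle M N n τ).coc h).1 (D + 1)) ^ k) ((K τ i z).1 (D + 1)) = _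
  rw [hcoc, K_trunc]
  refine exp_KAbs (ellRel_trunc _) (fun p a u hp => WeightedGens.ad_pow_eq_zero_of_le _ hp a u)
    _ _ _ _ i fun j hij α m => ?_
  -- The difference z_i - z_j moves by the difference of the lattice vectors, so the exponent -2πi
  -- (b_i - b_j) agrees with the eigenvalue of the cocycle on the ij terms.
  have := kronCoeff_add_lattice τ (hz i j hij) α (h.1 i - h.1 j) (h.2 i - h.2 j) m
  push_cast at this
  rw [← this]
  congr 1
  simp only [Pi.add_apply, bundle]
  ring

end Trunc

/-! ### Analyticity and meromorphy -/

section Analytic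

variable {M N n : ℕ} [NeZero M] [NeZero N] (τ : ℍ)

/-- The product of `θ(ζ - α̃)` and the coefficient of `x ^ m` in `k_α(x, ζ)`, as an entire function
of `ζ`. -/
def kronNum (α : ZMod M × ZMod N) (m : ℕ) (ζ : ℂ) : ℂ :=
  ∑ p ∈ Finset.HasAntidiagonal.antidiagonal (m + 1),
    PowerSeries.coeff p.1 (taylor (kronFactor τ (liftTau α))) *
      (iteratedDeriv p.2 (theta τ) (ζ - lift τ α) / p.2.factorial)

theorem kronCoeff_eq_kronNum {α : ZMod M × ZMod N} {ζ : ℂ} (h : theta τ (ζ - lift τ α) ≠ 0)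
    (m : ℕ) : kronCoeff τ α ζ m = (theta τ (ζ - lift τ α))⁻¹ * kronNum τ α m ζ := by
  rw [kronCoeff_eq τ α h, coeff_kronSeries, kronNum]

theorem differentiable_kronNum (α : ZMod M × ZMod N) (m : ℕ) :
    Differentiable ℂ (kronNum τ α m) := by
  have h : ∀ p, Differentiable ℂ (iteratedDeriv p (theta τ)) := fun p =>
    ((differentiable_theta τ).contDiff (n := (⊤ : ℕ∞))).differentiable_iteratedDeriv p
      (by exact_mod_cast WithTop.coe_lt_top p)
  refine Differentiable.fun_sum fun p _ => Differentiable.const_mul ?_ _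
  exact ((h p.2).comp (differentiable_id.sub_const _)).div_const _

theorem eventually_theta_ne_zero {ζ c : ℂ} (h : theta τ (ζ - c) ≠ 0) :
    ∀ᶠ w in 𝓝 ζ, theta τ (w - c) ≠ 0 :=
  ((differentiable_theta τ).continuous.comp (continuous_sub_right c)).continuousAt.eventually_ne h

theorem analyticAt_kronCoeff {α : ZMod M × ZMod N} {ζ : ℂ} (h : theta τ (ζ - lift τ α) ≠ 0)
    (m : ℕ) : AnalyticAt ℂ (fun w => kronCoeff τ α w m) ζ := by
  have h1 : AnalyticAt ℂ (fun w => (theta τ (w - lift τ α))⁻¹ * kronNum τ α m w) ζ :=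
    ((((differentiable_theta τ).comp (differentiable_id.sub_const (lift τ α))).analyticAt ζ).inv
      h).mul ((differentiable_kronNum τ α m).analyticAt ζ)
  refine h1.congr ?_
  filter_upwards [eventually_theta_ne_zero τ h] with w hw
  exact (kronCoeff_eq_kronNum τ hw m).symm

theorem eventually_regular {ζ : ℂ} (h : Regular M N τ ζ) : ∀ᶠ w in 𝓝 ζ, Regular M N τ w :=
  Filter.eventually_all.2 fun α => eventually_theta_ne_zero τ (h α)

theorem isOpen_twistedConf : IsOpen (twistedConf M N n τ) := by
  rw [isOpen_iff_mem_nhds]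
  intro z hz
  rw [mem_twistedConf] at hz
  have : ∀ᶠ w in 𝓝 z, ∀ i j, i ≠ j → Regular M N τ (w i - w j) := by
    refine Filter.eventually_all.2 fun i => Filter.eventually_all.2 fun j => ?_
    by_cases hij : i = j
    · exact Filter.Eventually.of_forall fun w h => absurd hij h
    · have hc : ContinuousAt (fun w : Fin n → ℂ => w i - w j) z := by fun_prop
      filter_upwards [hc.eventually (eventually_regular τ (hz i j hij))] with w hw _ using hw
  filter_upwards [this] with w hw
  exact (mem_twistedConf τ).2 hw

theorem apply_Kij (d : ℕ) (φ : (tGens M N n).Trunc d →ₗ[ℂ] ℂ) (i j : Fin n) (ζ : ℂ) :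
    φ ((Kij τ i j ζ).1 d) = ∑ α : ZMod M × ZMod N, ∑ m ∈ Finset.range d, kronCoeff τ α ζ m *
      φ ((LieAlgebra.ad ℂ _ ((hx (M := M) (N := N) i).1 d) ^ m) ((ht α i j).1 d)) := by
  rw [← WeightedGens.comp_apply, Kij, map_sum, map_sum]
  refine Finset.sum_congr rfl fun α _ => ?_
  change φ (∑ m ∈ Finset.range d, kronCoeff τ α ζ m •
    (LieAlgebra.ad ℂ _ ((hx (M := M) (N := N) i).1 d) ^ m) ((ht α i j).1 d)) = _
  rw [map_sum]
  simp only [map_smul, smul_eq_mul]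

theorem apply_K (d : ℕ) (φ : (tGens M N n).Trunc d →ₗ[ℂ] ℂ) (i : Fin n) (z : Fin n → ℂ) :
    φ ((K τ i z).1 d) = -φ ((hy (M := M) (N := N) i).1 d) +
      ∑ j ∈ Finset.univ.erase i, φ ((Kij (M := M) (N := N) τ i j (z i - z j)).1 d) := by
  rw [← WeightedGens.comp_apply, K, map_add, map_neg, map_sum, map_add, map_neg, map_sum]
  rfl

theorem analyticAt_Kij (d : ℕ) (φ : (tGens M N n).Trunc d →ₗ[ℂ] ℂ) (i j : Fin n) {ζ : ℂ}
    (h : Regular M N τ ζ) : AnalyticAt ℂ (fun w => φ ((Kij (M := M) (N := N) τ i j w).1 d)) ζ := by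
  simp only [apply_Kij]
  exact Finset.analyticAt_fun_sum _ fun α _ => Finset.analyticAt_fun_sum _ fun m _ =>
    (analyticAt_kronCoeff τ (h α) m).mul analyticAt_const

theorem analyticAt_coord_sub (i j : Fin n) (z : Fin n → ℂ) :
    AnalyticAt ℂ (fun w : Fin n → ℂ => w i - w j) z :=
  ((ContinuousLinearMap.proj (R := ℂ) (φ := fun _ : Fin n => ℂ) i).analyticAt z).sub
    ((ContinuousLinearMap.proj (R := ℂ) (φ := fun _ : Fin n => ℂ) j).analyticAt z)

theorem analyticAt_K (d : ℕ) (φ : (tGens M N n).Trunc d →ₗ[ℂ] ℂ) (i : Fin n) {z : Fin n → ℂ}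
    (hz : z ∈ twistedConf M N n τ) :
    AnalyticAt ℂ (fun w => φ ((K (M := M) (N := N) τ i w).1 d)) z := by
  rw [mem_twistedConf] at hz
  simp only [apply_K]
  refine analyticAt_const.add (Finset.analyticAt_fun_sum _ fun j hj => ?_)
  exact (analyticAt_Kij τ d φ i j (hz i j (Finset.ne_of_mem_erase hj).symm)).comp
    (f := fun w : Fin n → ℂ => w i - w j) (analyticAt_coord_sub i j z)

/-- The product of θ(z_i - z_j - α̃) over all j ≠ i and all α is a common denominator for every
truncated component. -/
theorem meromorphic_K (i : Fin n) :
    MeromorphicWithPolesOff (twistedConf M N n τ) (K (M := M) (N := N) τ i) := by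
  intro d φ
  refine ⟨fun z hz => analyticAt_K τ d φ i hz, fun z₀ => ?_⟩
  let S : Finset (Fin n × (ZMod M × ZMod N)) := (Finset.univ.erase i) ×ˢ Finset.univ
  let th : Fin n × (ZMod M × ZMod N) → (Fin n → ℂ) → ℂ := fun p z =>
    theta τ (z i - z p.1 - lift τ p.2)
  let num : Fin n × (ZMod M × ZMod N) → (Fin n → ℂ) → ℂ := fun p z =>
    ∑ m ∈ Finset.range d, kronNum τ p.2 m (z i - z p.1) *
      φ ((LieAlgebra.ad ℂ _ ((hx (M := M) (N := N) i).1 d) ^ m) ((ht p.2 i p.1).1 d))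
  have hth : ∀ p, AnalyticAt ℂ (th p) z₀ := fun p =>
    (((differentiable_theta τ).comp (differentiable_id.sub_const (lift τ p.2))).analyticAt _).comp
      (f := fun w : Fin n → ℂ => w i - w p.1) (analyticAt_coord_sub i p.1 z₀)
  have hnum : ∀ p, AnalyticAt ℂ (num p) z₀ := fun p =>
    Finset.analyticAt_fun_sum _ fun m _ => AnalyticAt.mul
      (((differentiable_kronNum τ p.2 m).analyticAt _).comp
        (f := fun w : Fin n → ℂ => w i - w p.1) (analyticAt_coord_sub i p.1 z₀)) analyticAt_const
  refine ⟨fun z => (∏ p ∈ S, th p z) * -φ ((hy (M := M) (N := N) i).1 d) +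
      ∑ p ∈ S, (∏ q ∈ S.erase p, th q z) * num p z, fun z => ∏ p ∈ S, th p z,
    ((Finset.analyticAt_fun_prod _ fun p _ => hth p).mul analyticAt_const).add
      (Finset.analyticAt_fun_sum _ fun p _ =>
        (Finset.analyticAt_fun_prod _ fun q _ => hth q).mul (hnum p)),
    Finset.analyticAt_fun_prod _ fun p _ => hth p, ?_, ?_⟩
  · intro hev
    -- On the line through z₀ in the i-th direction each theta factor has countably many zeros, so
    -- their product is nonzero at points arbitrarily close to z₀.
    have hc : Filter.Tendsto (fun t : ℂ => z₀ + t • (Pi.single i 1 : Fin n → ℂ)) (𝓝 0) (𝓝 z₀) := by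
      have : Continuous (fun t : ℂ => z₀ + t • (Pi.single i 1 : Fin n → ℂ)) := by fun_prop
      simpa using this.tendsto 0
    have hev' := hc.eventually hev
    have hcount : (⋃ p ∈ S, {t : ℂ | theta τ (t + (z₀ i - z₀ p.1 - lift τ p.2)) = 0}).Countable :=
      S.countable_toSet.biUnion fun p _ => countable_theta_zeros τ _
    obtain ⟨t, ht, ht'⟩ := (hcount.dense_compl ℂ).inter_nhds_nonempty hev'
    simp only [Set.mem_compl_iff, Set.mem_iUnion, not_exists, Set.mem_ofPred_eq] at ht
    refine Finset.prod_ne_zero_iff.2 (fun p hp => ?_) ht'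
    have hpi : p.1 ≠ i := Finset.ne_of_mem_erase (Finset.mem_product.1 hp).1
    have := ht p hp
    convert this using 2
    simp [hpi]
    ring
  · refine Filter.Eventually.of_forall fun z hz => ?_
    rw [mem_twistedConf] at hz
    dsimp only
    rw [apply_K, mul_add, Finset.mul_sum, Finset.sum_product]
    congr 1
    refine Finset.sum_congr rfl fun j hj => ?_
    rw [apply_Kij, Finset.mul_sum]
    refine Finset.sum_congr rfl fun α _ => ?_
    have hmem : (j, α) ∈ S := Finset.mem_product.2 ⟨hj, Finset.mem_univ _⟩
    have hne := hz i j (Finset.ne_of_mem_erase hj).symm α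
    rw [← Finset.mul_prod_erase S (fun p => th p z) hmem, Finset.mul_sum, Finset.mul_sum]
    refine Finset.sum_congr rfl fun m _ => ?_
    rw [kronCoeff_eq_kronNum τ hne]
    change theta τ (z i - z j - lift τ α) * _ * _ = _
    field_simp

end Analytic

/-! ### The connection given by an equivariant local form -/

section Connections

variable {L : Type} [LieRing L] [LieAlgebra ℂ L] {W : WeightedGens L}
variable {V : Type} [AddCommGroup V] [Module ℂ V] [TopologicalSpace V]

theorem WeightedGens.Ad_mul (g h : W.ExpGroup) (w : W.Hat) :
    W.Ad (g * h) w = W.Ad g (W.Ad h w) := rfl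

theorem WeightedGens.Ad_one (w : W.Hat) : W.Ad 1 w = w := rfl

/-- The connection form `(z, g) ↦ ((v, u) ↦ Ad g⁻¹ (a z v) + u)`. -/
def CocycleData.formOf (B : CocycleData W V) (a : V → V →ₗ[ℂ] W.Hat)
    (ha : ∀ z ∈ B.Y, ∀ h v, a (z + B.trans h) v = W.Ad (W.exp (B.coc h)) (a z v)) :
    B.Total → (V × W.Hat →ₗ[ℂ] W.Hat) :=
  Quot.lift (fun p => (W.Ad p.2⁻¹ ∘ₗ a p.1) ∘ₗ LinearMap.fst ℂ V W.Hat + LinearMap.snd ℂ V W.Hat)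
    (by
      rintro ⟨z, g⟩ ⟨z', g'⟩ ⟨h, h1, h2⟩
      refine LinearMap.ext fun ⟨v, u⟩ => ?_
      change W.Ad g⁻¹ (a z v) + u = W.Ad g'⁻¹ (a z' v) + u
      dsimp only at h1 h2
      -- Here g' is exp(coc h) g, and Ad g'⁻¹ undoes the conjugation by exp(coc h) supplied by ha,
      -- so the form is constant on orbits.
      rw [h1, h2, ha z z.2, ← WeightedGens.Ad_mul, mul_inv_rev, inv_mul_cancel_right])

theorem CocycleData.pullForm_formOf (B : CocycleData W V) (a : V → V →ₗ[ℂ] W.Hat)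
    (ha : ∀ z ∈ B.Y, ∀ h v, a (z + B.trans h) v = W.Ad (W.exp (B.coc h)) (a z v))
    {z : V} (hz : z ∈ B.Y) (v : V) : B.pullForm (B.formOf a ha) z v = a z v := by
  rw [pullForm, dif_pos hz]
  change W.Ad (1 : W.ExpGroup)⁻¹ (a z v) + 0 = a z v
  rw [inv_one, WeightedGens.Ad_one, add_zero]

/-- The connection with local form `a`. -/
def CocycleData.connectionOf (B : CocycleData W V) (a : V → V →ₗ[ℂ] W.Hat)
    (ha : ∀ z ∈ B.Y, ∀ h v, a (z + B.trans h) v = W.Ad (W.exp (B.coc h)) (a z v))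
    (hol : ∀ (v : V) (d : ℕ) (φ : W.Trunc d →ₗ[ℂ] ℂ),
      DifferentiableOn ℂ (fun z => φ ((a z v).1 d)) B.Y) : Connection B where
  form := B.formOf a ha
  vertical p u := by
    obtain ⟨⟨z, g⟩, rfl⟩ := Quot.exists_rep p
    change W.Ad g⁻¹ (a z 0) + u = u
    rw [map_zero, map_zero, zero_add]
  equivariant p g v u := by
    obtain ⟨⟨z, k⟩, rfl⟩ := Quot.exists_rep p
    change W.Ad (k * g)⁻¹ (a z v) + W.Ad g⁻¹ u = W.Ad g⁻¹ (W.Ad k⁻¹ (a z v) + u)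
    rw [map_add, mul_inv_rev, WeightedGens.Ad_mul]
  holomorphic v d φ := (hol v d φ).congr fun z hz => by
    rw [B.pullForm_formOf a ha hz]

theorem CocycleData.localForm_connectionOf (B : CocycleData W V) (a : V → V →ₗ[ℂ] W.Hat)
    (ha : ∀ z ∈ B.Y, ∀ h v, a (z + B.trans h) v = W.Ad (W.exp (B.coc h)) (a z v))
    (hol : ∀ (v : V) (d : ℕ) (φ : W.Trunc d →ₗ[ℂ] ℂ),
      DifferentiableOn ℂ (fun z => φ ((a z v).1 d)) B.Y) {z : V} (hz : z ∈ B.Y) (v : V) :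
    (B.connectionOf a ha hol).localForm z v = a z v :=
  B.pullForm_formOf a ha hz v

end Connections

/-! ### The universal connection and its flatness -/

section KZB

variable {M N n : ℕ} [NeZero M] [NeZero N] (τ : ℍ)

/-- The local form `-∑ i, K i dz i`. -/
def kzbForm (z : Fin n → ℂ) : (Fin n → ℂ) →ₗ[ℂ] (tGens M N n).Hat :=
  -∑ i, (LinearMap.proj i : (Fin n → ℂ) →ₗ[ℂ] ℂ).smulRight (K τ i z)

theorem kzbForm_apply (z v : Fin n → ℂ) :
    kzbForm (M := M) (N := N) τ z v = -∑ i, v i • K τ i z := by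
  simp [kzbForm, LinearMap.sum_apply]

theorem kzbForm_add_trans {z : Fin n → ℂ} (hz : z ∈ (bundle M N n τ).Y)
    (h : (bundle M N n τ).H) (v : Fin n → ℂ) :
    kzbForm (M := M) (N := N) τ (z + (bundle M N n τ).trans h) v =
      (tGens M N n).Ad ((tGens M N n).exp ((bundle M N n τ).coc h)) (kzbForm τ z v) := by
  rw [kzbForm_apply, kzbForm_apply, map_neg, map_sum]
  simp only [map_smul, Ad_exp_K τ hz h]

theorem apply_kzbForm (d : ℕ) (φ : (tGens M N n).Trunc d →ₗ[ℂ] ℂ) (z v : Fin n → ℂ) :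
    φ ((kzbForm τ z v).1 d) = -∑ i, v i * φ ((K (M := M) (N := N) τ i z).1 d) := by
  rw [← WeightedGens.comp_apply, kzbForm_apply, map_neg, map_sum, map_neg, map_sum]
  simp only [map_smul, smul_eq_mul]
  rfl

theorem differentiableOn_kzbForm (v : Fin n → ℂ) (d : ℕ) (φ : (tGens M N n).Trunc d →ₗ[ℂ] ℂ) :
    DifferentiableOn ℂ (fun z => φ ((kzbForm (M := M) (N := N) τ z v).1 d))
      (twistedConf M N n τ) := by
  intro z hz
  simp only [apply_kzbForm]
  refine DifferentiableAt.differentiableWithinAt ?_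
  exact (DifferentiableAt.fun_sum fun i _ =>
    ((analyticAt_K τ d φ i hz).differentiableAt).const_mul _).fun_neg

variable (M N n) in
/-- The universal twisted elliptic connection. -/
def kzb : Connection (bundle M N n τ) :=
  (bundle M N n τ).connectionOf (kzbForm τ) (fun _ hz h v => kzbForm_add_trans τ hz h v)
    (differentiableOn_kzbForm τ)

theorem localForm_kzb {z : Fin n → ℂ} (hz : z ∈ twistedConf M N n τ) (v : Fin n → ℂ) :
    (kzb M N n τ).localForm z v = kzbForm τ z v :=
  (bundle M N n τ).localForm_connectionOf (kzbForm τ) (fun _ hz h v => kzbForm_add_trans τ hz h v)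
    (differentiableOn_kzbForm τ) hz v

theorem hasLineDerivAt_apply_kzbForm (d : ℕ) (φ : (tGens M N n).Trunc d →ₗ[ℂ] ℂ)
    {z : Fin n → ℂ} (hz : z ∈ twistedConf M N n τ) (v w : Fin n → ℂ) :
    HasLineDerivAt ℂ (fun y => φ ((kzbForm τ y w).1 d))
      (-∑ i, w i * ∑ j ∈ Finset.univ.erase i, (v i - v j) *
        deriv (fun ζ => φ ((Kij (M := M) (N := N) τ i j ζ).1 d)) (z i - z j)) z v := by
  have hz' := hz
  rw [mem_twistedConf] at hz'
  simp only [apply_kzbForm, apply_K]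
  refine HasDerivAt.fun_neg (HasDerivAt.fun_sum fun i _ => HasDerivAt.const_mul _ ?_)
  refine HasDerivAt.const_add _ (HasDerivAt.fun_sum fun j hj => ?_)
  have h1 : HasDerivAt (fun t : ℂ => (z + t • v) i - (z + t • v) j) (v i - v j) 0 := by
    have : HasDerivAt (fun t : ℂ => (z i + t * v i) - (z j + t * v j)) (v i - v j) 0 := by
      simpa using (((hasDerivAt_id (0 : ℂ)).mul_const (v i)).const_add (z i)).fun_sub
        (((hasDerivAt_id (0 : ℂ)).mul_const (v j)).const_add (z j))
    exact this
  have h2 := (analyticAt_Kij τ d φ i j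
    (hz' i j (Finset.ne_of_mem_erase hj).symm)).differentiableAt.hasDerivAt
  rw [mul_comm]
  refine HasDerivAt.comp (𝕜 := ℂ) (0 : ℂ) (h₂ := fun ζ => φ ((Kij (M := M) (N := N) τ i j ζ).1 d))
    (h := fun t : ℂ => (z + t • v) i - (z + t • v) j) ?_ h1
  simpa using h2

/-- The relation K_{ji}(-w) = -K_{ij}(w) holds in a neighbourhood of ζ, and differentiating it
cancels the two signs. -/
theorem deriv_Kij_symm (d : ℕ) (φ : (tGens M N n).Trunc d →ₗ[ℂ] ℂ) {i j : Fin n} (hij : i ≠ j)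
    {ζ : ℂ} (h : Regular M N τ ζ) :
    deriv (fun w => φ ((Kij (M := M) (N := N) τ j i w).1 d)) (-ζ) =
      deriv (fun w => φ ((Kij (M := M) (N := N) τ i j w).1 d)) ζ := by
  have h1 : deriv (fun w => φ ((Kij (M := M) (N := N) τ j i (-w)).1 d)) ζ =
      deriv (fun w => -φ ((Kij (M := M) (N := N) τ i j w).1 d)) ζ := by
    refine Filter.EventuallyEq.deriv_eq ?_
    filter_upwards [eventually_regular τ h] with w hw
    rw [Kij_neg τ hij hw, ← map_neg]
    rfl
  rw [deriv_comp_neg (fun w => φ ((Kij (M := M) (N := N) τ j i w).1 d)), deriv.fun_neg] at h1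
  exact neg_injective h1

theorem sum_erase_antisymm {n : ℕ} {E : Type*} [AddCommGroup E] [IsAddTorsionFree E]
    (F : Fin n → Fin n → E)
    (hF : ∀ i j, i ≠ j → F j i = -F i j) : ∑ i, ∑ j ∈ Finset.univ.erase i, F i j = 0 := by
  have h : ∀ G : Fin n → Fin n → E, ∑ i, ∑ j ∈ Finset.univ.erase i, G i j =
      ∑ i, ∑ j, if i = j then 0 else G i j := fun G => Finset.sum_congr rfl fun i _ => by
    rw [← Finset.sum_erase_add _ _ (Finset.mem_univ i), if_pos rfl, add_zero]
    exact Finset.sum_congr rfl fun j hj => (if_neg (Finset.ne_of_mem_erase hj).symm).symm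
  rw [h]
  refine self_eq_neg.1 ?_
  rw [← Finset.sum_neg_distrib]
  conv_lhs => rw [Finset.sum_comm]
  refine Finset.sum_congr rfl fun i _ => ?_
  rw [← Finset.sum_neg_distrib]
  refine Finset.sum_congr rfl fun j _ => ?_
  by_cases hij : i = j
  · simp [hij]
  · rw [if_neg hij, if_neg (Ne.symm hij), hF i j hij]

/-- In the difference of the two derivatives only (v_j w_i - v_i w_j) K_{ij}'(z_i - z_j) remains, up
to an overall sign. The scalar is antisymmetric in i and j, the derivative is symmetric, and the sum
vanishes. -/
theorem closed_kzbForm (d : ℕ) (φ : (tGens M N n).Trunc d →ₗ[ℂ] ℂ)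
    {z : Fin n → ℂ} (hz : z ∈ twistedConf M N n τ) (v w : Fin n → ℂ) :
    lineDeriv ℂ (fun y => φ ((kzbForm τ y w).1 d)) z v =
      lineDeriv ℂ (fun y => φ ((kzbForm (M := M) (N := N) τ y v).1 d)) z w := by
  rw [(hasLineDerivAt_apply_kzbForm τ d φ hz v w).lineDeriv,
    (hasLineDerivAt_apply_kzbForm τ d φ hz w v).lineDeriv, ← sub_eq_zero, neg_sub_neg,
    ← Finset.sum_sub_distrib]
  simp only [Finset.mul_sum, ← Finset.sum_sub_distrib]
  rw [mem_twistedConf] at hz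
  refine sum_erase_antisymm _ fun i j hij => ?_
  have h := deriv_Kij_symm τ d φ hij (hz i j hij)
  rw [neg_sub] at h
  rw [h]
  ring

theorem lie_kzbForm {z : Fin n → ℂ} (hz : z ∈ twistedConf M N n τ) (v w : Fin n → ℂ) :
    ⁅kzbForm (M := M) (N := N) τ z v, kzbForm (M := M) (N := N) τ z w⁆ = 0 := by
  rw [kzbForm_apply, kzbForm_apply, neg_lie, lie_neg, neg_neg, sum_lie]
  refine Finset.sum_eq_zero fun i _ => ?_
  rw [lie_sum]
  refine Finset.sum_eq_zero fun j _ => ?_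
  rw [smul_lie, lie_smul, lie_K τ hz, smul_zero, smul_zero]

theorem isFlat_kzb : (kzb M N n τ).IsFlat := by
  intro z hz v w d φ
  -- The local form is extended by zero outside Y, so openness of Y is needed to compare derivatives
  -- at z.
  have h : ∀ w : Fin n → ℂ, (fun y => φ (((kzb M N n τ).localForm y w).1 d)) =ᶠ[𝓝 z]
      fun y => φ ((kzbForm τ y w).1 d) := fun w => by
    filter_upwards [(isOpen_twistedConf τ).mem_nhds hz] with y hy
    rw [localForm_kzb τ hy]
  rw [(h w).lineDeriv_eq, (h v).lineDeriv_eq, closed_kzbForm τ d φ hz, sub_self, zero_add,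
    localForm_kzb τ hz, localForm_kzb τ hz, lie_kzbForm τ hz]
  exact map_zero φ

end KZB

/-! ### Morphisms of completions -/

namespace WeightedGens

variable {L : Type} [LieRing L] [LieAlgebra ℂ L] (W : WeightedGens L)
variable {L' : Type} [LieRing L'] [LieAlgebra ℂ L'] (f : L →ₗ⁅ℂ⁆ L') (hf : Function.Surjective f)

theorem pushTrunc_proj (d : ℕ) (u : L) :
    W.pushTrunc f hf d (W.proj d u) = (W.push f hf).proj d (f u) := rfl

theorem pushTrunc_lie (d : ℕ) (a b : W.Trunc d) :
    W.pushTrunc f hf d ⁅a, b⁆ = ⁅W.pushTrunc f hf d a, W.pushTrunc f hf d b⁆ := by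
  obtain ⟨a, rfl⟩ := W.proj_surj d a
  obtain ⟨b, rfl⟩ := W.proj_surj d b
  rw [← proj_lie, pushTrunc_proj, pushTrunc_proj, pushTrunc_proj, LieHom.map_lie, proj_lie]

theorem pushTrunc_ad_pow (d m : ℕ) (a u : W.Trunc d) :
    W.pushTrunc f hf d ((LieAlgebra.ad ℂ (W.Trunc d) a ^ m) u) =
      (LieAlgebra.ad ℂ ((W.push f hf).Trunc d) (W.pushTrunc f hf d a) ^ m)
        (W.pushTrunc f hf d u) := by
  induction m with
  | zero => rfl
  | succ m ih =>
    simp only [pow_succ', Module.End.mul_apply, LieAlgebra.ad_apply, pushTrunc_lie, ih]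

theorem pushHat_lie (a b : W.Hat) :
    W.pushHat f hf ⁅a, b⁆ = ⁅W.pushHat f hf a, W.pushHat f hf b⁆ :=
  Subtype.ext (funext fun d => W.pushTrunc_lie f hf d (a.1 d) (b.1 d))

theorem pushHat_Ad_exp (u w : W.Hat) :
    W.pushHat f hf (W.Ad (W.exp u) w) =
      (W.push f hf).Ad ((W.push f hf).exp (W.pushHat f hf u)) (W.pushHat f hf w) := by
  rw [Ad_exp_apply, Ad_exp_apply]
  refine Subtype.ext (funext fun d => ?_)
  change W.pushTrunc f hf d (∑ m ∈ Finset.range d, (m.factorial : ℂ)⁻¹ •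
    ((LieAlgebra.ad ℂ (W.Trunc d) (u.1 d)) ^ m) (w.1 d)) = ∑ m ∈ Finset.range d, _
  rw [map_sum]
  refine Finset.sum_congr rfl fun m _ => ?_
  rw [map_smul, pushTrunc_ad_pow]
  rfl

end WeightedGens

/-! ### The section of the quotient by the diagonal -/

section Section

variable {n : ℕ} (o : Fin n)

/-- The linear section `[z] ↦ (z i - z o)_i` of the quotient by the diagonal line. -/
def diagSection : ((Fin n → ℂ) ⧸ diagLine n) →ₗ[ℂ] (Fin n → ℂ) :=
  (diagLine n).liftQ
    { toFun := fun z i => z i - z o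
      map_add' := fun z w => funext fun i => add_sub_add_comm (z i) (w i) (z o) (w o)
      map_smul' := fun c z => funext fun i => (mul_sub c (z i) (z o)).symm } (by
    rw [diagLine, Submodule.span_le, Set.singleton_subset_iff, SetLike.mem_coe, LinearMap.mem_ker]
    exact funext fun i => sub_self 1)

theorem diagSection_mk (z : Fin n → ℂ) (i : Fin n) :
    diagSection o ((diagLine n).mkQ z) i = z i - z o := rfl

theorem mkQ_diagSection (z : (Fin n → ℂ) ⧸ diagLine n) :
    (diagLine n).mkQ (diagSection o z) = z := by
  obtain ⟨z, rfl⟩ := (diagLine n).mkQ_surjective z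
  refine (Submodule.Quotient.eq _).2 (Submodule.mem_span_singleton.2 ⟨-z o, ?_⟩)
  ext i
  have h := diagSection_mk o z i
  rw [Submodule.mkQ_apply] at h
  simp [h]

theorem continuous_diagSection : Continuous (diagSection o) := by
  refine continuous_coinduced_dom.2 ?_
  change Continuous fun z : Fin n → ℂ => fun i => z i - z o
  fun_prop

theorem DifferentiableOn.comp_diagSection {F : (Fin n → ℂ) → ℂ} {Y : Set (Fin n → ℂ)}
    {Y' : Set ((Fin n → ℂ) ⧸ diagLine n)} (hF : DifferentiableOn ℂ F Y)
    (hY : Set.MapsTo (diagSection o) Y' Y) :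
    DifferentiableOn ℂ (fun z => F (diagSection o z)) Y' := by
  have : IsClosed (diagLine n : Set (Fin n → ℂ)) := Submodule.closed_of_finiteDimensional _
  let s : ((Fin n → ℂ) ⧸ diagLine n) →L[ℂ] (Fin n → ℂ) :=
    ⟨diagSection o, continuous_diagSection o⟩
  exact hF.comp (f := s) s.differentiable.differentiableOn hY

end Section

/-! ### The reduced connection -/

section Reduced

variable {M N n : ℕ} [NeZero M] [NeZero N] (τ : ℍ) (o : Fin n)

theorem K_congr {z z' : Fin n → ℂ} (h : ∀ i j, z i - z j = z' i - z' j) (i : Fin n) :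
    K (M := M) (N := N) τ i z = K τ i z' := by
  simp only [K, h]

theorem diagSection_mk_sub (z : Fin n → ℂ) (i j : Fin n) :
    diagSection o ((diagLine n).mkQ z) i - diagSection o ((diagLine n).mkQ z) j = z i - z j := by
  rw [diagSection_mk, diagSection_mk]; ring

theorem diagSection_mem {z : (Fin n → ℂ) ⧸ diagLine n} :
    diagSection o z ∈ twistedConf M N n τ ↔ z ∈ (reducedBundle M N n τ).Y := by
  constructor
  · intro h
    exact ⟨_, h, mkQ_diagSection o z⟩
  · rintro ⟨z, hz, rfl⟩
    rw [mem_twistedConf] at hz ⊢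
    simpa only [diagSection_mk_sub] using hz

/-- The K_{ij} cancel in pairs. This computes the value of the form on the diagonal direction, which
therefore reduces to 0. -/
theorem sum_K {z : Fin n → ℂ} (hz : z ∈ twistedConf M N n τ) :
    ∑ i, K (M := M) (N := N) τ i z = -∑ i, hy i := by
  simp only [K, Finset.sum_add_distrib, Finset.sum_neg_distrib]
  rw [mem_twistedConf] at hz
  have : IsAddTorsionFree (tGens M N n).Hat := .of_module_rat _
  rw [sum_erase_antisymm (fun i j => Kij (M := M) (N := N) τ i j (z i - z j)), add_zero]
  intro i j hij
  rw [← Kij_neg τ hij (hz i j hij), neg_sub]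

theorem reduce_sum_hy : reduce M N n (∑ i, hy i) = 0 := by
  have h : (∑ i, hy i : (tGens M N n).Hat) = (tGens M N n).toHat (∑ i, ty i) := by
    rw [map_sum]; rfl
  rw [h]
  change (tbarGens M N n).toHat (quotHom (centerIdeal M N n) (∑ i, ty i)) = 0
  rw [show quotHom (centerIdeal M N n) (∑ i, ty i) = 0 from
    LieSubmodule.Quotient.mk_eq_zero'.2 (LieSubmodule.subset_lieSpan (by simp)), map_zero]

/-- Passing to the section translates z diagonally, which leaves every K_i unchanged, and subtracts
v_o (1, …, 1) from v, which adds v_o ∑ K_i; the latter reduces to 0. So the reduced form does not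
depend on representatives. -/
theorem reduce_kzbForm_diagSection {z : Fin n → ℂ} (hz : z ∈ twistedConf M N n τ)
    (v : Fin n → ℂ) :
    reduce M N n (kzbForm τ (diagSection o ((diagLine n).mkQ z))
      (diagSection o ((diagLine n).mkQ v))) = reduce M N n (kzbForm τ z v) := by
  have h : kzbForm (M := M) (N := N) τ (diagSection o ((diagLine n).mkQ z))
      (diagSection o ((diagLine n).mkQ v)) = kzbForm τ z v + v o • ∑ i, K τ i z := by
    rw [kzbForm_apply, kzbForm_apply, Finset.smul_sum, neg_add_eq_sub, ← Finset.sum_sub_distrib,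
      ← Finset.sum_neg_distrib]
    refine Finset.sum_congr rfl fun i _ => ?_
    rw [K_congr τ (diagSection_mk_sub o z), diagSection_mk, sub_smul, neg_sub]
  rw [h, map_add, map_smul, sum_K τ hz, map_neg, reduce_sum_hy, neg_zero, smul_zero, add_zero]

/-- The local form of the reduced connection. -/
def kzbFormBar (z : (Fin n → ℂ) ⧸ diagLine n) :
    ((Fin n → ℂ) ⧸ diagLine n) →ₗ[ℂ] (tbarGens M N n).Hat :=
  reduce M N n ∘ₗ kzbForm τ (diagSection o z) ∘ₗ diagSection o

/-- The section turns translation by h into translation by h minus its o-th coordinate, so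
equivariance is applied to an arbitrary representative z, and `reduce_kzbForm_diagSection` moves
between z and the section. -/
theorem kzbFormBar_add_trans {z : (Fin n → ℂ) ⧸ diagLine n}
    (hz : z ∈ (reducedBundle M N n τ).Y) (h : (reducedBundle M N n τ).H)
    (v : (Fin n → ℂ) ⧸ diagLine n) :
    kzbFormBar (M := M) (N := N) τ o (z + (reducedBundle M N n τ).trans h) v =
      (tbarGens M N n).Ad ((tbarGens M N n).exp ((reducedBundle M N n τ).coc h))
        (kzbFormBar τ o z v) := by
  obtain ⟨z, hz, rfl⟩ := hz
  obtain ⟨v, rfl⟩ := (diagLine n).mkQ_surjective v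
  have hz' : z + (bundle M N n τ).trans h ∈ twistedConf M N n τ := by
    rw [mem_twistedConf] at hz ⊢
    intro i j hij
    have := (hz i j hij).add_lattice (h.1 i - h.1 j) (h.2 i - h.2 j)
    convert this using 1
    simp only [Pi.add_apply, bundle]
    push_cast
    ring
  change reduce M N n (kzbForm τ (diagSection o ((diagLine n).mkQ z +
    (diagLine n).mkQ ((bundle M N n τ).trans h))) (diagSection o ((diagLine n).mkQ v))) =
    (tbarGens M N n).Ad ((tbarGens M N n).exp (reduce M N n ((bundle M N n τ).coc h)))
      (reduce M N n (kzbForm τ (diagSection o ((diagLine n).mkQ z))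
        (diagSection o ((diagLine n).mkQ v))))
  rw [← map_add, reduce_kzbForm_diagSection τ o hz', reduce_kzbForm_diagSection τ o hz]
  exact (congrArg (reduce M N n) (kzbForm_add_trans τ hz h v)).trans
    (WeightedGens.pushHat_Ad_exp _ _ _ _ _)

theorem differentiableOn_kzbFormBar (v : (Fin n → ℂ) ⧸ diagLine n) (d : ℕ)
    (φ : (tbarGens M N n).Trunc d →ₗ[ℂ] ℂ) :
    DifferentiableOn ℂ (fun z => φ ((kzbFormBar (M := M) (N := N) τ o z v).1 d))
      (reducedBundle M N n τ).Y :=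
  DifferentiableOn.comp_diagSection o
    (differentiableOn_kzbForm τ (diagSection o v) d
      (φ ∘ₗ (tGens M N n).pushTrunc (quotHom (centerIdeal M N n)) (quotHom_surjective _) d))
    fun _ hz => (diagSection_mem τ o).2 hz

variable (M N) in
/-- The reduced universal twisted elliptic connection. -/
def kzbBar : Connection (reducedBundle M N n τ) :=
  (reducedBundle M N n τ).connectionOf (kzbFormBar τ o)
    (fun _ hz h v => kzbFormBar_add_trans τ o hz h v) (differentiableOn_kzbFormBar τ o)

/-- The equality also holds outside Y, where both sides are the zero extension. Line derivatives can
then be compared by rewriting the functions, without restricting to a neighbourhood. -/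
theorem localForm_kzbBar (z v : (Fin n → ℂ) ⧸ diagLine n) :
    (kzbBar M N τ o).localForm z v =
      reduce M N n ((kzb M N n τ).localForm (diagSection o z) (diagSection o v)) := by
  by_cases hz : z ∈ (reducedBundle M N n τ).Y
  · rw [localForm_kzb τ ((diagSection_mem τ o).2 hz)]
    exact (reducedBundle M N n τ).localForm_connectionOf (kzbFormBar τ o)
      (fun _ hz h v => kzbFormBar_add_trans τ o hz h v) (differentiableOn_kzbFormBar τ o) hz v
  · have hz' : diagSection o z ∉ (bundle M N n τ).Y := fun h => hz ((diagSection_mem τ o).1 h)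
    rw [Connection.localForm, Connection.localForm, CocycleData.pullForm, dif_neg hz,
      CocycleData.pullForm, dif_neg hz', map_zero]

/-- The local form is pulled back along a linear section and pushed along a morphism of Lie
algebras. The curvature therefore reduces to the one upstairs, tested against φ composed with the
map of truncations. -/
theorem isFlat_kzbBar : (kzbBar M N τ o).IsFlat := by
  intro z hz v w d φ
  have h := isFlat_kzb τ (diagSection o z) ((diagSection_mem τ o).2 hz) (diagSection o v)
    (diagSection o w) d
    (φ ∘ₗ (tGens M N n).pushTrunc (quotHom (centerIdeal M N n)) (quotHom_surjective _) d)
  have hd : ∀ v w : (Fin n → ℂ) ⧸ diagLine n,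
      lineDeriv ℂ (fun y => φ (((kzbBar M N τ o).localForm y w).1 d)) z v =
      lineDeriv ℂ (fun y => (φ ∘ₗ (tGens M N n).pushTrunc (quotHom (centerIdeal M N n))
        (quotHom_surjective _) d) (((kzb M N n τ).localForm y (diagSection o w)).1 d))
        (diagSection o z) (diagSection o v) := fun v w => by
    simp only [lineDeriv, localForm_kzbBar, map_add, map_smul]
    rfl
  rw [hd, hd, localForm_kzbBar, localForm_kzbBar]
  rw [← h]
  congr 1
  exact congrArg (fun a => φ (a.1 d)) ((tGens M N n).pushHat_lie
    (quotHom (centerIdeal M N n)) (quotHom_surjective _) _ _).symm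

theorem reduce_localForm_kzb {z : Fin n → ℂ} (hz : z ∈ twistedConf M N n τ) (v : Fin n → ℂ) :
    reduce M N n ((kzb M N n τ).localForm z v) =
      (kzbBar M N τ o).localForm ((diagLine n).mkQ z) ((diagLine n).mkQ v) := by
  rw [localForm_kzbBar, localForm_kzb τ hz,
    localForm_kzb τ ((diagSection_mem τ o).2 (Set.mem_image_of_mem _ hz)),
    reduce_kzbForm_diagSection τ o hz]

end Reduced

end EllKZB

end

theorem mainTheorem3 (M N n : ℕ) [NeZero M] [NeZero N] (hn : 1 ≤ n) (τ : UpperHalfPlane) :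
    (∀ i : Fin n, EllKZB.MeromorphicWithPolesOff (EllKZB.twistedConf M N n τ)
      (EllKZB.K (M := M) (N := N) τ i)) ∧
    ∃ A : EllKZB.Connection (EllKZB.bundle M N n τ),
      (∀ z ∈ EllKZB.twistedConf M N n τ, ∀ v : Fin n → ℂ,
        A.localForm z v = -∑ i, v i • EllKZB.K τ i z) ∧
      A.IsFlat ∧
      ∃ Abar : EllKZB.Connection (EllKZB.reducedBundle M N n τ),
        Abar.IsFlat ∧
        ∀ z ∈ EllKZB.twistedConf M N n τ, ∀ v : Fin n → ℂ,
          EllKZB.reduce M N n (A.localForm z v) =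
            Abar.localForm ((EllKZB.diagLine n).mkQ z) ((EllKZB.diagLine n).mkQ v) :=
  ⟨fun i => EllKZB.meromorphic_K τ i, EllKZB.kzb M N n τ,
    fun z hz v => (EllKZB.localForm_kzb τ hz v).trans (EllKZB.kzbForm_apply τ z v),
    -- The bound n ≥ 1 provides the coordinate 0 that normalises the section of the quotient by the
    -- diagonal.
    EllKZB.isFlat_kzb τ, EllKZB.kzbBar M N τ ⟨0, hn⟩, EllKZB.isFlat_kzbBar τ _,
    fun _ hz v => EllKZB.reduce_localForm_kzb τ _ hz v⟩
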